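/- Let $\mathbb K$ be a field. For $\ell\ge 1$ let $Q$ be the ladder quiver of length $\ell$: its vertices are $x_0^+,\dots,x_\ell^+$ and $x_0^-,\dots,x_\ell^-$, and its edges are $x_{i}^{\pm}\to x_{i+1}^{\pm}$ for $0\le i<\ell$ and $x_i^+\to x_i^-$ for $0\le i\le \ell$. A finite-dimensional $\mathbb K$-representation $V$ of $Q$ is *nestfree* if any two paths of $Q$ with the same source and the same target act by the same linear map, and the barcodes of the top row $V^+$ and of the bottom row $V^-$ each contain no pair of strictly nested intervals, i.e. no intervals $[a,b]$, $[c,d]$ with $a<c\le d<b$. (The barcode of a representation of the equioriented line $x_0\to\dots\to x_\ell$ is the multiset of intervals in its decomposition into interval modules.) For a central charge $\alpha:Q_0\to\mathbb R$, the slope of a representation $V\ne 0$ is $\mu_\alpha(V)=\sum_x\alpha(x)\dim V_x\big/\sum_x\dim V_x$; $V$ is $\alpha$-semistable if $\mu_\alpha(U)\le\mu_\alpha(V)$ for every nonzero subrepresentation $U\subset V$; the Harder–Narasimhan (HN) filtration of $V$ is its unique filtration $0=V^0\subsetneq V^1\subsetneq\dots\subsetneq V^n=V$ with $\alpha$-semistable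 quotients $V^i/V^{i-1}$ of strictly decreasing slopes; and the HN type of $V$ along $\alpha$ is the sequence of dimension vectors of these quotients (the empty sequence if $V=0$). A set $A$ of central charges is *complete* on a full subcategory if any two of its objects that have the same HN type along every $\alpha\in A$ are isomorphic. For an integer $k$ and $S\subset Q_0$ let $\mathcal I_S^k$ be the class of indecomposable nestfree representations $I$ with $\sum_x\dim I_x=k$ such that $S$ is the set of minimal vertices of $\{x\mid I_x\ne0\}$, where $x\le y$ means that there is a (possibly trivial) path from $x$ to $y$. Let $\delta_x$ denote the skyscraper central charge ($1$ at $x$ and $0$ at the other vertices). Let $t=(t_{p,q})_{0\le q<p}$ be a family of irrational numbers with $$\frac{q}{p-q}<t_{p,q}<\frac{q+1}{p-(q+1)}\qquad(0\le q<p),$$ where the upper bound is read as $\infty$ if $p=q+1$. Such families exist, even with $t_{p,q}\neq t_{p',q}$ whenever $p\ne p'$. For every such family $t$ the following hold. For every $\ell\ge1$: 1. If $\mathcal I_S^k\neq\emptyset$, then either $S=\{x\}$ for a vertex $x$, or $S=\{x_a^+,x_c^-\}$ with $0\le c<a\le\ell$, and $x$, respectively $(a,c)$, is unique. Put $\alpha_S^k:=\delta_x$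 in the first case and $\alpha_S^k:=\delta_{x_a^+}+t_{k,a-c}\,\delta_{x_c^-}$ in the second. 2. The set $A=A(\ell)=\{\alpha_S^k\mid \mathcal I_S^k\ne\emptyset\}$ is finite and is complete on nestfree ladder persistence modules of length $\ell$. 3. For all $k$ and $S$, the set of dimension vectors $\{\underline{\dim}_I\mid I\in\mathcal I_S^k\}$ is linearly independent in $\mathbb R^{Q_0}$. 4. $|A(\ell)|\le\frac{2\ell^3+3\ell^2+13\ell+12}{6}$, with equality if for every $q$ the numbers $t_{p,q}$, $p>q$, are pairwise distinct. Moreover, $|A(\ell)|=\Theta(\ell^3)$ as $\ell\to\infty$. -/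

import Mathlib

open Filter Asymptotics

universe u

/-! ### Finite-dimensional representations of a quiver -/

/-- A finite-dimensional representation over the field `K` of the quiver with vertex set `Q`. -/
structure QuiverRep (K : Type u) [Field K] (Q : Type) [Quiver.{0} Q] where
  obj : Q → Type u
  [addCommGroup : ∀ x, AddCommGroup (obj x)]
  [module : ∀ x, Module K (obj x)]
  [finite : ∀ x, Module.Finite K (obj x)]
  map : ∀ {x y : Q}, (x ⟶ y) → obj x →ₗ[K] obj y

attribute [instance] QuiverRep.addCommGroup QuiverRep.module QuiverRep.finite

namespace QuiverRep

variable {K : Type u} [Field K] {Q : Type} [Quiver.{0} Q]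

/-- The dimension vector. -/
noncomputable def dimVec (V : QuiverRep K Q) (x : Q) : ℕ := Module.finrank K (V.obj x)

/-- The total dimension. -/
noncomputable def totalDim [Fintype Q] (V : QuiverRep K Q) : ℕ := ∑ x, V.dimVec x

/-- The support: all vertices carrying a nontrivial vector space. -/
def support (V : QuiverRep K Q) : Set Q := {x | Nontrivial (V.obj x)}

/-- The zero representation (up to isomorphism). -/
def IsZero (V : QuiverRep K Q) : Prop := ∀ x, Subsingleton (V.obj x)

/-- The representations `V` and `W` are isomorphic. -/
def Isomorphic (V W : QuiverRep K Q) : Prop :=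
  ∃ φ : ∀ x, V.obj x ≃ₗ[K] W.obj x,
    ∀ (x y : Q) (e : x ⟶ y) (v : V.obj x), φ y (V.map e v) = W.map e (φ x v)

/-- The direct sum of two representations. -/
def prod (V W : QuiverRep K Q) : QuiverRep K Q where
  obj x := V.obj x × W.obj x
  map e := (V.map e).prodMap (W.map e)

/-- The direct sum of a finite family of representations. -/
def directSum {n : ℕ} (V : Fin n → QuiverRep K Q) : QuiverRep K Q where
  obj x := ∀ i, (V i).obj x
  map e := LinearMap.pi fun i => (V i).map e ∘ₗ LinearMap.proj i

/-- A nonzero representation without nontrivial direct sum decompositions. -/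
def IsIndecomposable (V : QuiverRep K Q) : Prop :=
  ¬ V.IsZero ∧ ∀ U W : QuiverRep K Q, V.Isomorphic (U.prod W) → U.IsZero ∨ W.IsZero

/-- The composite linear map along a path. -/
def mapPath (V : QuiverRep K Q) {x : Q} : ∀ {y : Q}, Quiver.Path x y → (V.obj x →ₗ[K] V.obj y)
  | _, .nil => LinearMap.id
  | _, .cons p e => V.map e ∘ₗ V.mapPath p

/-- Any two paths with the same source and the same target act by the same map. -/
def IsEqualised (V : QuiverRep K Q) : Prop :=
  ∀ (x y : Q) (p q : Quiver.Path x y), V.mapPath p = V.mapPath q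

/-- Restriction of a representation along a morphism of quivers. -/
def restrict {P : Type} [Quiver.{0} P] (F : P ⥤q Q) (V : QuiverRep K Q) : QuiverRep K P where
  obj x := V.obj (F.obj x)
  map e := V.map (F.map e)

/-- The minimal vertices of the support for the flow order on vertices, in which `y ≤ x` when
there is a (possibly trivial) path from `y` to `x`. -/
def minSupport (V : QuiverRep K Q) : Set Q :=
  {x ∈ V.support | ∀ y ∈ V.support, Nonempty (Quiver.Path y x) → y = x}

/-! ### Subrepresentations and quotients -/

/-- A subrepresentation: subspaces preserved by all edge maps. -/
@[ext] structure Sub (V : QuiverRep K Q) where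
  carrier : ∀ x, Submodule K (V.obj x)
  stable : ∀ {x y : Q} (e : x ⟶ y), carrier x ≤ (carrier y).comap (V.map e)

namespace Sub

variable {V : QuiverRep K Q}

/-- Vertexwise inclusion. -/
instance : PartialOrder (Sub V) where
  le U W := ∀ x, U.carrier x ≤ W.carrier x
  le_refl _ _ := le_rfl
  le_trans _ _ _ h₁ h₂ x := (h₁ x).trans (h₂ x)
  le_antisymm _ _ h₁ h₂ := Sub.ext (funext fun x => le_antisymm (h₁ x) (h₂ x))

instance : Bot (Sub V) := ⟨⟨fun _ => ⊥, fun _ => bot_le⟩⟩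

instance : Top (Sub V) := ⟨⟨fun _ => ⊤, fun _ _ _ => trivial⟩⟩

/-- A subrepresentation, regarded as a representation. -/
def toRep (U : Sub V) : QuiverRep K Q where
  obj x := U.carrier x
  map e := (V.map e).restrict (U.stable e)

/-- The quotient representation `V / U`. -/
def quotient (U : Sub V) : QuiverRep K Q where
  obj x := V.obj x ⧸ U.carrier x
  map {x y} e := (U.carrier x).mapQ (U.carrier y) (V.map e) (U.stable e)

/-- The intersection `U ∩ W`, as a subrepresentation of `W`. -/
def inside (U W : Sub V) : Sub W.toRep where
  carrier x := (U.carrier x).submoduleOf (W.carrier x)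
  stable e _ hv := U.stable e hv

end Sub

/-! ### Harder-Narasimhan types -/

section HN

variable [Fintype Q]

/-- The slope of a nonzero representation along the central charge `α`. -/
noncomputable def slope (α : Q → ℝ) (V : QuiverRep K Q) : ℝ :=
  (∑ x, α x * (V.dimVec x : ℝ)) / ∑ x, (V.dimVec x : ℝ)

/-- Semistability along `α`: no nonzero subrepresentation has larger slope. -/
def IsSemistable (α : Q → ℝ) (V : QuiverRep K Q) : Prop :=
  ∀ U : Sub V, U ≠ ⊥ → U.toRep.slope α ≤ V.slope α

/-- A Harder-Narasimhan filtration along `α`: a strictly increasing chain from `0` to `V` whose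
successive quotients are semistable with strictly decreasing slopes. -/
structure HNFiltration (α : Q → ℝ) (V : QuiverRep K Q) where
  length : ℕ
  step : Fin (length + 1) → Sub V
  step_zero : step 0 = ⊥
  step_last : step (Fin.last length) = ⊤
  strictMono : StrictMono step
  semistable : ∀ i : Fin length,
    ((step i.castSucc).inside (step i.succ)).quotient.IsSemistable α
  slope_strictAnti : StrictAnti fun i : Fin length =>
    ((step i.castSucc).inside (step i.succ)).quotient.slope α

/-- The list of dimension vectors of the successive quotients of a filtration. -/
noncomputable def HNFiltration.type {α : Q → ℝ} {V : QuiverRep K Q} (F : HNFiltration α V) :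
    List (Q → ℕ) :=
  List.ofFn fun i : Fin F.length =>
    ((F.step i.castSucc).inside (F.step i.succ)).quotient.dimVec

open Classical in
/-- The Harder-Narasimhan type of `V` along `α`, read off from the Harder-Narasimhan filtration,
which always exists and is unique. It is the empty list for the zero representation. -/
noncomputable def hnType (α : Q → ℝ) (V : QuiverRep K Q) : List (Q → ℕ) :=
  if h : Nonempty (HNFiltration α V) then h.some.type else []

/-- The set `A` of central charges is complete on the full subcategory of the representations
satisfying `C`: there, the Harder-Narasimhan types along all members of `A` together determine a
representation up to isomorphism. -/
def IsCompleteOn (A : Set (Q → ℝ)) (C : QuiverRep K Q → Prop) : Prop :=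
  ∀ V W : QuiverRep K Q, C V → C W → (∀ α ∈ A, V.hnType α = W.hnType α) → V.Isomorphic W

end HN

end QuiverRep

/-! ### The equioriented line and its interval modules -/

/-- Vertices `x_0, …, x_ℓ` of the equioriented line quiver. -/
structure LineVertex (ℓ : ℕ) where
  idx : Fin (ℓ + 1)

/-- One edge from `x_i` to `x_{i+1}` for every `i`. -/
inductive LineEdge (ℓ : ℕ) : LineVertex ℓ → LineVertex ℓ → Type
  | edge {i j : Fin (ℓ + 1)} (h : i.val + 1 = j.val) : LineEdge ℓ ⟨i⟩ ⟨j⟩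

instance (ℓ : ℕ) : Quiver.{0} (LineVertex ℓ) := ⟨LineEdge ℓ⟩

/-- The vector space of the interval module on `[a, b]` at the vertex `x_i`: all of `K` for
`a ≤ i ≤ b` and `0` otherwise. -/
def intervalSpace (K : Type u) [Field K] {ℓ : ℕ} (a b i : Fin (ℓ + 1)) : Submodule K K :=
  if a ≤ i ∧ i ≤ b then ⊤ else ⊥

/-- The interval module on `[a, b]`: edge maps are the identity inside of `[a, b]`, and `0`
elsewhere. -/
def intervalModule (K : Type u) [Field K] {ℓ : ℕ} (a b : Fin (ℓ + 1)) :
    QuiverRep K (LineVertex ℓ) where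
  obj x := intervalSpace K a b x.idx
  map {x y} _ :=
    { toFun := fun v => ⟨if a ≤ y.idx ∧ y.idx ≤ b then v.1 else 0, by
        unfold intervalSpace; split_ifs <;> simp⟩
      map_add' := fun v w => by ext; simp only [Submodule.coe_add]; split_ifs <;> simp
      map_smul' := fun c v => by
        ext; simp only [Submodule.coe_smul, RingHom.id_apply]; split_ifs <;> simp }

/-- No barcode of the line representation `W` contains two strictly nested intervals. (The barcode
is the family of intervals in a decomposition of `W` as a direct sum of interval modules.) -/
def HasNoNestedIntervals {K : Type u} [Field K] {ℓ : ℕ} (W : QuiverRep K (LineVertex ℓ)) : Prop :=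
  ∀ (n : ℕ) (a b : Fin n → Fin (ℓ + 1)), (∀ i, a i ≤ b i) →
    W.Isomorphic (QuiverRep.directSum fun i => intervalModule K (a i) (b i)) →
      ¬ ∃ i j, a i < a j ∧ b j < b i

/-! ### Ladder quivers and nestfree representations -/

/-- Vertices of the ladder quiver of length `ℓ`: `top i` is `x_i^+`, and `bot i` is `x_i^-`. -/
inductive LadderVertex (ℓ : ℕ) where
  | top (i : Fin (ℓ + 1))
  | bot (i : Fin (ℓ + 1))
  deriving DecidableEq, Fintype

/-- Edges of the ladder quiver. -/
inductive LadderEdge (ℓ : ℕ) : LadderVertex ℓ → LadderVertex ℓ → Type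
  | top {i j : Fin (ℓ + 1)} (h : i.val + 1 = j.val) : LadderEdge ℓ (.top i) (.top j)
  | bot {i j : Fin (ℓ + 1)} (h : i.val + 1 = j.val) : LadderEdge ℓ (.bot i) (.bot j)
  | down (i : Fin (ℓ + 1)) : LadderEdge ℓ (.top i) (.bot i)

instance (ℓ : ℕ) : Quiver.{0} (LadderVertex ℓ) := ⟨LadderEdge ℓ⟩

/-- The inclusion of the top row. -/
def topRow (ℓ : ℕ) : LineVertex ℓ ⥤q LadderVertex ℓ where
  obj x := .top x.idx
  map e := match e with | .edge h => .top h

/-- The inclusion of the bottom row. -/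
def botRow (ℓ : ℕ) : LineVertex ℓ ⥤q LadderVertex ℓ where
  obj x := .bot x.idx
  map e := match e with | .edge h => .bot h

/-- Nestfree ladder persistence modules. -/
structure IsNestfree {K : Type u} [Field K] {ℓ : ℕ} (V : QuiverRep K (LadderVertex ℓ)) : Prop where
  equalised : V.IsEqualised
  top : HasNoNestedIntervals (V.restrict (topRow ℓ))
  bot : HasNoNestedIntervals (V.restrict (botRow ℓ))

/-- The class `I_S^k` of indecomposable nestfree representations of total dimension `k` whose
support has `S` as its set of minimal vertices. -/
def ladderClass (K : Type u) [Field K] (ℓ k : ℕ) (S : Set (LadderVertex ℓ)) :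
    Set (QuiverRep K (LadderVertex ℓ)) :=
  {V | V.IsIndecomposable ∧ IsNestfree V ∧ V.totalDim = k ∧ V.minSupport = S}

/-! ### The central charges -/

/-- The skyscraper central charge at `x`. -/
def skyscraper {ℓ : ℕ} (x : LadderVertex ℓ) : LadderVertex ℓ → ℝ := Pi.single x 1

/-- Irrational parameters `t p q`, for `0 ≤ q < p`, which satisfy
`q / (p - q) < t p q < (q + 1) / (p - (q + 1))`, where the upper bound is read as `∞` if
`p = q + 1`. -/
def IsAdmissibleParam (t : ℕ → ℕ → ℝ) : Prop :=
  ∀ p q : ℕ, q < p → Irrational (t p q) ∧ (q : ℝ) / ((p : ℝ) - q) < t p q ∧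
    (q + 1 < p → t p q < ((q : ℝ) + 1) / ((p : ℝ) - ((q : ℝ) + 1)))

/-- For each `q`, the parameters `t p q` with `p > q` are pairwise distinct. -/
def IsDistinctParam (t : ℕ → ℕ → ℝ) : Prop :=
  ∀ q : ℕ, Set.InjOn (fun p => t p q) {p | q < p}

/-- `α` is the central charge `α_S^k`, that is, `δ_x` if `S = {x}`, and `δ_y + t_{k,a-c} δ_z` if
`S = {y, z}` with `y = x_a^+`, `z = x_c^-` and `c < a`. -/
def IsLadderCharge (t : ℕ → ℕ → ℝ) {ℓ : ℕ} (k : ℕ) (S : Set (LadderVertex ℓ))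
    (α : LadderVertex ℓ → ℝ) : Prop :=
  (∃ x, S = {x} ∧ α = skyscraper x) ∨
  (∃ a c : Fin (ℓ + 1), c < a ∧ S = {.top a, .bot c} ∧
    α = skyscraper (.top a) + t k (a.val - c.val) • skyscraper (.bot c))

/-- The set of all the central charges `α_S^k` with `I_S^k` nonempty. -/
def ladderCharges (K : Type u) [Field K] (ℓ : ℕ) (t : ℕ → ℕ → ℝ) : Set (LadderVertex ℓ → ℝ) :=
  {α | ∃ k S, (ladderClass K ℓ k S).Nonempty ∧ IsLadderCharge t k S α}

/-!
A nestfree representation is a direct sum of thin representations supported on blocks, because the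
absence of nested intervals makes the images and the kernels of the transition maps of each row
comparable. Along a central charge `α`, the Harder-Narasimhan subquotient of slope `θ` is the
quotient of the largest by the smallest subrepresentation that maximises the dimension weighted by
`α - θ`. Its dimension vector is therefore additive in direct sums and can be computed block by
block. For `α = α_S^k` and a suitable `θ`, a block `P` contributes the up-set of `P` generated by
`S` if this is the support of a member of `I_S^k`, and nothing otherwise: the irrationality of
`t_{p,q}` rules out coincidences of slopes, and its bounds say that exactly the members of `I_S^k`
are semistable. As the dimension vectors of these members are linearly independent, the
Harder-Narasimhan types count, for every block `R`, the blocks `P` in which the minimal vertices of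
`R` generate `R`. Then `R ⊆ P`, so the matrix of these counts is unitriangular and the
multiplicities of the blocks can be recovered.
-/

namespace QuiverRep

/-! ### Morphisms and direct summands -/

section Morphisms

variable {K : Type u} [Field K] {Q : Type} [Quiver.{0} Q] {U V W : QuiverRep K Q}

/-- A morphism of representations. -/
structure Hom (V W : QuiverRep K Q) where
  app : ∀ x, V.obj x →ₗ[K] W.obj x
  naturality : ∀ {x y : Q} (e : x ⟶ y) (v : V.obj x), app y (V.map e v) = W.map e (app x v)

theorem Hom.app_mapPath (φ : Hom V W) {x y : Q} (p : Quiver.Path x y) (v : V.obj x) :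
    φ.app y (V.mapPath p v) = W.mapPath p (φ.app x v) := by
  induction p with
  | nil => rfl
  | cons p e ih => simp only [mapPath, LinearMap.comp_apply, φ.naturality, ih]

/-- The inclusion of the first summand. -/
def Hom.inl (V W : QuiverRep K Q) : Hom V (V.prod W) where
  app x := LinearMap.inl K (V.obj x) (W.obj x)
  naturality e _ := Prod.ext rfl (map_zero (W.map e)).symm

/-- The inclusion of the second summand. -/
def Hom.inr (V W : QuiverRep K Q) : Hom W (V.prod W) where
  app x := LinearMap.inr K (V.obj x) (W.obj x)
  naturality e _ := Prod.ext (map_zero (V.map e)).symm rfl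

/-- The projection to the first summand. -/
def Hom.fst (V W : QuiverRep K Q) : Hom (V.prod W) V where
  app x := LinearMap.fst K (V.obj x) (W.obj x)
  naturality _ _ := rfl

/-- The projection to the second summand. -/
def Hom.snd (V W : QuiverRep K Q) : Hom (V.prod W) W where
  app x := LinearMap.snd K (V.obj x) (W.obj x)
  naturality _ _ := rfl

theorem Isomorphic.refl (V : QuiverRep K Q) : V.Isomorphic V :=
  ⟨fun _ => LinearEquiv.refl K _, fun _ _ _ _ => rfl⟩

theorem Isomorphic.symm (h : V.Isomorphic W) : W.Isomorphic V := by
  obtain ⟨φ, hφ⟩ := h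
  refine ⟨fun x => (φ x).symm, fun x y e v => ?_⟩
  rw [LinearEquiv.symm_apply_eq, hφ, LinearEquiv.apply_symm_apply]

theorem Isomorphic.trans (h : U.Isomorphic V) (h' : V.Isomorphic W) : U.Isomorphic W := by
  obtain ⟨φ, hφ⟩ := h
  obtain ⟨ψ, hψ⟩ := h'
  exact ⟨fun x => (φ x).trans (ψ x), fun x y e v => by simp [hφ, hψ]⟩

theorem Isomorphic.exists_inverse_homs (h : V.Isomorphic W) :
    ∃ (φ : Hom V W) (ψ : Hom W V), (∀ x v, ψ.app x (φ.app x v) = v) ∧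
      ∀ x w, φ.app x (ψ.app x w) = w := by
  obtain ⟨φ, hφ⟩ := h
  exact ⟨⟨fun x => φ x, fun {x y} e => hφ x y e⟩, ⟨fun x => (φ x).symm, fun e v =>
    (LinearEquiv.symm_apply_eq _).mpr (by simp [hφ])⟩, by simp, by simp⟩

theorem Isomorphic.prod_congr {V' W' : QuiverRep K Q} (h : V.Isomorphic V')
    (h' : W.Isomorphic W') : (V.prod W).Isomorphic (V'.prod W') := by
  obtain ⟨φ, hφ⟩ := h
  obtain ⟨ψ, hψ⟩ := h'
  exact ⟨fun x => (φ x).prodCongr (ψ x),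
    fun x y e v => Prod.ext (hφ x y e v.1) (hψ x y e v.2)⟩

theorem isomorphic_prod_comm (V W : QuiverRep K Q) : (V.prod W).Isomorphic (W.prod V) :=
  ⟨fun _ => LinearEquiv.prodComm K _ _, fun _ _ _ _ => rfl⟩

theorem isomorphic_prod_left_comm (U V W : QuiverRep K Q) :
    (U.prod (V.prod W)).Isomorphic (V.prod (U.prod W)) :=
  ⟨fun _ =>
    { toFun := fun v => (v.2.1, v.1, v.2.2)
      invFun := fun v => (v.2.1, v.1, v.2.2)
      left_inv := fun _ => rfl
      right_inv := fun _ => rfl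
      map_add' := fun _ _ => rfl
      map_smul' := fun _ _ => rfl }, fun _ _ _ _ => rfl⟩

theorem IsZero.isomorphic (hV : V.IsZero) (hW : W.IsZero) : V.Isomorphic W :=
  ⟨fun x => have := hV x; have := hW x; 0, fun _ y _ _ => (hW y).elim _ _⟩

theorem isomorphic_prod_of_isZero (V : QuiverRep K Q) (hW : W.IsZero) :
    (V.prod W).Isomorphic V := by
  refine ⟨fun x => LinearEquiv.ofBijective (LinearMap.fst K (V.obj x) (W.obj x))
    ⟨fun v w h => ?_, fun v => ⟨(v, 0), rfl⟩⟩, fun _ _ _ _ => rfl⟩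
  exact Prod.ext h ((hW x).elim _ _)

/-- `W` is a direct summand of `V`, expressed by a split monomorphism. -/
def IsRetract (W V : QuiverRep K Q) : Prop :=
  ∃ (ι : Hom W V) (π : Hom V W), ∀ x w, π.app x (ι.app x w) = w

theorem IsRetract.exists_isomorphic_prod (h : IsRetract W V) :
    ∃ U, V.Isomorphic (W.prod U) := by
  obtain ⟨ι, π, hπ⟩ := h
  let N : Sub V :=
    { carrier := fun x => LinearMap.ker (π.app x)
      stable := fun e v hv => by
        rw [LinearMap.mem_ker] at hv
        rw [Submodule.mem_comap, LinearMap.mem_ker, π.naturality, hv, map_zero] }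
  have complement_mem : ∀ x v, v - ι.app x (π.app x v) ∈ N.carrier x := fun x v => by
    change π.app x _ = 0
    rw [map_sub, hπ, sub_self]
  refine ⟨N.toRep, fun x => LinearEquiv.ofBijective ((π.app x).prod
    ((LinearMap.id - ι.app x ∘ₗ π.app x).codRestrict (N.carrier x) (complement_mem x)))
    ⟨?_, ?_⟩, fun x y e v => Prod.ext (π.naturality e v) (Subtype.ext ?_)⟩
  · refine (injective_iff_map_eq_zero _).mpr fun v hv => ?_
    have hπv : π.app x v = 0 := congrArg Prod.fst hv
    have hsub : v - ι.app x (π.app x v) = 0 :=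
      congrArg (fun p : W.obj x × N.carrier x => (p.2 : V.obj x)) hv
    simpa [hπv] using hsub
  · rintro ⟨w, u, hu⟩
    have hπu : π.app x u = 0 := hu
    have hπv : π.app x (ι.app x w + u) = w := by rw [map_add, hπ, hπu, add_zero]
    refine ⟨ι.app x w + u, Prod.ext hπv (Subtype.ext ?_)⟩
    change ι.app x w + u - ι.app x (π.app x (ι.app x w + u)) = u
    rw [hπv, add_sub_cancel_left]
  · change V.map e v - ι.app y (π.app y (V.map e v)) = V.map e (v - ι.app x (π.app x v))
    rw [map_sub, π.naturality, ι.naturality]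

theorem isRetract_prod_right (V W : QuiverRep K Q) : IsRetract W (V.prod W) :=
  ⟨.inr V W, .snd V W, fun _ _ => rfl⟩

theorem IsRetract.trans (h : IsRetract U V) (h' : IsRetract V W) : IsRetract U W := by
  obtain ⟨ι, π, hπ⟩ := h
  obtain ⟨ι', π', hπ'⟩ := h'
  exact ⟨⟨fun x => ι'.app x ∘ₗ ι.app x, fun e v => by simp [ι.naturality, ι'.naturality]⟩,
    ⟨fun x => π.app x ∘ₗ π'.app x, fun e v => by simp [π.naturality, π'.naturality]⟩,
    fun x u => by simp [hπ, hπ']⟩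

theorem Isomorphic.isRetract (h : V.Isomorphic W) : IsRetract V W := by
  obtain ⟨φ, ψ, hψφ, -⟩ := h.exists_inverse_homs
  exact ⟨φ, ψ, hψφ⟩

theorem isRetract_of_isomorphic_prod (h : V.Isomorphic (U.prod W)) : IsRetract W V :=
  (isRetract_prod_right U W).trans h.symm.isRetract

end Morphisms

section Dimension

variable {K : Type u} [Field K] {Q : Type} [Quiver.{0} Q] {V W : QuiverRep K Q}

theorem Isomorphic.dimVec_eq (h : V.Isomorphic W) : V.dimVec = W.dimVec :=
  funext fun x => (h.choose x).finrank_eq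

theorem dimVec_prod (V W : QuiverRep K Q) : (V.prod W).dimVec = V.dimVec + W.dimVec :=
  funext fun x => Module.finrank_prod (R := K) (M := V.obj x) (M' := W.obj x)

theorem mem_support_iff {x : Q} : x ∈ V.support ↔ V.dimVec x ≠ 0 :=
  (Module.finrank_pos_iff (R := K)).symm.trans Nat.pos_iff_ne_zero

theorem Isomorphic.support_eq (h : V.Isomorphic W) : V.support = W.support :=
  Set.ext fun x => by rw [mem_support_iff, mem_support_iff, h.dimVec_eq]

theorem Isomorphic.totalDim_eq [Fintype Q] (h : V.Isomorphic W) : V.totalDim = W.totalDim := by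
  rw [totalDim, totalDim, h.dimVec_eq]

theorem totalDim_prod [Fintype Q] (V W : QuiverRep K Q) :
    (V.prod W).totalDim = V.totalDim + W.totalDim := by
  simp only [totalDim, dimVec_prod, Pi.add_apply, Finset.sum_add_distrib]

end Dimension

/-! ### Transition maps of equalised representations -/

section Transition

variable {K : Type u} [Field K] {Q : Type} [Quiver.{0} Q] {V W : QuiverRep K Q}

/-- The flow order `x ≤ y` on the vertices: there is a (possibly trivial) path from `x` to `y`. -/
abbrev Reaches (x y : Q) : Prop := Nonempty (Quiver.Path x y)

theorem mapPath_comp (V : QuiverRep K Q) {x y z : Q} (p : Quiver.Path x y)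
    (q : Quiver.Path y z) : V.mapPath (p.comp q) = V.mapPath q ∘ₗ V.mapPath p := by
  induction q with
  | nil => rfl
  | cons q e ih =>
    rw [Quiver.Path.comp_cons]
    simp only [mapPath, ih, LinearMap.comp_assoc]

theorem IsRetract.isEqualised (h : IsRetract W V) (hV : V.IsEqualised) : W.IsEqualised := by
  obtain ⟨ι, π, hπ⟩ := h
  intro x y p q
  ext v
  rw [← hπ y (W.mapPath p v), ← hπ y (W.mapPath q v), ι.app_mapPath, ι.app_mapPath, hV x y p q]

open Classical in
/-- The linear map along a path from `x` to `y`, or `0` if there is none. For an equalised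
representation it does not depend on the path. -/
noncomputable def transition (V : QuiverRep K Q) (x y : Q) : V.obj x →ₗ[K] V.obj y :=
  if h : Reaches x y then V.mapPath h.some else 0

theorem IsEqualised.transition_eq (hV : V.IsEqualised) {x y : Q} (p : Quiver.Path x y) :
    V.transition x y = V.mapPath p :=
  (dif_pos ⟨p⟩).trans (hV _ _ _ _)

theorem IsEqualised.transition_self (hV : V.IsEqualised) {x : Q} (v : V.obj x) :
    V.transition x x v = v := by
  rw [hV.transition_eq .nil, mapPath, LinearMap.id_apply]

theorem IsEqualised.map_eq_transition (hV : V.IsEqualised) {x y : Q} (e : x ⟶ y) :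
    V.map e = V.transition x y :=
  (hV.transition_eq e.toPath).symm

theorem IsEqualised.transition_transition (hV : V.IsEqualised) {x y z : Q}
    (hxy : Reaches x y) (hyz : Reaches y z) (v : V.obj x) :
    V.transition y z (V.transition x y v) = V.transition x z v := by
  obtain ⟨p⟩ := hxy
  obtain ⟨q⟩ := hyz
  rw [hV.transition_eq p, hV.transition_eq q, hV.transition_eq (p.comp q), mapPath_comp,
    LinearMap.comp_apply]

theorem Hom.app_transition (φ : Hom V W) {x y : Q} (v : V.obj x) :
    φ.app y (V.transition x y v) = W.transition x y (φ.app x v) := by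
  unfold transition
  split_ifs
  · exact φ.app_mapPath _ _
  · simp only [LinearMap.zero_apply, map_zero]

/-- The image of the transition map from `x` to `y` and the kernel of the transition map from `y`
to `z` are comparable: the form in which the absence of nested intervals is used. -/
def Comparable (V : QuiverRep K Q) (x y z : Q) : Prop :=
  LinearMap.ker (V.transition y z) ≤ LinearMap.range (V.transition x y) ∨
    LinearMap.range (V.transition x y) ≤ LinearMap.ker (V.transition y z)

theorem IsRetract.comparable (h : IsRetract W V) {x y z : Q} (hV : V.Comparable x y z) :
    W.Comparable x y z := by
  obtain ⟨ι, π, hπ⟩ := h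
  refine hV.imp (fun hle w hw => ?_) (fun hle => ?_)
  · have hιw : ι.app y w ∈ LinearMap.ker (V.transition y z) := by
      rw [LinearMap.mem_ker] at hw ⊢
      rw [← ι.app_transition, hw, map_zero]
    obtain ⟨u, hu⟩ := hle hιw
    exact ⟨π.app x u, by rw [← π.app_transition, hu, hπ]⟩
  · rintro _ ⟨u, rfl⟩
    have hιu : V.transition y z (V.transition x y (ι.app x u)) = 0 := hle ⟨_, rfl⟩
    rw [LinearMap.mem_ker, ← hπ z (W.transition y z _), ι.app_transition, ι.app_transition, hιu,
      map_zero]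

variable {P : Type} [Quiver.{0} P] (F : P ⥤q Q)

theorem mapPath_restrict (V : QuiverRep K Q) {x y : P} (p : Quiver.Path x y) :
    (V.restrict F).mapPath p = V.mapPath (F.mapPath p) := by
  induction p with
  | nil => rfl
  | cons p e ih =>
    rw [mapPath, ih, Prefunctor.mapPath_cons, mapPath]
    rfl

theorem IsEqualised.restrict (hV : V.IsEqualised) : (V.restrict F).IsEqualised := fun x y p q => by
  rw [mapPath_restrict, mapPath_restrict, hV]

theorem IsEqualised.transition_restrict (hV : V.IsEqualised) {x y : P} (h : Reaches x y) :
    (V.restrict F).transition x y = V.transition (F.obj x) (F.obj y) := by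
  obtain ⟨p⟩ := h
  rw [(hV.restrict F).transition_eq p, mapPath_restrict, hV.transition_eq (F.mapPath p)]

end Transition

/-! ### Thin representations -/

section Thin

variable {K : Type u} [Field K] {Q : Type}

open Classical in
/-- The space of the thin representation on `P` at the vertex `x`, encoded as a subspace of `K` so
that all maps between these spaces are restrictions of the identity or zero. -/
noncomputable def thinSpace (K : Type u) [Field K] (P : Set Q) (x : Q) : Submodule K K :=
  if x ∈ P then ⊤ else ⊥

theorem thinSpace_of_mem {P : Set Q} {x : Q} (h : x ∈ P) : thinSpace K P x = ⊤ := if_pos h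

theorem thinSpace_of_notMem {P : Set Q} {x : Q} (h : x ∉ P) : thinSpace K P x = ⊥ := if_neg h

variable [Quiver.{0} Q]

open Classical in
/-- The thin representation supported on `P`, with all edges inside of `P` acting by the
identity. -/
noncomputable def thin (K : Type u) [Field K] (P : Set Q) : QuiverRep K Q where
  obj x := thinSpace K P x
  map {x y} _ :=
    { toFun := fun v => ⟨if y ∈ P then v.1 else 0, by
        split_ifs with h
        · rw [thinSpace_of_mem h]; trivial
        · exact zero_mem _⟩
      map_add' := fun v w => by ext; simp only [Submodule.coe_add]; split_ifs <;> simp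
      map_smul' := fun c v => by
        ext; simp only [Submodule.coe_smul, RingHom.id_apply]; split_ifs <;> simp }

theorem thin_map_of_mem {P : Set Q} {x y : Q} (e : x ⟶ y) (h : y ∈ P) (v : (thin K P).obj x) :
    ((thin K P).map e v).1 = v.1 := if_pos h

theorem thin_obj_eq_zero {P : Set Q} {x : Q} (h : x ∉ P) (v : (thin K P).obj x) : v = 0 := by
  have hbot : thinSpace K P x ≤ ⊥ := (thinSpace_of_notMem h).le
  exact Subtype.ext ((Submodule.mem_bot K).mp (hbot v.2))

open Classical in
theorem dimVec_thin (P : Set Q) (x : Q) : (thin K P).dimVec x = if x ∈ P then 1 else 0 := by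
  change Module.finrank K (thinSpace K P x) = _
  split_ifs with h
  · rw [thinSpace_of_mem h, finrank_top, Module.finrank_self]
  · rw [thinSpace_of_notMem h, finrank_bot]

theorem support_thin (P : Set Q) : (thin K P).support = P := by
  classical
  ext x
  simp [mem_support_iff, dimVec_thin]

theorem totalDim_thin [Fintype Q] (P : Set Q) : (thin K P).totalDim = P.ncard := by
  classical
  simp only [totalDim, dimVec_thin, Finset.sum_boole, Nat.cast_id, ← Set.ncard_coe_finset,
    Finset.coe_filter, Finset.mem_univ, true_and, Set.ofPred_mem_eq]

/-- The morphism from a thin representation that sends `1` at the vertex `x` to `e x`. -/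
noncomputable def Hom.ofThin {V : QuiverRep K Q} {P : Set Q} (e : ∀ x, V.obj x)
    (he : ∀ x ∉ P, e x = 0)
    (hmap : ∀ {x y : Q} (f : x ⟶ y), x ∈ P → V.map f (e x) = e y) : Hom (thin K P) V where
  app x := (thinSpace K P x).subtype.smulRight (e x)
  naturality {x y} f v := by
    change ((thin K P).map f v).1 • e y = V.map f (v.1 • e x)
    by_cases hx : x ∈ P
    · rw [map_smul, hmap f hx]
      by_cases hy : y ∈ P
      · rw [thin_map_of_mem f hy]
      · rw [he y hy, smul_zero, smul_zero]
    · rw [thin_obj_eq_zero hx v, map_zero]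
      exact (zero_smul K _).trans ((congrArg (V.map f) (zero_smul K _)).trans (map_zero _)).symm

/-- The morphism to a thin representation given by the functional `ξ x` at the vertex `x`. -/
noncomputable def Hom.toThin {V : QuiverRep K Q} {P : Set Q} (ξ : ∀ x, V.obj x →ₗ[K] K)
    (hξ : ∀ x ∉ P, ξ x = 0)
    (hmap : ∀ {x y : Q} (f : x ⟶ y), y ∈ P → ∀ v, ξ y (V.map f v) = ξ x v) :
    Hom V (thin K P) where
  app x := (ξ x).codRestrict (thinSpace K P x) fun v => by
    by_cases hx : x ∈ P
    · simp [thinSpace_of_mem hx]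
    · simp [hξ x hx]
  naturality {x y} f v := by
    by_cases hy : y ∈ P
    · exact Subtype.ext ((hmap f hy v).trans
        (thin_map_of_mem f hy (⟨ξ x v, _⟩ : (thin K P).obj x)).symm)
    · exact (thin_obj_eq_zero hy _).trans (thin_obj_eq_zero hy _).symm

open Classical in
theorem exists_isomorphic_thin_prod {V : QuiverRep K Q} {P : Set Q} (e : ∀ x, V.obj x)
    (ξ : ∀ x, V.obj x →ₗ[K] K) (hξe : ∀ x ∈ P, ξ x (e x) = 1)
    (he : ∀ {x y : Q} (f : x ⟶ y), x ∈ P → V.map f (e x) = if y ∈ P then e y else 0)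
    (hξ : ∀ {x y : Q} (f : x ⟶ y), y ∈ P → ∀ v, ξ y (V.map f v) = if x ∈ P then ξ x v else 0) :
    ∃ W, V.Isomorphic ((thin K P).prod W) := by
  refine IsRetract.exists_isomorphic_prod
    ⟨.ofThin (fun x => if x ∈ P then e x else 0) (fun x hx => if_neg hx) fun f hx => ?_,
      .toThin (fun x => if x ∈ P then ξ x else 0) (fun x hx => if_neg hx) fun {x y} f hy v => ?_,
      fun x c => ?_⟩
  · rw [if_pos hx, he f hx]
  · rw [if_pos hy, hξ f hy]
    split_ifs <;> rfl
  · by_cases hx : x ∈ P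
    · refine Subtype.ext ?_
      change (if x ∈ P then ξ x else 0) (c.1 • if x ∈ P then e x else 0) = c.1
      rw [if_pos hx, if_pos hx, map_smul, hξe x hx, smul_eq_mul, mul_one]
    · exact (thin_obj_eq_zero hx _).trans (thin_obj_eq_zero hx _).symm

/-- The vector `e` generates a copy of `thin K P`, and the functional `ξ` splits it off. -/
theorem IsEqualised.exists_isomorphic_thin_prod {V : QuiverRep K Q} (hV : V.IsEqualised) {a b : Q}
    {P : Set Q} (hP : ∀ x ∈ P, Reaches a x ∧ Reaches x b) (e : V.obj a) (ξ : V.obj b →ₗ[K] K)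
    (hξe : ξ (V.transition a b e) = 1)
    (hout : ∀ {x y : Q} (_ : x ⟶ y), x ∈ P → y ∉ P → V.transition a y e = 0)
    (hin : ∀ {x y : Q} (_ : x ⟶ y), x ∉ P → y ∈ P → ∀ v, ξ (V.transition x b v) = 0) :
    ∃ W, V.Isomorphic ((thin K P).prod W) := by
  refine QuiverRep.exists_isomorphic_thin_prod (fun x => V.transition a x e)
    (fun x => ξ ∘ₗ V.transition x b) (fun x hx => ?_) (fun {x y} f hx => ?_)
    (fun {x y} f hy v => ?_)
  · rw [LinearMap.comp_apply, hV.transition_transition (hP x hx).1 (hP x hx).2, hξe]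
  · rw [hV.map_eq_transition f, hV.transition_transition (hP x hx).1 ⟨f.toPath⟩]
    split_ifs with hy
    exacts [rfl, hout f hx hy]
  · rw [hV.map_eq_transition f, LinearMap.comp_apply,
      hV.transition_transition ⟨f.toPath⟩ (hP y hy).2]
    split_ifs with hx
    exacts [rfl, hin f hx hy v]

end Thin

/-! ### Sums of thin representations -/

section ThinSum

variable {K : Type u} [Field K] {Q : Type} [Quiver.{0} Q]

/-- The zero object among the representations. -/
def zero (K : Type u) [Field K] (Q : Type) [Quiver.{0} Q] : QuiverRep K Q where
  obj _ := PUnit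
  map _ := 0

theorem isZero_zero : (zero K Q).IsZero := fun _ => inferInstanceAs (Subsingleton PUnit)

/-- The direct sum of the thin representations on the members of a list. -/
noncomputable def thinSum (K : Type u) [Field K] : List (Set Q) → QuiverRep K Q
  | [] => zero K Q
  | P :: l => (thin K P).prod (thinSum K l)

theorem thinSum_perm {l l' : List (Set Q)} (h : l.Perm l') :
    (thinSum K l).Isomorphic (thinSum K l') := by
  induction h with
  | nil => exact .refl _
  | cons P _ ih => exact (Isomorphic.refl _).prod_congr ih
  | swap P R l => exact isomorphic_prod_left_comm _ _ _
  | trans _ _ ih ih' => exact ih.trans ih'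

theorem exists_isomorphic_thinSum [Finite Q] {C : QuiverRep K Q → Prop} {p : Set Q → Prop}
    (hC : ∀ {V W}, C V → IsRetract W V → C W)
    (hsplit : ∀ {V}, C V → ¬ V.IsZero → ∃ P W, p P ∧ P.Nonempty ∧
      V.Isomorphic ((thin K P).prod W)) {V : QuiverRep K Q} (hV : C V) :
    ∃ l : List (Set Q), (∀ P ∈ l, p P) ∧ V.Isomorphic (thinSum K l) := by
  cases nonempty_fintype Q
  induction hn : V.totalDim using Nat.strong_induction_on generalizing V with
  | _ n ih =>
    by_cases hzero : V.IsZero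
    · exact ⟨[], by simp, hzero.isomorphic isZero_zero⟩
    obtain ⟨P, W, hP, hne, hiso⟩ := hsplit hV hzero
    have hdim : V.totalDim = P.ncard + W.totalDim := by
      rw [hiso.totalDim_eq, totalDim_prod, totalDim_thin]
    have hpos : 0 < P.ncard := (Set.ncard_pos P.toFinite).mpr hne
    obtain ⟨l, hl, hWl⟩ := ih W.totalDim (by lia) (hC hV (isRetract_of_isomorphic_prod hiso)) rfl
    exact ⟨P :: l, by simpa using ⟨hP, hl⟩, hiso.trans ((Isomorphic.refl _).prod_congr hWl)⟩

end ThinSum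

/-! ### The lattice of subrepresentations -/

section Sub

variable {K : Type u} [Field K] {Q : Type} [Quiver.{0} Q] {V W V' : QuiverRep K Q}

namespace Sub

instance : Lattice (Sub V) :=
  { (inferInstance : PartialOrder (Sub V)) with
    sup := fun U W => ⟨fun x => U.carrier x ⊔ W.carrier x, fun e =>
      sup_le ((U.stable e).trans (Submodule.comap_mono le_sup_left))
        ((W.stable e).trans (Submodule.comap_mono le_sup_right))⟩
    inf := fun U W => ⟨fun x => U.carrier x ⊓ W.carrier x, fun e =>
      le_inf (inf_le_left.trans (U.stable e)) (inf_le_right.trans (W.stable e))⟩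
    le_sup_left := fun _ _ _ => le_sup_left
    le_sup_right := fun _ _ _ => le_sup_right
    sup_le := fun _ _ _ hU hW x => sup_le (hU x) (hW x)
    inf_le_left := fun _ _ _ => inf_le_left
    inf_le_right := fun _ _ _ => inf_le_right
    le_inf := fun _ _ _ hU hW x => le_inf (hU x) (hW x) }

instance : BoundedOrder (Sub V) where
  le_top _ _ := le_top
  bot_le _ _ := bot_le

/-- The image of a subrepresentation under a morphism. -/
def map (φ : Hom V W) (U : Sub V) : Sub W where
  carrier x := (U.carrier x).map (φ.app x)
  stable := by
    rintro x y e _ ⟨v, hv, rfl⟩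
    exact ⟨V.map e v, U.stable e hv, φ.naturality e v⟩

/-- The preimage of a subrepresentation under a morphism. -/
def comap (φ : Hom V W) (U : Sub W) : Sub V where
  carrier x := (U.carrier x).comap (φ.app x)
  stable e v hv := by
    rw [Submodule.mem_comap, Submodule.mem_comap, φ.naturality]
    exact U.stable e hv

/-- The inclusion of a subrepresentation. -/
def incl (U : Sub V) : Hom U.toRep V where
  app x := (U.carrier x).subtype
  naturality _ _ := rfl

/-- The projection to the quotient by a subrepresentation. -/
def mkQ (U : Sub V) : Hom V U.quotient where
  app x := (U.carrier x).mkQ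
  naturality _ _ := rfl

theorem map_mono (φ : Hom V W) {U U' : Sub V} (h : U ≤ U') : U.map φ ≤ U'.map φ :=
  fun x => Submodule.map_mono (h x)

theorem map_map_of_leftInverse {φ : Hom V W} {ψ : Hom W V} (h : ∀ x v, ψ.app x (φ.app x v) = v)
    (U : Sub V) : (U.map φ).map ψ = U := by
  refine Sub.ext (funext fun x => ?_)
  have hcomp : ψ.app x ∘ₗ φ.app x = LinearMap.id := LinearMap.ext (h x)
  change ((U.carrier x).map (φ.app x)).map (ψ.app x) = U.carrier x
  rw [← Submodule.map_comp, hcomp, Submodule.map_id]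

/-- The dimension vector of a subrepresentation. -/
noncomputable def dim (U : Sub V) (x : Q) : ℕ := Module.finrank K (U.carrier x)

theorem dim_bot : (⊥ : Sub V).dim = 0 := funext fun _ => finrank_bot _ _

theorem dim_top : (⊤ : Sub V).dim = V.dimVec := funext fun _ => finrank_top _ _

theorem dim_mono {U W : Sub V} (h : U ≤ W) : U.dim ≤ W.dim :=
  fun x => Submodule.finrank_mono (h x)

theorem eq_of_le_of_dim_le {U W : Sub V} (h : U ≤ W) (hdim : W.dim ≤ U.dim) : U = W :=
  Sub.ext (funext fun x => Submodule.eq_of_le_of_finrank_le (h x) (hdim x))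

theorem dim_sup_add_dim_inf (U W : Sub V) : (U ⊔ W).dim + (U ⊓ W).dim = U.dim + W.dim :=
  funext fun x => Submodule.finrank_sup_add_finrank_inf_eq (U.carrier x) (W.carrier x)

theorem dim_map_of_injective {φ : Hom V W} (hφ : ∀ x, Function.Injective (φ.app x)) (U : Sub V) :
    (U.map φ).dim = U.dim :=
  funext fun x => (Submodule.equivMapOfInjective _ (hφ x) (U.carrier x)).finrank_eq.symm

theorem dim_eq_dim_comap_add_dim_map {ι : Hom V' V} {π : Hom V W}
    (hι : ∀ x, Function.Injective (ι.app x)) (hιπ : ∀ x, Function.Exact (ι.app x) (π.app x))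
    (U : Sub V) : U.dim = (U.comap ι).dim + (U.map π).dim := by
  funext x
  have hker : LinearMap.ker ((π.app x).domRestrict (U.carrier x)) =
      (((U.comap ι).map ι).carrier x).submoduleOf (U.carrier x) := by
    ext v
    constructor
    · intro hv
      obtain ⟨u, hu⟩ := (hιπ x v.1).mp hv
      exact ⟨u, show ι.app x u ∈ U.carrier x from hu ▸ v.2, hu⟩
    · rintro ⟨u, -, hu⟩
      exact (hιπ x v.1).mpr ⟨u, hu⟩
  have hle : ((U.comap ι).map ι).carrier x ≤ U.carrier x := Submodule.map_comap_le _ _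
  have hrank := LinearMap.finrank_range_add_finrank_ker ((π.app x).domRestrict (U.carrier x))
  rw [LinearMap.range_domRestrict, hker, (Submodule.submoduleOfEquivOfLe hle).finrank_eq] at hrank
  have hmap := congrFun (dim_map_of_injective hι (U.comap ι)) x
  change U.dim x = (U.comap ι).dim x + (U.map π).dim x
  rw [← hmap, add_comm]
  exact hrank.symm

/-- The direct sum of two subrepresentations. -/
def prod (A : Sub V) (B : Sub W) : Sub (V.prod W) where
  carrier x := (A.carrier x).prod (B.carrier x)
  stable e _ hv := ⟨A.stable e hv.1, B.stable e hv.2⟩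

theorem dim_eq_dim_comap_inl_add_dim_map_snd (U : Sub (V.prod W)) :
    U.dim = (U.comap (.inl V W)).dim + (U.map (.snd V W)).dim :=
  dim_eq_dim_comap_add_dim_map (fun _ => LinearMap.inl_injective) (fun _ => .inl_snd) U

theorem dim_eq_dim_comap_inr_add_dim_map_fst (U : Sub (V.prod W)) :
    U.dim = (U.comap (.inr V W)).dim + (U.map (.fst V W)).dim :=
  dim_eq_dim_comap_add_dim_map (fun _ => LinearMap.inr_injective) (fun _ => .inr_fst) U

theorem dim_prod (A : Sub V) (B : Sub W) : (A.prod B).dim = A.dim + B.dim := by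
  have hcomap : (A.prod B).comap (.inl V W) = A :=
    Sub.ext (funext fun x => Submodule.prod_comap_inl _ _)
  have hmap : (A.prod B).map (.snd V W) = B :=
    Sub.ext (funext fun x => Submodule.prod_map_snd _ _)
  rw [dim_eq_dim_comap_inl_add_dim_map_snd, hcomap, hmap]

end Sub

end Sub

/-! ### Subquotients and their slopes -/

namespace Sub

variable {K : Type u} [Field K] {Q : Type} [Quiver.{0} Q] {V W V' : QuiverRep K Q}

/-- The subrepresentation `X` of the quotient `W / U`, as a subrepresentation between `U`
and `W`. -/
def lift (U W : Sub V) (X : Sub (U.inside W).quotient) : Sub V :=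
  (X.comap (U.inside W).mkQ).map W.incl

/-- The image in the quotient `W / U` of a subrepresentation `X`. -/
def image (U W X : Sub V) : Sub (U.inside W).quotient := (X.inside W).map (U.inside W).mkQ

theorem dim_inside {U W : Sub V} (h : U ≤ W) : (U.inside W).dim = U.dim :=
  funext fun x => (Submodule.submoduleOfEquivOfLe (h x)).finrank_eq

theorem dim_eq_dim_inside_add_dim_map_mkQ {N X : Sub V} (h : N ≤ X) :
    X.dim = N.dim + (X.map N.mkQ).dim := by
  have hcomap : X.comap N.incl = ⊤ :=
    eq_top_iff.mpr fun x (v : N.carrier x) _ => h x v.2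
  have hdim := dim_eq_dim_comap_add_dim_map (ι := N.incl) (π := N.mkQ)
    (fun x => (N.carrier x).injective_subtype)
    (fun x => LinearMap.exact_subtype_mkQ (N.carrier x)) X
  rwa [hcomap, dim_top] at hdim

theorem dimVec_quotient {U W : Sub V} (h : U ≤ W) :
    (U.inside W).quotient.dimVec + U.dim = W.dim := by
  have hdim := dim_eq_dim_inside_add_dim_map_mkQ (le_top : U.inside W ≤ ⊤)
  have hmap : (⊤ : Sub W.toRep).map (U.inside W).mkQ = ⊤ :=
    Sub.ext (funext fun x => Submodule.map_top _ |>.trans (Submodule.range_mkQ _))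
  rw [hmap, dim_top, dim_top, dim_inside h] at hdim
  rw [add_comm, ← hdim]
  rfl

theorem dim_lift {U W : Sub V} (h : U ≤ W) (X : Sub (U.inside W).quotient) :
    (lift U W X).dim = X.dim + U.dim := by
  have hle : U.inside W ≤ X.comap (U.inside W).mkQ := fun x v hv => by
    have hzero : ((U.inside W).carrier x).mkQ v = 0 := (Submodule.Quotient.mk_eq_zero _).mpr hv
    change ((U.inside W).carrier x).mkQ v ∈ X.carrier x
    exact hzero ▸ zero_mem _
  have hmap : (X.comap (U.inside W).mkQ).map (U.inside W).mkQ = X :=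
    Sub.ext (funext fun x => Submodule.map_comap_eq_of_surjective (Submodule.mkQ_surjective _) _)
  rw [lift, dim_map_of_injective fun x => (W.carrier x).injective_subtype,
    dim_eq_dim_inside_add_dim_map_mkQ hle, hmap, dim_inside h, add_comm]

theorem le_lift {U W : Sub V} (h : U ≤ W) (X : Sub (U.inside W).quotient) : U ≤ lift U W X := by
  intro x v hv
  have hzero : ((U.inside W).carrier x).mkQ ⟨v, h x hv⟩ = 0 :=
    (Submodule.Quotient.mk_eq_zero _).mpr hv
  refine ⟨⟨v, h x hv⟩, ?_, rfl⟩
  change ((U.inside W).carrier x).mkQ ⟨v, h x hv⟩ ∈ X.carrier x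
  exact hzero ▸ zero_mem _

theorem lift_le {U W : Sub V} (X : Sub (U.inside W).quotient) : lift U W X ≤ W := by
  rintro x _ ⟨v, -, rfl⟩
  exact v.2

theorem lift_image {U W X : Sub V} (h : U ≤ X) (h' : X ≤ W) : lift U W (image U W X) = X := by
  refine Sub.ext (funext fun x => le_antisymm ?_ fun v hv => ?_)
  · rintro _ ⟨(v : W.carrier x), ⟨(w : W.carrier x), hw, hwv⟩, rfl⟩
    have hsub : (v.1 : V.obj x) - w.1 ∈ U.carrier x :=
      (Submodule.Quotient.eq ((U.carrier x).submoduleOf (W.carrier x))).mp hwv.symm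
    have hadd : (v.1 : V.obj x) - w.1 + w.1 ∈ X.carrier x := Submodule.add_mem _ (h x hsub) hw
    rwa [sub_add_cancel] at hadd
  · exact ⟨⟨v, h' x hv⟩, ⟨⟨v, h' x hv⟩, hv, rfl⟩, rfl⟩

theorem exists_max [Finite Q] {p : Sub V → Prop} (hp : ∃ U, p U) (g : (Q → ℕ) → ℝ) :
    ∃ U, p U ∧ ∀ W, p W → g W.dim ≤ g U.dim := by
  classical
  cases nonempty_fintype Q
  have hfin : (dim '' {U : Sub V | p U}).Finite := (Set.finite_Iic V.dimVec).subset <| by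
    rintro _ ⟨U, -, rfl⟩ x
    exact Submodule.finrank_le _
  have hne : (dim '' {U : Sub V | p U}).Nonempty := Set.Nonempty.image _ hp
  obtain ⟨_, ⟨U, hU, rfl⟩, hmax⟩ := hfin.exists_maximalFor g _ hne
  refine ⟨U, hU, fun W hW => ?_⟩
  by_contra! hlt
  exact hlt.not_ge (hmax ⟨W, hW, rfl⟩ hlt.le)

section Weights

variable [Fintype Q]

/-- The dimension of a subrepresentation, weighted by `w`. -/
noncomputable def wdim (w : Q → ℝ) (U : Sub V) : ℝ := ∑ x, w x * (U.dim x : ℝ)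

/-- The total dimension of a subrepresentation, as a real number. -/
noncomputable def size (U : Sub V) : ℝ := wdim 1 U

theorem wdim_eq_add {w : Q → ℝ} {U : Sub V} {A : Sub W} {B : Sub V'} (h : U.dim = A.dim + B.dim) :
    U.wdim w = A.wdim w + B.wdim w := by
  simp only [wdim, h, Pi.add_apply, Nat.cast_add, mul_add, Finset.sum_add_distrib]

theorem wdim_sup_add_wdim_inf (w : Q → ℝ) (U W : Sub V) :
    (U ⊔ W).wdim w + (U ⊓ W).wdim w = U.wdim w + W.wdim w := by
  simp only [wdim, ← Finset.sum_add_distrib, ← mul_add, ← Nat.cast_add, ← Pi.add_apply,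
    dim_sup_add_dim_inf]

theorem wdim_sub_const (α : Q → ℝ) (θ : ℝ) (U : Sub V) :
    U.wdim (fun x => α x - θ) = U.wdim α - θ * U.size := by
  simp only [size, wdim, sub_mul, Finset.sum_sub_distrib, Finset.mul_sum, Pi.one_apply, one_mul]

theorem size_eq_sum_dim (U : Sub V) : U.size = ∑ x, (U.dim x : ℝ) := by
  simp only [size, wdim, Pi.one_apply, one_mul]

theorem size_mono {U W : Sub V} (h : U ≤ W) : U.size ≤ W.size := by
  rw [size_eq_sum_dim, size_eq_sum_dim]
  exact Finset.sum_le_sum fun x _ => Nat.cast_le.mpr (dim_mono h x)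

theorem size_strictMono {U W : Sub V} (h : U < W) : U.size < W.size := by
  by_contra hle
  refine h.ne (eq_of_le_of_dim_le h.le fun x => ?_)
  by_contra! hx
  rw [size_eq_sum_dim, size_eq_sum_dim] at hle
  exact hle (Finset.sum_lt_sum (fun y _ => Nat.cast_le.mpr (dim_mono h.le y))
    ⟨x, Finset.mem_univ x, Nat.cast_lt.mpr hx⟩)

/-- The slope of `W / U`. -/
noncomputable def relSlope (α : Q → ℝ) (U W : Sub V) : ℝ :=
  (W.wdim α - U.wdim α) / (W.size - U.size)

/-- Semistability of `W / U`. -/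
def RelSemistable (α : Q → ℝ) (U W : Sub V) : Prop :=
  ∀ X, U < X → X ≤ W → relSlope α U X ≤ relSlope α U W

theorem slope_eq_relSlope (α : Q → ℝ) {U W : Sub V} (h : V'.dimVec + U.dim = W.dim) :
    V'.slope α = relSlope α U W := by
  have hcast : ∀ x, (V'.dimVec x : ℝ) = W.dim x - U.dim x := fun x => by
    rw [← h, Pi.add_apply, Nat.cast_add, add_sub_cancel_right]
  simp only [slope, relSlope, size, wdim, hcast, mul_sub, Finset.sum_sub_distrib, Pi.one_apply,
    one_mul]

theorem slope_quotient (α : Q → ℝ) {U W : Sub V} (h : U ≤ W) :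
    (U.inside W).quotient.slope α = relSlope α U W :=
  slope_eq_relSlope α (dimVec_quotient h)

theorem slope_toRep_eq_relSlope_lift (α : Q → ℝ) {U W : Sub V} (h : U ≤ W)
    (X : Sub (U.inside W).quotient) : X.toRep.slope α = relSlope α U (lift U W X) :=
  slope_eq_relSlope α (dim_lift h X).symm

theorem isSemistable_quotient_iff {α : Q → ℝ} {U W : Sub V} (h : U ≤ W) :
    (U.inside W).quotient.IsSemistable α ↔ RelSemistable α U W := by
  constructor
  · intro hs X hUX hXW
    have himage : image U W X ≠ ⊥ := fun hbot => hUX.ne <| eq_of_le_of_dim_le hUX.le <| by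
      rw [← lift_image hUX.le hXW, hbot, dim_lift h, dim_bot, zero_add]
    have hslope := hs _ himage
    rwa [slope_toRep_eq_relSlope_lift α h, lift_image hUX.le hXW, slope_quotient α h] at hslope
  · intro hs X hX
    rw [slope_toRep_eq_relSlope_lift α h, slope_quotient α h]
    refine hs _ ((le_lift h X).lt_of_ne fun heq => hX ?_) (lift_le X)
    refine (eq_of_le_of_dim_le bot_le ?_).symm
    have hdim := dim_lift h X
    rw [← heq] at hdim
    rw [dim_bot, right_eq_add.mp hdim]

theorem relSlope_mul {α : Q → ℝ} {U W : Sub V} (h : U < W) :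
    relSlope α U W * (W.size - U.size) = W.wdim α - U.wdim α :=
  div_mul_cancel₀ _ (sub_pos.mpr (size_strictMono h)).ne'

theorem RelSemistable.mul_le {α : Q → ℝ} {U W X : Sub V} (hs : RelSemistable α U W)
    (hUX : U ≤ X) (hXW : X ≤ W) :
    X.wdim α - U.wdim α ≤ relSlope α U W * (X.size - U.size) := by
  rcases hUX.eq_or_lt with rfl | hlt
  · simp
  · rw [← relSlope_mul hlt]
    exact mul_le_mul_of_nonneg_right (hs X hlt hXW) (sub_nonneg.mpr (size_mono hUX))

end Weights

end Sub

/-! ### Existence of Harder-Narasimhan filtrations -/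

namespace Sub

variable {K : Type u} [Field K] {Q : Type} [Quiver.{0} Q] [Fintype Q] {V : QuiverRep K Q}

theorem relSlope_lt_of_relSlope_lt {α : Q → ℝ} {U X Z : Sub V} (hUX : U < X) (hXZ : X < Z)
    (h : relSlope α U Z < relSlope α U X) : relSlope α X Z < relSlope α U X := by
  have hUZ := relSlope_mul (α := α) (hUX.trans hXZ)
  have := relSlope_mul (α := α) hUX
  have := relSlope_mul (α := α) hXZ
  refine lt_of_mul_lt_mul_right (a := Z.size - X.size) ?_
    (sub_nonneg.mpr (size_mono hXZ.le))
  have := mul_lt_mul_of_pos_right h (sub_pos.mpr (size_strictMono (hUX.trans hXZ)))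
  linarith

theorem exists_max_relSlope (α : Q → ℝ) {U : Sub V} (hU : U ≠ ⊤) :
    ∃ X, U < X ∧ (∀ Z, U < Z → relSlope α U Z ≤ relSlope α U X) ∧
      ∀ Z, X < Z → relSlope α U Z < relSlope α U X := by
  obtain ⟨Y, hUY, hY⟩ := exists_max (p := fun X => U < X) ⟨⊤, hU.lt_top⟩
    (fun d => ((∑ x, α x * (d x : ℝ)) - U.wdim α) /
      ((∑ x, (1 : Q → ℝ) x * (d x : ℝ)) - U.size))
  obtain ⟨X, ⟨hUX, hXY⟩, hX⟩ := exists_max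
    (p := fun X => U < X ∧ relSlope α U X = relSlope α U Y) ⟨Y, hUY, rfl⟩
    (fun d => ∑ x, (1 : Q → ℝ) x * (d x : ℝ))
  refine ⟨X, hUX, fun Z hUZ => hXY ▸ hY Z hUZ, fun Z hXZ => hXY ▸ ?_⟩
  exact (hY Z (hUX.trans hXZ)).lt_of_ne fun heq =>
    (size_strictMono hXZ).not_ge (hX Z ⟨hUX.trans hXZ, heq⟩)

/-- A chain of subrepresentations with semistable subquotients of decreasing slopes: a
Harder-Narasimhan filtration without conditions on its ends. -/
structure IsHNChain (α : Q → ℝ) {n : ℕ} (s : Fin (n + 1) → Sub V) : Prop where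
  lt : ∀ i : Fin n, s i.castSucc < s i.succ
  relSemistable : ∀ i : Fin n, RelSemistable α (s i.castSucc) (s i.succ)
  relSlope_lt : ∀ i j : Fin n, i.succ = j.castSucc →
    relSlope α (s j.castSucc) (s j.succ) < relSlope α (s i.castSucc) (s i.succ)

theorem IsHNChain.cons {α : Q → ℝ} {n : ℕ} {s : Fin (n + 1) → Sub V} (hs : IsHNChain α s)
    {U : Sub V} (hU : U < s 0) (hle : ∀ Z, U < Z → relSlope α U Z ≤ relSlope α U (s 0))
    (hlt : ∀ Z, s 0 < Z → relSlope α U Z < relSlope α U (s 0)) :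
    IsHNChain α (Fin.cons U s : Fin (n + 2) → Sub V) where
  lt i := by
    cases i using Fin.cases with
    | zero => simpa using hU
    | succ i => simpa [← Fin.succ_castSucc] using hs.lt i
  relSemistable i := by
    cases i using Fin.cases with
    | zero => exact fun Z hZ _ => hle Z hZ
    | succ i => simpa [← Fin.succ_castSucc] using hs.relSemistable i
  relSlope_lt i j hij := by
    cases j using Fin.cases with
    | zero => simp at hij
    | succ j =>
      cases i using Fin.cases with
      | succ i => simpa [← Fin.succ_castSucc] using hs.relSlope_lt i j (by simpa using hij)
      | zero =>
        have hj : j.castSucc = 0 := (Fin.succ_injective _ hij).symm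
        have hlt_succ : s 0 < s j.succ := hj ▸ hs.lt j
        simpa [← Fin.succ_castSucc, hj] using
          relSlope_lt_of_relSlope_lt hU hlt_succ (hlt _ hlt_succ)

theorem exists_isHNChain (α : Q → ℝ) (U : Sub V) :
    ∃ (n : ℕ) (s : Fin (n + 1) → Sub V), s 0 = U ∧ s (Fin.last n) = ⊤ ∧ IsHNChain α s := by
  induction hN : (∑ x, V.dimVec x) - ∑ x, U.dim x using Nat.strong_induction_on generalizing U with
  | _ N ih =>
    by_cases hU : U = ⊤
    · exact ⟨0, fun _ => U, rfl, hU, fun i => i.elim0, fun i => i.elim0, fun i => i.elim0⟩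
    obtain ⟨X, hUX, hle, hlt⟩ := exists_max_relSlope α hU
    have hdecr : (∑ x, V.dimVec x) - ∑ x, X.dim x < N := by
      have hsize := size_strictMono hUX
      rw [size_eq_sum_dim, size_eq_sum_dim] at hsize
      norm_cast at hsize
      have : ∑ x, X.dim x ≤ ∑ x, V.dimVec x :=
        Finset.sum_le_sum fun x _ => Submodule.finrank_le _
      lia
    obtain ⟨n, s, rfl, htop, hs⟩ := ih _ hdecr X rfl
    exact ⟨n + 1, Fin.cons U s, rfl, htop, hs.cons hUX hle hlt⟩

end Sub

section Filtration

variable {K : Type u} [Field K] {Q : Type} [Quiver.{0} Q] [Fintype Q] {V : QuiverRep K Q}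

theorem nonempty_hnFiltration (α : Q → ℝ) (V : QuiverRep K Q) : Nonempty (HNFiltration α V) := by
  obtain ⟨n, s, hbot, htop, hs⟩ := Sub.exists_isHNChain α (⊥ : Sub V)
  refine ⟨⟨n, s, hbot, htop, Fin.strictMono_iff_lt_succ.mpr hs.lt, fun i => ?_, ?_⟩⟩
  · exact (Sub.isSemistable_quotient_iff (hs.lt i).le).mpr (hs.relSemistable i)
  · simp only [fun i : Fin n => Sub.slope_quotient α (hs.lt i).le]
    cases n with
    | zero => exact fun i => i.elim0
    | succ n => exact Fin.strictAnti_iff_succ_lt.mpr fun i => hs.relSlope_lt _ _ rfl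

namespace HNFiltration

variable {α : Q → ℝ} (F : HNFiltration α V)

/-- The slope of the `i`-th subquotient. -/
noncomputable def stepSlope (i : Fin F.length) : ℝ :=
  Sub.relSlope α (F.step i.castSucc) (F.step i.succ)

theorem step_lt (i : Fin F.length) : F.step i.castSucc < F.step i.succ :=
  F.strictMono Fin.castSucc_lt_succ

theorem relSemistable (i : Fin F.length) :
    Sub.RelSemistable α (F.step i.castSucc) (F.step i.succ) :=
  (Sub.isSemistable_quotient_iff (F.step_lt i).le).mp (F.semistable i)

theorem slope_eq_stepSlope (i : Fin F.length) :
    ((F.step i.castSucc).inside (F.step i.succ)).quotient.slope α = F.stepSlope i :=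
  Sub.slope_quotient α (F.step_lt i).le

theorem stepSlope_strictAnti : StrictAnti F.stepSlope := by
  have hanti := F.slope_strictAnti
  simpa only [slope_eq_stepSlope] using hanti

end HNFiltration

end Filtration

/-! ### Maximal weighted dimension and the subquotient of slope `θ` -/

section Part

variable {K : Type u} [Field K] {Q : Type} [Quiver.{0} Q] [Fintype Q] {V W : QuiverRep K Q}

/-- Subrepresentations of maximal weighted dimension. -/
def Sub.IsMaximizer (w : Q → ℝ) (U : Sub V) : Prop := ∀ W : Sub V, W.wdim w ≤ U.wdim w

theorem Sub.exists_isMaximizer (V : QuiverRep K Q) (w : Q → ℝ) : ∃ U : Sub V, U.IsMaximizer w := by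
  obtain ⟨U, -, hU⟩ := Sub.exists_max (V := V) (p := fun _ => True) ⟨⊥, trivial⟩
    (fun d => ∑ x, w x * (d x : ℝ))
  exact ⟨U, fun W => hU W trivial⟩

theorem Sub.IsMaximizer.le_of_lt_relSlope {α : Q → ℝ} {θ : ℝ} {U W X : Sub V}
    (hX : X.IsMaximizer (fun x => α x - θ)) (hUW : U < W) (hs : RelSemistable α U W)
    (hθ : θ < relSlope α U W) (hUX : U ≤ X) : W ≤ X := by
  by_contra hWX
  have hlt : X ⊓ W < W := inf_le_right.lt_of_ne fun h => hWX (inf_eq_right.mp h)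
  have hmax := hX (X ⊔ W)
  have hmodular := wdim_sup_add_wdim_inf (fun x => α x - θ) X W
  have hinf := hs.mul_le (le_inf hUX hUW.le) hlt.le
  have hW := relSlope_mul (α := α) hUW
  have hpos := mul_pos (sub_pos.mpr hθ) (sub_pos.mpr (size_strictMono hlt))
  simp only [wdim_sub_const] at hmax hmodular
  linarith

theorem Sub.IsMaximizer.le_of_relSlope_lt {α : Q → ℝ} {θ : ℝ} {U W X : Sub V}
    (hX : X.IsMaximizer (fun x => α x - θ)) (hUW : U < W) (hs : RelSemistable α U W)
    (hθ : relSlope α U W < θ) (hXW : X ≤ W) : X ≤ U := by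
  by_contra hXU
  have hlt : U < X ⊔ U := le_sup_right.lt_of_ne fun h => hXU (sup_eq_right.mp h.symm)
  have hmax := hX (X ⊓ U)
  have hmodular := wdim_sup_add_wdim_inf (fun x => α x - θ) X U
  have hsup := hs.mul_le hlt.le (sup_le hXW hUW.le)
  have hpos := mul_pos (sub_pos.mpr hθ) (sub_pos.mpr (size_strictMono hlt))
  simp only [wdim_sub_const] at hmax hmodular
  linarith

/-- The subrepresentations of `V` of maximal weighted dimension have a smallest and a largest
element, and `d` is the difference of the dimension vectors of these. For the weight `α - θ`, this
is the dimension vector of the Harder-Narasimhan subquotient of slope `θ`; in this form it is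
visibly additive. -/
def HasPart (w : Q → ℝ) (V : QuiverRep K Q) (d : Q → ℕ) : Prop :=
  ∃ A B : Sub V, A.IsMaximizer w ∧ B.IsMaximizer w ∧
    (∀ X : Sub V, X.IsMaximizer w → A ≤ X ∧ X ≤ B) ∧ B.dim = d + A.dim

theorem HasPart.unique {w : Q → ℝ} {d d' : Q → ℕ} (h : V.HasPart w d) (h' : V.HasPart w d') :
    d = d' := by
  obtain ⟨A, B, hA, hB, hAB, hd⟩ := h
  obtain ⟨A', B', hA', hB', hAB', hd'⟩ := h'
  obtain rfl : A = A' := le_antisymm (hAB _ hA').1 (hAB' _ hA).1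
  obtain rfl : B = B' := le_antisymm (hAB' _ hB).2 (hAB _ hB').2
  exact add_right_cancel (hd.symm.trans hd')

theorem exists_castSucc_lt_iff_lt {n : ℕ} {μ : Fin n → ℝ} (hμ : Antitone μ) (θ : ℝ) :
    ∃ j : Fin (n + 1), ∀ i : Fin n, i.castSucc < j ↔ θ < μ i := by
  classical
  have hex : ∃ j : ℕ, ∀ i : Fin n, j ≤ i.val → μ i ≤ θ := ⟨n, fun i hi => by lia⟩
  have hle : Nat.find hex ≤ n := Nat.find_min' hex fun i hi => by lia
  refine ⟨⟨Nat.find hex, by lia⟩, fun i => ⟨fun hi => ?_, fun hi => ?_⟩⟩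
  · obtain ⟨k, hik, hk⟩ : ∃ k : Fin n, i.val ≤ k.val ∧ θ < μ k := by
      simpa using Nat.find_min hex (m := i.val) hi
    exact hk.trans_le (hμ hik)
  · by_contra hij
    exact hi.not_ge (Nat.find_spec hex i (not_lt.mp hij))

namespace HNFiltration

variable {α : Q → ℝ} (F : HNFiltration α V) {θ : ℝ}

theorem step_le_of_isMaximizer {X : Sub V} (hX : X.IsMaximizer fun x => α x - θ)
    {j : Fin (F.length + 1)} (hj : ∀ i : Fin F.length, i.castSucc < j → θ < F.stepSlope i) :
    F.step j ≤ X := by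
  induction j using Fin.induction with
  | zero => exact F.step_zero.trans_le bot_le
  | succ j ih =>
    exact hX.le_of_lt_relSlope (F.step_lt j) (F.relSemistable j) (hj j Fin.castSucc_lt_succ)
      (ih fun i hi => hj i (hi.trans Fin.castSucc_lt_succ))

theorem le_step_of_isMaximizer {X : Sub V} (hX : X.IsMaximizer fun x => α x - θ)
    {j : Fin (F.length + 1)} (hj : ∀ i : Fin F.length, j ≤ i.castSucc → F.stepSlope i < θ) :
    X ≤ F.step j := by
  induction j using Fin.reverseInduction with
  | last => exact le_top.trans_eq F.step_last.symm
  | cast j ih =>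
    exact hX.le_of_relSlope_lt (F.step_lt j) (F.relSemistable j) (hj j le_rfl)
      (ih fun i hi => hj i (Fin.castSucc_lt_succ.le.trans hi))

theorem hasPart_stepSlope (i : Fin F.length) :
    V.HasPart (fun x => α x - F.stepSlope i)
      ((F.step i.castSucc).inside (F.step i.succ)).quotient.dimVec := by
  have above : ∀ Y : Sub V, Y.IsMaximizer (fun x => α x - F.stepSlope i) →
      F.step i.castSucc ≤ Y := fun Y hY => F.step_le_of_isMaximizer hY fun j hj =>
    F.stepSlope_strictAnti (Fin.castSucc_lt_castSucc_iff.mp hj)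
  have below : ∀ Y : Sub V, Y.IsMaximizer (fun x => α x - F.stepSlope i) →
      Y ≤ F.step i.succ := fun Y hY => F.le_step_of_isMaximizer hY fun j hj =>
    F.stepSlope_strictAnti (Fin.succ_le_castSucc_iff.mp hj)
  obtain ⟨X, hX⟩ := Sub.exists_isMaximizer V fun x => α x - F.stepSlope i
  have hbetween : X.wdim α - (F.step i.castSucc).wdim α ≤
      F.stepSlope i * (X.size - (F.step i.castSucc).size) :=
    (F.relSemistable i).mul_le (above X hX) (below X hX)
  have hstep : F.stepSlope i * ((F.step i.succ).size - (F.step i.castSucc).size) =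
      (F.step i.succ).wdim α - (F.step i.castSucc).wdim α := Sub.relSlope_mul (F.step_lt i)
  simp only [Sub.IsMaximizer, Sub.wdim_sub_const] at hX
  refine ⟨_, _, fun Y => ?_, fun Y => ?_, fun Y hY => ⟨above Y hY, below Y hY⟩,
    (Sub.dimVec_quotient (F.step_lt i).le).symm⟩ <;>
  · have := hX Y
    simp only [Sub.wdim_sub_const]
    linarith

theorem hasPart_zero (h : ∀ i, F.stepSlope i ≠ θ) : V.HasPart (fun x => α x - θ) 0 := by
  obtain ⟨j, hj⟩ := exists_castSucc_lt_iff_lt F.stepSlope_strictAnti.antitone θ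
  have eq_step : ∀ Y : Sub V, Y.IsMaximizer (fun x => α x - θ) → Y = F.step j := fun Y hY =>
    le_antisymm
      (F.le_step_of_isMaximizer hY fun i hi =>
        (not_lt.mp (mt (hj i).mpr hi.not_gt)).lt_of_ne (h i))
      (F.step_le_of_isMaximizer hY fun i => (hj i).mp)
  obtain ⟨X, hX⟩ := Sub.exists_isMaximizer V fun x => α x - θ
  exact ⟨X, X, hX, hX, fun Y hY => by rw [eq_step X hX, eq_step Y hY]; exact ⟨le_rfl, le_rfl⟩,
    (zero_add _).symm⟩

end HNFiltration

open Classical in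
/-- The entry of slope `θ` of a Harder-Narasimhan type, or `0` if there is none. -/
noncomputable def partOfSlope (α : Q → ℝ) (θ : ℝ) (L : List (Q → ℕ)) : Q → ℕ :=
  (L.map fun d => if (∑ x, α x * (d x : ℝ)) / ∑ x, (d x : ℝ) = θ then d else 0).sum

open Classical in
theorem HNFiltration.partOfSlope_type {α : Q → ℝ} (F : HNFiltration α V) (θ : ℝ) :
    partOfSlope α θ F.type = ∑ i, if F.stepSlope i = θ then
      ((F.step i.castSucc).inside (F.step i.succ)).quotient.dimVec else 0 := by
  rw [partOfSlope, HNFiltration.type, List.map_ofFn, List.sum_ofFn]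
  exact Finset.sum_congr rfl fun i _ =>
    if_congr (iff_of_eq (congrArg (· = θ) (F.slope_eq_stepSlope i))) rfl rfl

theorem HNFiltration.hasPart {α : Q → ℝ} (F : HNFiltration α V) (θ : ℝ) :
    V.HasPart (fun x => α x - θ) (partOfSlope α θ F.type) := by
  classical
  rw [F.partOfSlope_type]
  by_cases hex : ∃ i, F.stepSlope i = θ
  · obtain ⟨i, rfl⟩ := hex
    simpa only [F.stepSlope_strictAnti.injective.eq_iff, Finset.sum_ite_eq', Finset.mem_univ,
      if_true] using F.hasPart_stepSlope i
  · rw [not_exists] at hex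
    simpa only [hex, if_false, Finset.sum_const_zero] using F.hasPart_zero hex

theorem hasPart_hnType (α : Q → ℝ) (θ : ℝ) (V : QuiverRep K Q) :
    V.HasPart (fun x => α x - θ) (partOfSlope α θ (V.hnType α)) := by
  rw [hnType, dif_pos (nonempty_hnFiltration α V)]
  exact HNFiltration.hasPart _ θ

theorem Isomorphic.hasPart (h : V.Isomorphic W) {w : Q → ℝ} {d : Q → ℕ} (hV : V.HasPart w d) :
    W.HasPart w d := by
  obtain ⟨φ, ψ, hψφ, hφψ⟩ := h.exists_inverse_homs
  have dim_map (U : Sub V) : (U.map φ).dim = U.dim :=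
    Sub.dim_map_of_injective (fun x => Function.LeftInverse.injective (hψφ x)) U
  have dim_map' (U : Sub W) : (U.map ψ).dim = U.dim :=
    Sub.dim_map_of_injective (fun x => Function.LeftInverse.injective (hφψ x)) U
  have wdim_map (U : Sub V) : (U.map φ).wdim w = U.wdim w := by rw [Sub.wdim, Sub.wdim, dim_map]
  have wdim_map' (U : Sub W) : (U.map ψ).wdim w = U.wdim w := by rw [Sub.wdim, Sub.wdim, dim_map']
  obtain ⟨A, B, hA, hB, hAB, hd⟩ := hV
  refine ⟨A.map φ, B.map φ, fun X => ?_, fun X => ?_, fun X hX => ?_, by rw [dim_map, dim_map, hd]⟩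
  · rw [wdim_map, ← wdim_map']
    exact hA _
  · rw [wdim_map, ← wdim_map']
    exact hB _
  · have hXψ : (X.map ψ).IsMaximizer w := fun Y => by
      rw [wdim_map', ← wdim_map]
      exact hX _
    rw [← Sub.map_map_of_leftInverse hφψ X]
    exact ⟨Sub.map_mono φ (hAB _ hXψ).1, Sub.map_mono φ (hAB _ hXψ).2⟩

theorem IsZero.hasPart (hV : V.IsZero) (w : Q → ℝ) : V.HasPart w 0 := by
  have hsub : Subsingleton (Sub V) := ⟨fun U U' => Sub.ext (funext fun x => by
    have := hV x
    exact Subsingleton.elim _ _)⟩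
  have hmax : (⊥ : Sub V).IsMaximizer w := fun X => by rw [hsub.elim X ⊥]
  exact ⟨⊥, ⊥, hmax, hmax, fun X _ => ⟨bot_le, (hsub.elim X ⊥).le⟩, (zero_add _).symm⟩

theorem Sub.IsMaximizer.of_dim_eq_add {U : Sub (V.prod W)} {w : Q → ℝ} {A Y : Sub V} {B Z : Sub W}
    (hU : U.IsMaximizer w) (hA : A.IsMaximizer w) (hB : B.IsMaximizer w)
    (h : U.dim = Y.dim + Z.dim) : Y.IsMaximizer w ∧ Z.IsMaximizer w := by
  have hAB := hU (A.prod B)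
  rw [wdim_eq_add (dim_prod A B), wdim_eq_add h] at hAB
  have hY := hA Y
  have hZ := hB Z
  exact ⟨fun X => (hA X).trans (by linarith), fun X => (hB X).trans (by linarith)⟩

theorem HasPart.prod {w : Q → ℝ} {d d' : Q → ℕ} (h : V.HasPart w d) (h' : W.HasPart w d') :
    (V.prod W).HasPart w (d + d') := by
  obtain ⟨A, B, hA, hB, hAB, hd⟩ := h
  obtain ⟨A', B', hA', hB', hAB', hd'⟩ := h'
  have prod_isMaximizer {Y : Sub V} {Z : Sub W} (hY : Y.IsMaximizer w) (hZ : Z.IsMaximizer w) :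
      (Y.prod Z).IsMaximizer w := fun X => by
    rw [Sub.wdim_eq_add X.dim_eq_dim_comap_inl_add_dim_map_snd, Sub.wdim_eq_add (Sub.dim_prod Y Z)]
    exact add_le_add (hY _) (hZ _)
  refine ⟨A.prod A', B.prod B', prod_isMaximizer hA hA', prod_isMaximizer hB hB',
    fun X hX => ?_, ?_⟩
  · obtain ⟨hinl, hsnd⟩ := hX.of_dim_eq_add hA hA' X.dim_eq_dim_comap_inl_add_dim_map_snd
    obtain ⟨hfst, hinr⟩ := hX.of_dim_eq_add hA hA'
      (X.dim_eq_dim_comap_inr_add_dim_map_fst.trans (add_comm _ _))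
    constructor
    · rintro x ⟨v, u⟩ ⟨hv, hu⟩
      have hv0 : (v, (0 : W.obj x)) ∈ X.carrier x := (hAB _ hinl).1 x hv
      have h0u : ((0 : V.obj x), u) ∈ X.carrier x := (hAB' _ hinr).1 x hu
      have hsum : (v, (0 : W.obj x)) + ((0 : V.obj x), u) = (v, u) :=
        Prod.ext (add_zero _) (zero_add _)
      exact hsum ▸ Submodule.add_mem _ hv0 h0u
    · intro x v hv
      exact ⟨(hAB _ hfst).2 x ⟨v, hv, rfl⟩, (hAB' _ hsnd).2 x ⟨v, hv, rfl⟩⟩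
  · rw [Sub.dim_prod, Sub.dim_prod, hd, hd', add_add_add_comm]

theorem hasPart_thinSum {w : Q → ℝ} {D : Set Q → Q → ℕ} {l : List (Set Q)}
    (h : ∀ P ∈ l, (thin K P).HasPart w (D P)) : (thinSum K l).HasPart w (l.map D).sum := by
  induction l with
  | nil => exact isZero_zero.hasPart w
  | cons P l ih =>
    rw [List.map_cons, List.sum_cons]
    exact (h P List.mem_cons_self).prod (ih fun R hR => h R (List.mem_cons_of_mem _ hR))

end Part

end QuiverRep

open QuiverRep

/-! ### Barcodes of representations of the line -/

section Line

variable {ℓ : ℕ}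

instance : Finite (LineVertex ℓ) :=
  .of_injective LineVertex.idx fun ⟨_⟩ ⟨_⟩ h => congrArg LineVertex.mk h

theorem reaches_line_iff {x y : LineVertex ℓ} : Reaches x y ↔ x.idx ≤ y.idx := by
  constructor
  · rintro ⟨p⟩
    induction p with
    | nil => exact le_rfl
    | cons p e ih =>
      obtain ⟨hij⟩ := e
      exact ih.trans (Fin.le_def.mpr (Nat.le.intro hij))
  · obtain ⟨i⟩ := x
    obtain ⟨j⟩ := y
    intro hij
    obtain ⟨n, hn⟩ := Nat.exists_eq_add_of_le (Fin.le_def.mp hij)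
    induction n generalizing j with
    | zero =>
      obtain rfl : i = j := Fin.ext hn.symm
      exact ⟨.nil⟩
    | succ n ih =>
      obtain ⟨p⟩ := @ih ⟨i + n, by lia⟩ (Fin.le_def.mpr (Nat.le_add_right _ _)) rfl
      exact ⟨p.cons (.edge hn.symm)⟩

/-- The vertices of the interval `[a, b]`. -/
def lineInterval (a b : Fin (ℓ + 1)) : Set (LineVertex ℓ) := {x | a ≤ x.idx ∧ x.idx ≤ b}

/-- The nonempty intervals of the line. -/
def IsLineInterval (P : Set (LineVertex ℓ)) : Prop := ∃ a b, a ≤ b ∧ P = lineInterval a b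

variable {K : Type u} [Field K]

theorem exists_linearMap_eq_one {M : Type*} [AddCommGroup M] [Module K M] (N : Submodule K M)
    {v : M} (hv : v ∉ N) : ∃ ξ : M →ₗ[K] K, (∀ w ∈ N, ξ w = 0) ∧ ξ v = 1 := by
  obtain ⟨f, hf, hN⟩ := Submodule.exists_le_ker_of_notMem hv
  exact ⟨(f v)⁻¹ • f, fun w hw => by simp [LinearMap.mem_ker.mp (hN hw)], by simp [hf]⟩

theorem exists_isLeast {α : Type*} [LinearOrder α] [Finite α] {S : Set α} (hS : S.Nonempty) :
    ∃ a, IsLeast S a :=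
  (S.toFinite.exists_minimal hS).imp fun _ => minimal_iff_isLeast.mp

theorem exists_isGreatest {α : Type*} [LinearOrder α] [Finite α] {S : Set α} (hS : S.Nonempty) :
    ∃ a, IsGreatest S a :=
  exists_isLeast (α := αᵒᵈ) hS

/-- Take a vector `e` that is born as early as possible, and a functional `ξ` that detects it just
before it dies. -/
theorem QuiverRep.IsEqualised.exists_interval_generators {V : QuiverRep K (LineVertex ℓ)}
    (hV : V.IsEqualised) (hne : ¬ V.IsZero) :
    ∃ (a b : Fin (ℓ + 1)) (e : V.obj ⟨a⟩) (ξ : V.obj ⟨b⟩ →ₗ[K] K), a ≤ b ∧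
      ξ (V.transition ⟨a⟩ ⟨b⟩ e) = 1 ∧ (∀ i > b, V.transition ⟨a⟩ ⟨i⟩ e = 0) ∧
      ∀ i < a, Subsingleton (V.obj ⟨i⟩) := by
  have support_nonempty : {a | Nontrivial (V.obj ⟨a⟩)}.Nonempty := by
    simp only [IsZero, not_forall, not_subsingleton_iff_nontrivial] at hne
    obtain ⟨⟨i⟩, hi⟩ := hne
    exact ⟨i, hi⟩
  obtain ⟨a, ha, ha_least⟩ := exists_isLeast support_nonempty
  obtain ⟨e, he⟩ := @exists_ne _ ha 0
  obtain ⟨b, ⟨hab, hb⟩, hb_greatest⟩ := exists_isGreatest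
    (S := {b : Fin (ℓ + 1) | a ≤ b ∧ V.transition ⟨a⟩ ⟨b⟩ e ≠ 0})
    ⟨a, le_rfl, by rwa [hV.transition_self]⟩
  obtain ⟨ξ, -, hξ⟩ := exists_linearMap_eq_one (K := K) ⊥ (by simpa using hb)
  refine ⟨a, b, e, ξ, hab, hξ, fun i hbi => ?_, fun i hia => ?_⟩
  · by_contra hi
    exact hbi.not_ge (hb_greatest ⟨hab.trans hbi.le, hi⟩)
  · by_contra hi
    exact hia.not_ge (ha_least (not_subsingleton_iff_nontrivial.mp hi))

theorem QuiverRep.IsEqualised.exists_line_split {V : QuiverRep K (LineVertex ℓ)}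
    (hV : V.IsEqualised) (hne : ¬ V.IsZero) : ∃ P W, IsLineInterval P ∧ P.Nonempty ∧
      V.Isomorphic ((thin K P).prod W) := by
  obtain ⟨a, b, e, ξ, hab, hξe, he, hsub⟩ := hV.exists_interval_generators hne
  obtain ⟨W, hW⟩ := hV.exists_isomorphic_thin_prod (P := lineInterval a b)
    (fun x hx => ⟨reaches_line_iff.mpr hx.1, reaches_line_iff.mpr hx.2⟩) e ξ hξe
    (by
      rintro _ _ (@⟨i, j, hij⟩) ⟨hai, -⟩ hj
      have haj : a ≤ j := hai.trans (Fin.le_def.mpr (Nat.le.intro hij))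
      exact he j (not_le.mp fun hjb => hj ⟨haj, hjb⟩))
    (by
      rintro _ _ (@⟨i, j, hij⟩) hi ⟨-, hjb⟩ v
      have hij : i ≤ j := Fin.le_def.mpr (Nat.le.intro hij)
      have := hsub i (not_le.mp fun hai => hi ⟨hai, hij.trans hjb⟩)
      rw [Subsingleton.elim v 0, map_zero, map_zero])
  exact ⟨_, W, ⟨a, b, hab, rfl⟩, ⟨⟨a⟩, le_rfl, hab⟩, hW⟩

theorem thin_lineInterval_isomorphic (a b : Fin (ℓ + 1)) :
    (thin K (lineInterval a b)).Isomorphic (intervalModule K a b) := by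
  have space_eq : ∀ x, thinSpace K (lineInterval a b) x = intervalSpace K a b x.idx := fun x => by
    unfold thinSpace intervalSpace
    congr
  refine ⟨fun x => LinearEquiv.ofEq _ _ (space_eq x), fun x y f v => Subtype.ext ?_⟩
  by_cases hy : y ∈ lineInterval a b
  · exact (thin_map_of_mem f hy v).trans (if_pos hy : ite (a ≤ y.idx ∧ y.idx ≤ b) v.1 0 = _).symm
  · exact (congrArg Subtype.val (thin_obj_eq_zero hy _)).trans
      (if_neg hy : ite (a ≤ y.idx ∧ y.idx ≤ b) v.1 0 = _).symm

theorem isomorphic_directSum_cons {Q : Type} [Quiver.{0} Q] {n : ℕ}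
    (V : Fin (n + 1) → QuiverRep K Q) :
    ((V 0).prod (directSum fun i : Fin n => V i.succ)).Isomorphic (directSum V) :=
  ⟨fun x => Fin.consLinearEquiv K fun i => (V i).obj x, fun _ _ _ _ => funext fun i => by
    cases i using Fin.cases <;> rfl⟩

theorem thinSum_isomorphic_directSum (l : List (Set (LineVertex ℓ)))
    (hl : ∀ P ∈ l, IsLineInterval P) : ∃ (n : ℕ) (a b : Fin n → Fin (ℓ + 1)),
      (∀ i, a i ≤ b i) ∧
        (thinSum K l).Isomorphic (directSum fun i => intervalModule K (a i) (b i)) := by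
  induction l with
  | nil =>
    exact ⟨0, finZeroElim, finZeroElim, finZeroElim,
      isZero_zero.isomorphic fun x => inferInstanceAs (Subsingleton (∀ i : Fin 0, _))⟩
  | cons P l ih =>
    obtain ⟨n, a, b, hab, hiso⟩ := ih fun R hR => hl R (List.mem_cons_of_mem _ hR)
    obtain ⟨a₀, b₀, hab₀, rfl⟩ := hl P List.mem_cons_self
    refine ⟨n + 1, Fin.cons a₀ a, Fin.cons b₀ b, Fin.cases hab₀ hab, ?_⟩
    exact ((thin_lineInterval_isomorphic a₀ b₀).prod_congr hiso).trans
      (isomorphic_directSum_cons fun i => intervalModule K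
        ((Fin.cons a₀ a : Fin (n + 1) → Fin (ℓ + 1)) i)
        ((Fin.cons b₀ b : Fin (n + 1) → Fin (ℓ + 1)) i))

theorem QuiverRep.IsEqualised.exists_barcode {V : QuiverRep K (LineVertex ℓ)}
    (hV : V.IsEqualised) : ∃ (n : ℕ) (a b : Fin n → Fin (ℓ + 1)), (∀ i, a i ≤ b i) ∧
      V.Isomorphic (directSum fun i => intervalModule K (a i) (b i)) := by
  obtain ⟨l, hl, hVl⟩ := exists_isomorphic_thinSum (C := IsEqualised)
    (fun hV h => h.isEqualised hV) (fun hV hne => hV.exists_line_split hne) hV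
  obtain ⟨n, a, b, hab, hiso⟩ := thinSum_isomorphic_directSum (K := K) l hl
  exact ⟨n, a, b, hab, hVl.trans hiso⟩

theorem mem_interval_of_ne_zero {a b : Fin (ℓ + 1)} {x : LineVertex ℓ}
    {v : (intervalModule K a b).obj x} (hv : v ≠ 0) : a ≤ x.idx ∧ x.idx ≤ b := by
  by_contra hx
  have hbot : intervalSpace K a b x.idx ≤ ⊥ := (if_neg hx).le
  exact hv (Subtype.ext ((Submodule.mem_bot K).mp (hbot v.2)))

theorem intervalModule_transition {a b : Fin (ℓ + 1)} {x y : LineVertex ℓ} (hxy : x.idx ≤ y.idx)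
    (hx : a ≤ x.idx) (hy : y.idx ≤ b) (v : (intervalModule K a b).obj x) :
    ((intervalModule K a b).transition x y v).1 = v.1 := by
  have mapPath_eq : ∀ {y : LineVertex ℓ} (p : Quiver.Path x y), y.idx ≤ b →
      ((intervalModule K a b).mapPath p v).1 = v.1 := by
    intro y p hy
    induction p with
    | nil => rfl
    | @cons y z p e ih =>
      have hxz : x.idx ≤ z.idx := reaches_line_iff.mp ⟨p.cons e⟩
      exact (if_pos ⟨hx.trans hxz, hy⟩).trans (ih ((reaches_line_iff.mp ⟨e.toPath⟩).trans hy))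
  unfold transition
  rw [dif_pos (reaches_line_iff.mpr hxy)]
  exact mapPath_eq _ hy

theorem intervalModule_transition_surjective {a b : Fin (ℓ + 1)} {x y : LineVertex ℓ}
    (hxy : x.idx ≤ y.idx) (hx : a ≤ x.idx) :
    Function.Surjective ((intervalModule K a b).transition x y) := by
  intro w
  by_cases hw : w = 0
  · exact ⟨0, by rw [map_zero, hw]⟩
  have hy : y.idx ≤ b := (mem_interval_of_ne_zero hw).2
  have htop : ⊤ ≤ intervalSpace K a b x.idx := (if_pos ⟨hx, hxy.trans hy⟩).ge
  exact ⟨⟨w.1, htop trivial⟩, Subtype.ext (intervalModule_transition hxy hx hy _)⟩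

/-- The projection of a direct sum onto a summand. -/
def directSumProj {Q : Type} [Quiver.{0} Q] {n : ℕ} (V : Fin n → QuiverRep K Q) (i : Fin n) :
    Hom (directSum V) (V i) where
  app _ := LinearMap.proj i
  naturality _ _ := rfl

theorem directSum_transition_apply {Q : Type} [Quiver.{0} Q] {n : ℕ} (V : Fin n → QuiverRep K Q)
    {x y : Q} (v : (directSum V).obj x) (i : Fin n) :
    (directSum V).transition x y v i = (V i).transition x y (v i) :=
  (directSumProj V i).app_transition v

/-- If neither inclusion holds, then some interval contains `x` and `z`, while another one, which
contains `y`, is born after `x` and dies before `z`. -/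
theorem comparable_of_hasNoNestedIntervals {V : QuiverRep K (LineVertex ℓ)}
    (hV : V.IsEqualised) (hn : HasNoNestedIntervals V) {x y z : LineVertex ℓ}
    (hxy : x.idx ≤ y.idx) (hyz : y.idx ≤ z.idx) : V.Comparable x y z := by
  obtain ⟨n, a, b, hab, hiso⟩ := hV.exists_barcode
  refine hiso.isRetract.comparable ?_
  by_contra hcomp
  obtain ⟨hker, hrange⟩ := not_or.mp hcomp
  obtain ⟨w, hw, hw_range⟩ := Set.not_subset.mp hker
  obtain ⟨_, ⟨u, rfl⟩, hu⟩ := Set.not_subset.mp hrange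
  obtain ⟨i, hi⟩ := Function.ne_iff.mp hu
  simp only [directSum_transition_apply] at hi
  have hai : a i ≤ x.idx :=
    (mem_interval_of_ne_zero fun h : u i = 0 => hi (by rw [h, map_zero, map_zero]; rfl)).1
  have hbi : z.idx ≤ b i := (mem_interval_of_ne_zero hi).2
  obtain ⟨j, hj, hxj⟩ : ∃ j, w j ≠ 0 ∧ x.idx < a j := by
    by_contra! hall
    have hlift : ∀ j, ∃ v, (intervalModule K (a j) (b j)).transition x y v = w j := fun j => by
      by_cases hj : w j = 0
      · exact ⟨0, by rw [map_zero, hj]⟩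
      · exact intervalModule_transition_surjective hxy (hall j hj) _
    choose v hv using hlift
    exact hw_range ⟨v, funext fun j => (directSum_transition_apply _ _ j).trans (hv j)⟩
  have hjz : b j < z.idx := by
    by_contra! hzj
    have hwj : (intervalModule K (a j) (b j)).transition y z (w j) = 0 :=
      (directSum_transition_apply _ w j).symm.trans (congrFun hw j)
    exact hj (Subtype.ext ((intervalModule_transition hyz (mem_interval_of_ne_zero hj).1 hzj
      (w j)).symm.trans (congrArg Subtype.val hwj)))
  exact hn n a b hab hiso ⟨i, j, hai.trans_lt hxj, hjz.trans_le hbi⟩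

theorem hasNoNestedIntervals_of_dimVec_le_one {V : QuiverRep K (LineVertex ℓ)}
    (hV : ∀ x, V.dimVec x ≤ 1) : HasNoNestedIntervals V := by
  rintro n a b hab hiso ⟨i, j, hij, hji⟩
  have dimVec_eq : V.dimVec ⟨a j⟩ =
      ∑ k, Module.finrank K (intervalSpace K (a k) (b k) (a j)) :=
    (congrFun hiso.dimVec_eq _).trans (Module.finrank_pi_fintype K)
  have one_le : ∀ k ∈ ({i, j} : Finset (Fin n)),
      1 ≤ Module.finrank K (intervalSpace K (a k) (b k) (a j)) := by
    intro k hk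
    have hkj : a k ≤ a j ∧ a j ≤ b k := by
      rcases Finset.mem_insert.mp hk with rfl | hk
      · exact ⟨hij.le, (hab j).trans hji.le⟩
      · rw [Finset.mem_singleton.mp hk]
        exact ⟨le_rfl, hab j⟩
    rw [intervalSpace, if_pos hkj, finrank_top, Module.finrank_self]
  have hne : i ≠ j := fun h => hij.ne (congrArg a h)
  have htwo : 2 ≤ V.dimVec ⟨a j⟩ := calc
    2 = ({i, j} : Finset (Fin n)).card • 1 := by rw [Finset.card_pair hne, smul_eq_mul, mul_one]
    _ ≤ ∑ k ∈ {i, j}, Module.finrank K (intervalSpace K (a k) (b k) (a j)) :=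
        Finset.card_nsmul_le_sum _ _ _ one_le
    _ ≤ V.dimVec ⟨a j⟩ := dimVec_eq ▸ Finset.sum_le_sum_of_subset (Finset.subset_univ _)
  exact absurd (hV ⟨a j⟩) (by lia)

end Line

/-! ### Blocks split off from representations of the ladder -/

section Comparable

variable {K : Type u} [Field K] {Q : Type} [Quiver.{0} Q] {V : QuiverRep K Q}

theorem QuiverRep.Comparable.ker_le_range {x y z : Q} (h : V.Comparable x y z) {e : V.obj x}
    (he : V.transition y z (V.transition x y e) ≠ 0) :
    LinearMap.ker (V.transition y z) ≤ LinearMap.range (V.transition x y) :=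
  h.resolve_right fun hle => he (hle ⟨e, rfl⟩)

theorem QuiverRep.Comparable.mem_range {x y z : Q} (h : V.Comparable x y z) {v : V.obj y}
    (hv : V.transition y z v ≠ 0) {u : V.obj x}
    (hu : V.transition y z (V.transition x y u) = V.transition y z v) :
    v ∈ LinearMap.range (V.transition x y) := by
  have hker : v - V.transition x y u ∈ LinearMap.ker (V.transition y z) := by
    rw [LinearMap.mem_ker, map_sub, hu, sub_self]
  obtain ⟨u', hu'⟩ := h.ker_le_range (hu ▸ hv) hker
  exact ⟨u' + u, by rw [map_add, hu', sub_add_cancel]⟩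

theorem exists_linearMap_comp_eq {M N : Type*} [AddCommGroup M] [Module K M] [AddCommGroup N]
    [Module K N] (f : M →ₗ[K] N) (g : M →ₗ[K] K) (h : LinearMap.ker f ≤ LinearMap.ker g) :
    ∃ ξ : N →ₗ[K] K, ∀ v, ξ (f v) = g v := by
  have hg : g ∈ LinearMap.range f.dualMap := by
    rw [LinearMap.range_dualMap_eq_dualAnnihilator_ker, Submodule.mem_dualAnnihilator]
    exact fun v hv => h hv
  obtain ⟨ξ, rfl⟩ := hg
  exact ⟨ξ, fun v => rfl⟩

end Comparable

section Ladder

variable {ℓ : ℕ}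

theorem reaches_top_top {i j : Fin (ℓ + 1)} (h : i ≤ j) :
    Reaches (.top i : LadderVertex ℓ) (.top j) :=
  (reaches_line_iff (x := ⟨i⟩) (y := ⟨j⟩)).mpr h |>.map (topRow ℓ).mapPath

theorem reaches_bot_bot {i j : Fin (ℓ + 1)} (h : i ≤ j) :
    Reaches (.bot i : LadderVertex ℓ) (.bot j) :=
  (reaches_line_iff (x := ⟨i⟩) (y := ⟨j⟩)).mpr h |>.map (botRow ℓ).mapPath

theorem reaches_top_bot {i j : Fin (ℓ + 1)} (h : i ≤ j) :
    Reaches (.top i : LadderVertex ℓ) (.bot j) :=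
  (reaches_top_top h).map fun p => p.cons (.down j)

/-- The vertices `top i` with `a ≤ i < b` and `bot j` with `c ≤ j < d`. -/
def block (ℓ a b c d : ℕ) : Set (LadderVertex ℓ) :=
  {x | match x with
    | .top i => a ≤ i.val ∧ i.val < b
    | .bot j => c ≤ j.val ∧ j.val < d}

theorem top_mem_block {a b c d : ℕ} {i : Fin (ℓ + 1)} :
    .top i ∈ block ℓ a b c d ↔ a ≤ i.val ∧ i.val < b := Iff.rfl

theorem bot_mem_block {a b c d : ℕ} {i : Fin (ℓ + 1)} :
    .bot i ∈ block ℓ a b c d ↔ c ≤ i.val ∧ i.val < d := Iff.rfl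

/-- The parameters of the supports of indecomposable nestfree representations. Representations
supported in the top row have `c = d = a`, and those supported in the bottom row have
`a = b = 0`. -/
def BlockShape (ℓ a b c d : ℕ) : Prop :=
  (a < b ∧ b ≤ ℓ + 1 ∧ c ≤ a ∧ a ≤ d ∧ d ≤ b ∧ (a = d → c = a)) ∨
    (a = 0 ∧ b = 0 ∧ c < d ∧ d ≤ ℓ + 1)

/-- The supports of indecomposable nestfree representations. -/
def IsBlock (P : Set (LadderVertex ℓ)) : Prop :=
  ∃ a b c d, BlockShape ℓ a b c d ∧ P = block ℓ a b c d

variable {K : Type u} [Field K] {V : QuiverRep K (LadderVertex ℓ)} {a b c d : Fin (ℓ + 1)}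

/-- The vectors obtained by transporting `e` along the top row and `f` along the bottom row. -/
noncomputable def rowVectors (e : V.obj (.top a)) (f : V.obj (.bot c)) : ∀ x, V.obj x
  | .top i => V.transition (.top a) (.top i) e
  | .bot j => V.transition (.bot c) (.bot j) f

/-- The functionals obtained by pulling back `ξ` along the top row and `η` along the bottom
row. -/
noncomputable def rowFunctionals (ξ : V.obj (.top b) →ₗ[K] K) (η : V.obj (.bot d) →ₗ[K] K) :
    ∀ x, V.obj x →ₗ[K] K
  | .top i => ξ ∘ₗ V.transition (.top i) (.top b)
  | .bot j => η ∘ₗ V.transition (.bot j) (.bot d)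

open Classical in
theorem QuiverRep.IsEqualised.map_rowVectors (hV : V.IsEqualised) (hca : c ≤ a) (had : a ≤ d)
    {e : V.obj (.top a)} {f : V.obj (.bot c)}
    (hfe : V.transition (.bot c) (.bot a) f = V.transition (.top a) (.bot a) e)
    (hb : ∀ i > b, V.transition (.top a) (.top i) e = 0)
    (hd : ∀ i > d, V.transition (.top a) (.bot i) e = 0)
    {x y : LadderVertex ℓ} (g : x ⟶ y) (hx : x ∈ block ℓ a (b + 1) c (d + 1)) :
    V.map g (rowVectors e f x) =
      if y ∈ block ℓ a (b + 1) c (d + 1) then rowVectors e f y else 0 := by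
  have hfe_bot : ∀ j, a ≤ j → V.transition (.bot c) (.bot j) f =
      V.transition (.top a) (.bot j) e := fun j hj => by
    rw [← hV.transition_transition (reaches_bot_bot hca) (reaches_bot_bot hj), hfe,
      hV.transition_transition (reaches_top_bot le_rfl) (reaches_bot_bot hj)]
  rw [hV.map_eq_transition g]
  obtain @⟨i, j, hij⟩ | @⟨i, j, hij⟩ | ⟨i⟩ := g <;>
    simp only [top_mem_block, bot_mem_block] at * <;>
    simp only [rowVectors]
  · rw [hV.transition_transition (reaches_top_top (by lia)) (reaches_top_top (by lia))]
    split_ifs with hy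
    exacts [rfl, hb j (by lia)]
  · rw [hV.transition_transition (reaches_bot_bot (by lia)) (reaches_bot_bot (by lia))]
    split_ifs with hy
    exacts [rfl, (hfe_bot j (by lia)).trans (hd j (by lia))]
  · rw [hV.transition_transition (reaches_top_top (by lia)) (reaches_top_bot le_rfl)]
    split_ifs with hy
    exacts [(hfe_bot i (by lia)).symm, hd i (by lia)]

open Classical in
theorem QuiverRep.IsEqualised.rowFunctionals_map (hV : V.IsEqualised) (had : a ≤ d) (hdb : d ≤ b)
    {ξ : V.obj (.top b) →ₗ[K] K} {η : V.obj (.bot d) →ₗ[K] K}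
    (hξη : ∀ v, ξ (V.transition (.top d) (.top b) v) = η (V.transition (.top d) (.bot d) v))
    (ha : ∀ i < a, ∀ v, η (V.transition (.top i) (.bot d) v) = 0)
    (hc : ∀ i < c, ∀ v, η (V.transition (.bot i) (.bot d) v) = 0)
    {x y : LadderVertex ℓ} (g : x ⟶ y) (hy : y ∈ block ℓ a (b + 1) c (d + 1)) (v : V.obj x) :
    rowFunctionals ξ η y (V.map g v) =
      if x ∈ block ℓ a (b + 1) c (d + 1) then rowFunctionals ξ η x v else 0 := by
  have hξη_top : ∀ i ≤ d, ∀ v : V.obj (.top i), ξ (V.transition (.top i) (.top b) v) =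
      η (V.transition (.top i) (.bot d) v) := fun i hi v => by
    rw [← hV.transition_transition (reaches_top_top hi) (reaches_top_top hdb), hξη,
      hV.transition_transition (reaches_top_top hi) (reaches_top_bot le_rfl)]
  rw [hV.map_eq_transition g]
  obtain @⟨i, j, hij⟩ | @⟨i, j, hij⟩ | ⟨i⟩ := g <;>
    simp only [top_mem_block, bot_mem_block] at * <;>
    simp only [rowFunctionals, LinearMap.comp_apply]
  · rw [hV.transition_transition (reaches_top_top (by lia)) (reaches_top_top (by lia))]
    split_ifs with hx
    exacts [rfl, (hξη_top i (by lia) v).trans (ha i (by lia) v)]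
  · rw [hV.transition_transition (reaches_bot_bot (by lia)) (reaches_bot_bot (by lia))]
    split_ifs with hx
    exacts [rfl, hc i (by lia) v]
  · rw [hV.transition_transition (reaches_top_bot le_rfl) (reaches_bot_bot (by lia))]
    split_ifs with hx
    exacts [(hξη_top i (by lia) v).symm, ha i (by lia) v]

/-- A block with two nonempty rows is generated at `top a` and `bot c`, and cogenerated at `top b`
and `bot d`. -/
theorem QuiverRep.IsEqualised.exists_block_split (hV : V.IsEqualised) (hca : c ≤ a) (had : a ≤ d)
    (hdb : d ≤ b) {e : V.obj (.top a)} {f : V.obj (.bot c)} {ξ : V.obj (.top b) →ₗ[K] K}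
    {η : V.obj (.bot d) →ₗ[K] K} (hηe : η (V.transition (.top a) (.bot d) e) = 1)
    (hfe : V.transition (.bot c) (.bot a) f = V.transition (.top a) (.bot a) e)
    (hξη : ∀ v, ξ (V.transition (.top d) (.top b) v) = η (V.transition (.top d) (.bot d) v))
    (hb : ∀ i > b, V.transition (.top a) (.top i) e = 0)
    (hd : ∀ i > d, V.transition (.top a) (.bot i) e = 0)
    (ha : ∀ i < a, ∀ v, η (V.transition (.top i) (.bot d) v) = 0)
    (hc : ∀ i < c, ∀ v, η (V.transition (.bot i) (.bot d) v) = 0) :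
    ∃ W, V.Isomorphic ((thin K (block ℓ a (b + 1) c (d + 1))).prod W) := by
  refine QuiverRep.exists_isomorphic_thin_prod (rowVectors e f) (rowFunctionals ξ η) ?_
    (hV.map_rowVectors hca had hfe hb hd) (hV.rowFunctionals_map had hdb hξη ha hc)
  rintro (i | j) hx <;> simp only [top_mem_block, bot_mem_block] at hx <;>
    simp only [rowVectors, rowFunctionals, LinearMap.comp_apply]
  · rw [hV.transition_transition (reaches_top_top (by lia)) (reaches_top_top (by lia)),
      ← hV.transition_transition (reaches_top_top had) (reaches_top_top hdb), hξη,
      hV.transition_transition (reaches_top_top had) (reaches_top_bot le_rfl), hηe]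
  · rw [hV.transition_transition (reaches_bot_bot (by lia)) (reaches_bot_bot (by lia)),
      ← hV.transition_transition (reaches_bot_bot hca) (reaches_bot_bot had), hfe,
      hV.transition_transition (reaches_top_bot le_rfl) (reaches_bot_bot had), hηe]

theorem exists_isLeast_le_of_monotoneOn {α : Type*} [PartialOrder α] [OrderBot α] {N : α}
    (hN : N ≠ ⊥) (R : Fin (ℓ + 1) → α) (hR : MonotoneOn R (Set.Iic d)) (hd : N ≤ R d) :
    ∃ c L, N ≤ R c ∧ (∀ i < c, R i ≤ L) ∧ ¬ N ≤ L := by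
  obtain ⟨c, ⟨hcd, hc⟩, hc_least⟩ := exists_isLeast (S := {c | c ≤ d ∧ N ≤ R c}) ⟨d, le_rfl, hd⟩
  cases c using Fin.cases with
  | zero =>
    exact ⟨0, ⊥, hc, fun i hi => absurd hi (Fin.not_lt_zero i), fun h => hN (le_bot_iff.mp h)⟩
  | succ c =>
    have hlt : c.castSucc < c.succ := Fin.castSucc_lt_succ
    refine ⟨c.succ, R c.castSucc, hc, fun i hi => ?_,
      fun h => hlt.not_ge (hc_least ⟨hlt.le.trans hcd, h⟩)⟩
    have hi : i ≤ c.castSucc := Fin.le_castSucc_iff.mpr hi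
    exact hR (hi.trans (hlt.le.trans hcd)) (hlt.le.trans hcd) hi

/-- Among the vectors of the top row that do not end up in `L`, choose one that is born as early as
possible and, among these, one that dies as early as possible. -/
theorem QuiverRep.IsEqualised.exists_top_generator (hV : V.IsEqualised)
    (L : Submodule K (V.obj (.bot d))) (hL : ∃ v, V.transition (.top d) (.bot d) v ∉ L) :
    ∃ (a b : Fin (ℓ + 1)) (e : V.obj (.top a)), a ≤ d ∧ d ≤ b ∧
      V.transition (.top a) (.bot d) e ∉ L ∧
      (∀ i < a, ∀ v, V.transition (.top i) (.bot d) v ∈ L) ∧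
      (∀ i > b, V.transition (.top a) (.top i) e = 0) ∧
      ∀ e', V.transition (.top a) (.bot d) e' ∉ L → V.transition (.top a) (.top b) e' ≠ 0 := by
  obtain ⟨a, ⟨had, ha⟩, ha_least⟩ := exists_isLeast
    (S := {a | a ≤ d ∧ ∃ e, V.transition (.top a) (.bot d) e ∉ L}) ⟨d, le_rfl, hL⟩
  have exists_death : ∀ e, V.transition (.top a) (.bot d) e ∉ L →
      ∃ b, IsGreatest {i | a ≤ i ∧ V.transition (.top a) (.top i) e ≠ 0} b ∧ d ≤ b := by
    intro e he
    have hd : d ∈ {i | a ≤ i ∧ V.transition (.top a) (.top i) e ≠ 0} := by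
      refine ⟨had, fun hzero => he ?_⟩
      rw [← hV.transition_transition (reaches_top_top had) (reaches_top_bot le_rfl), hzero,
        map_zero]
      exact zero_mem L
    obtain ⟨b, hb⟩ := exists_isGreatest ⟨d, hd⟩
    exact ⟨b, hb, hb.2 hd⟩
  obtain ⟨b, ⟨e, he, hb, hdb⟩, hb_least⟩ := exists_isLeast
    (S := {b | ∃ e, V.transition (.top a) (.bot d) e ∉ L ∧
      IsGreatest {i | a ≤ i ∧ V.transition (.top a) (.top i) e ≠ 0} b ∧ d ≤ b}) <| by
    obtain ⟨e, he⟩ := ha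
    exact (exists_death e he).imp fun b hb => ⟨e, he, hb⟩
  refine ⟨a, b, e, had, hdb, he, fun i hia v => ?_, fun i hbi => ?_, fun e' he' hzero => ?_⟩
  · by_contra hv
    exact hia.not_ge (ha_least ⟨hia.le.trans had, v, hv⟩)
  · by_contra hi
    exact hbi.not_ge (hb.2 ⟨hb.1.1.trans hbi.le, hi⟩)
  · obtain ⟨b', hb', hdb'⟩ := exists_death e' he'
    refine hb'.1.2 ?_
    rw [← hV.transition_transition (reaches_top_top (had.trans hdb))
      (reaches_top_top (hb_least ⟨e', he', hb', hdb'⟩)), hzero, map_zero]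

theorem QuiverRep.IsEqualised.exists_bot_lift (hV : V.IsEqualised) (hca : c ≤ a) (had : a ≤ d)
    (hbot : V.Comparable (.bot c) (.bot a) (.bot d)) {e : V.obj (.top a)}
    (he : V.transition (.top a) (.bot d) e ≠ 0)
    (hc : V.transition (.top a) (.bot d) e ∈ LinearMap.range (V.transition (.bot c) (.bot d))) :
    ∃ f, V.transition (.bot c) (.bot a) f = V.transition (.top a) (.bot a) e := by
  have he_bot := hV.transition_transition (reaches_top_bot le_rfl) (reaches_bot_bot had) e
  obtain ⟨u, hu⟩ := hc
  refine hbot.mem_range (u := u) (he_bot ▸ he) ?_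
  rw [he_bot, hV.transition_transition (reaches_bot_bot hca) (reaches_bot_bot had), hu]

theorem QuiverRep.IsEqualised.exists_top_extension (hV : V.IsEqualised) (had : a ≤ d)
    (hdb : d ≤ b) (htop : V.Comparable (.top a) (.top d) (.top b)) {e : V.obj (.top a)}
    {η : V.obj (.bot d) →ₗ[K] K} (hηe : η (V.transition (.top a) (.bot d) e) = 1)
    (hb : ∀ e', η (V.transition (.top a) (.bot d) e') ≠ 0 →
      V.transition (.top a) (.top b) e' ≠ 0) :
    ∃ ξ : V.obj (.top b) →ₗ[K] K,
      ∀ v, ξ (V.transition (.top d) (.top b) v) = η (V.transition (.top d) (.bot d) v) := by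
  have transition_top := hV.transition_transition (reaches_top_top had) (reaches_top_top hdb)
  refine exists_linearMap_comp_eq _ (η ∘ₗ V.transition (.top d) (.bot d)) fun v hv => ?_
  have he : V.transition (.top a) (.top b) e ≠ 0 := hb e (by rw [hηe]; exact one_ne_zero)
  obtain ⟨e', rfl⟩ := htop.ker_le_range (transition_top e ▸ he) hv
  rw [LinearMap.mem_ker, transition_top] at hv
  rw [LinearMap.mem_ker, LinearMap.comp_apply,
    hV.transition_transition (reaches_top_top had) (reaches_top_bot le_rfl)]
  exact not_not.mp fun he' => hb e' he' hv

theorem QuiverRep.IsEqualised.exists_split_of_down_ne_zero (hV : V.IsEqualised)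
    (htop : ∀ i j k : Fin (ℓ + 1), i ≤ j → j ≤ k → V.Comparable (.top i) (.top j) (.top k))
    (hbot : ∀ i j k : Fin (ℓ + 1), i ≤ j → j ≤ k → V.Comparable (.bot i) (.bot j) (.bot k))
    (hdown : ∃ i : Fin (ℓ + 1), V.transition (.top i) (.bot i) ≠ 0) :
    ∃ P W, IsBlock P ∧ P.Nonempty ∧ V.Isomorphic ((thin K P).prod W) := by
  obtain ⟨d, hd, hd_greatest⟩ := exists_isGreatest
    (S := {i : Fin (ℓ + 1) | V.transition (.top i) (.bot i) ≠ 0}) hdown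
  obtain ⟨c, L, hc, hcL, hdL⟩ := exists_isLeast_le_of_monotoneOn (d := d)
    (mt LinearMap.range_eq_bot.mp hd) (fun i => LinearMap.range (V.transition (.bot i) (.bot d)))
    (by
      rintro i - j hjd hij _ ⟨v, rfl⟩
      exact ⟨V.transition _ _ v,
        hV.transition_transition (reaches_bot_bot hij) (reaches_bot_bot hjd) v⟩)
    fun v _ => ⟨v, hV.transition_self v⟩
  obtain ⟨_, ⟨v, rfl⟩, hv⟩ := Set.not_subset.mp hdL
  obtain ⟨a, b, e, had, hdb, he, haL, heb, hb⟩ := hV.exists_top_generator L ⟨v, hv⟩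
  have hca : c ≤ a := by
    by_contra! hac
    exact he (hcL a hac ⟨V.transition (.top a) (.bot a) e,
      hV.transition_transition (reaches_top_bot le_rfl) (reaches_bot_bot had) e⟩)
  have hed : ∀ i > d, V.transition (.top a) (.bot i) e = 0 := fun i hdi => by
    have hdown_i : V.transition (.top i) (.bot i) = 0 := by
      by_contra hi
      exact hdi.not_ge (hd_greatest hi)
    rw [← hV.transition_transition (reaches_top_top (had.trans hdi.le)) (reaches_top_bot le_rfl),
      hdown_i, LinearMap.zero_apply]
  obtain ⟨η, hηL, hηe⟩ := exists_linearMap_eq_one L he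
  obtain ⟨f, hf⟩ := hV.exists_bot_lift hca had (hbot c a d hca had)
    (fun hzero => he (hzero ▸ zero_mem L))
    (hc ⟨V.transition (.top a) (.top d) e,
      hV.transition_transition (reaches_top_top had) (reaches_top_bot le_rfl) e⟩)
  obtain ⟨ξ, hξ⟩ := hV.exists_top_extension had hdb (htop a d b had hdb) hηe
    fun e' he' => hb e' (mt (hηL _) he')
  obtain ⟨W, hW⟩ := hV.exists_block_split hca had hdb hηe hf hξ heb hed
    (fun i hi v => hηL _ (haL i hi v)) (fun i hi v => hηL _ (hcL i hi ⟨v, rfl⟩))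
  exact ⟨_, W, ⟨a, b + 1, c, d + 1, Or.inl (by lia), rfl⟩, ⟨.top a, le_rfl, by lia⟩, hW⟩

theorem QuiverRep.IsEqualised.exists_top_generators (hV : V.IsEqualised)
    (hne : ¬ (V.restrict (topRow ℓ)).IsZero) :
    ∃ (a b : Fin (ℓ + 1)) (e : V.obj (.top a)) (ξ : V.obj (.top b) →ₗ[K] K), a ≤ b ∧
      ξ (V.transition (.top a) (.top b) e) = 1 ∧
      (∀ i > b, V.transition (.top a) (.top i) e = 0) ∧
      ∀ i < a, Subsingleton (V.obj (.top i)) := by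
  obtain ⟨a, b, e, ξ, hab, hξe, he, hsub⟩ :=
    (hV.restrict (topRow ℓ)).exists_interval_generators hne
  have transition_eq : ∀ {i : Fin (ℓ + 1)}, a ≤ i →
      (V.restrict (topRow ℓ)).transition ⟨a⟩ ⟨i⟩ = V.transition (.top a) (.top i) :=
    fun h => hV.transition_restrict _ (reaches_line_iff.mpr h)
  exact ⟨a, b, e, ξ, hab, transition_eq hab ▸ hξe,
    fun i hi => transition_eq (hab.trans hi.le) ▸ he i hi, hsub⟩

theorem QuiverRep.IsEqualised.exists_top_split (hV : V.IsEqualised)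
    (hdown : ∀ i : Fin (ℓ + 1), V.transition (.top i) (.bot i) = 0)
    (hne : ¬ (V.restrict (topRow ℓ)).IsZero) :
    ∃ P W, IsBlock P ∧ P.Nonempty ∧ V.Isomorphic ((thin K P).prod W) := by
  obtain ⟨a, b, e, ξ, hab, hξe, he, hsub⟩ := hV.exists_top_generators hne
  obtain ⟨W, hW⟩ := hV.exists_isomorphic_thin_prod (P := block ℓ a (b + 1) a a) (a := .top a)
    (b := .top b) (by
      rintro (i | i) ⟨hai, hib⟩
      · exact ⟨reaches_top_top hai, reaches_top_top (by lia)⟩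
      · lia) e ξ hξe
    (by
      rintro _ _ (@⟨i, j, hij⟩ | @⟨i, j, hij⟩ | ⟨i⟩) ⟨hai, hib⟩ hj
      · rw [top_mem_block] at hj
        exact he j (by lia)
      · lia
      · rw [← hV.transition_transition (reaches_top_top hai) (reaches_top_bot le_rfl), hdown,
          LinearMap.zero_apply])
    (by
      rintro _ _ (@⟨i, j, hij⟩ | @⟨i, j, hij⟩ | ⟨i⟩) hi ⟨haj, hjb⟩ v
      · rw [top_mem_block] at hi
        have : Subsingleton (V.obj (.top i)) := hsub i (by lia)
        rw [Subsingleton.elim v 0, map_zero, map_zero]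
      all_goals lia)
  exact ⟨_, W, ⟨a, b + 1, a, a, Or.inl (by lia), rfl⟩, ⟨.top a, le_rfl, by lia⟩, hW⟩

theorem QuiverRep.IsEqualised.exists_bot_generators (hV : V.IsEqualised)
    (hne : ¬ (V.restrict (botRow ℓ)).IsZero) :
    ∃ (a b : Fin (ℓ + 1)) (e : V.obj (.bot a)) (ξ : V.obj (.bot b) →ₗ[K] K), a ≤ b ∧
      ξ (V.transition (.bot a) (.bot b) e) = 1 ∧
      (∀ i > b, V.transition (.bot a) (.bot i) e = 0) ∧
      ∀ i < a, Subsingleton (V.obj (.bot i)) := by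
  obtain ⟨a, b, e, ξ, hab, hξe, he, hsub⟩ :=
    (hV.restrict (botRow ℓ)).exists_interval_generators hne
  have transition_eq : ∀ {i : Fin (ℓ + 1)}, a ≤ i →
      (V.restrict (botRow ℓ)).transition ⟨a⟩ ⟨i⟩ = V.transition (.bot a) (.bot i) :=
    fun h => hV.transition_restrict _ (reaches_line_iff.mpr h)
  exact ⟨a, b, e, ξ, hab, transition_eq hab ▸ hξe,
    fun i hi => transition_eq (hab.trans hi.le) ▸ he i hi, hsub⟩

theorem QuiverRep.IsEqualised.exists_bot_split (hV : V.IsEqualised)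
    (htop : (V.restrict (topRow ℓ)).IsZero) (hne : ¬ (V.restrict (botRow ℓ)).IsZero) :
    ∃ P W, IsBlock P ∧ P.Nonempty ∧ V.Isomorphic ((thin K P).prod W) := by
  obtain ⟨a, b, e, ξ, hab, hξe, he, hsub⟩ := hV.exists_bot_generators hne
  obtain ⟨W, hW⟩ := hV.exists_isomorphic_thin_prod (P := block ℓ 0 0 a (b + 1)) (a := .bot a)
    (b := .bot b) (by
      rintro (i | i) ⟨hai, hib⟩
      · lia
      · exact ⟨reaches_bot_bot hai, reaches_bot_bot (by lia)⟩) e ξ hξe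
    (by
      rintro _ _ (@⟨i, j, hij⟩ | @⟨i, j, hij⟩ | ⟨i⟩) ⟨hai, hib⟩ hj
      · lia
      · rw [bot_mem_block] at hj
        exact he j (by lia)
      · lia)
    (by
      rintro _ _ (@⟨i, j, hij⟩ | @⟨i, j, hij⟩ | ⟨i⟩) hi ⟨haj, hjb⟩ v
      · lia
      · rw [bot_mem_block] at hi
        have : Subsingleton (V.obj (.bot i)) := hsub i (by lia)
        rw [Subsingleton.elim v 0, map_zero, map_zero]
      · have : Subsingleton (V.obj (.top i)) := htop ⟨i⟩
        rw [Subsingleton.elim v 0, map_zero, map_zero])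
  exact ⟨_, W, ⟨0, 0, a, b + 1, Or.inr (by lia), rfl⟩, ⟨.bot a, le_rfl, by lia⟩, hW⟩

theorem IsNestfree.comparable_top (hV : IsNestfree V) {i j k : Fin (ℓ + 1)} (hij : i ≤ j)
    (hjk : j ≤ k) : V.Comparable (.top i) (.top j) (.top k) := by
  have h := comparable_of_hasNoNestedIntervals (x := ⟨i⟩) (y := ⟨j⟩) (z := ⟨k⟩)
    (hV.equalised.restrict (topRow ℓ)) hV.top hij hjk
  unfold Comparable at h ⊢
  rwa [hV.equalised.transition_restrict _ (reaches_line_iff.mpr hij),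
    hV.equalised.transition_restrict _ (reaches_line_iff.mpr hjk)] at h

theorem IsNestfree.comparable_bot (hV : IsNestfree V) {i j k : Fin (ℓ + 1)} (hij : i ≤ j)
    (hjk : j ≤ k) : V.Comparable (.bot i) (.bot j) (.bot k) := by
  have h := comparable_of_hasNoNestedIntervals (x := ⟨i⟩) (y := ⟨j⟩) (z := ⟨k⟩)
    (hV.equalised.restrict (botRow ℓ)) hV.bot hij hjk
  unfold Comparable at h ⊢
  rwa [hV.equalised.transition_restrict _ (reaches_line_iff.mpr hij),
    hV.equalised.transition_restrict _ (reaches_line_iff.mpr hjk)] at h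

theorem IsNestfree.exists_isomorphic_thinSum (hV : IsNestfree V) :
    ∃ l : List (Set (LadderVertex ℓ)), (∀ P ∈ l, IsBlock P) ∧ V.Isomorphic (thinSum K l) := by
  refine QuiverRep.exists_isomorphic_thinSum (C := fun V : QuiverRep K (LadderVertex ℓ) =>
    V.IsEqualised ∧
    (∀ i j k : Fin (ℓ + 1), i ≤ j → j ≤ k → V.Comparable (.top i) (.top j) (.top k)) ∧
    (∀ i j k : Fin (ℓ + 1), i ≤ j → j ≤ k → V.Comparable (.bot i) (.bot j) (.bot k)))
    (fun hC h => ⟨h.isEqualised hC.1, fun i j k hij hjk => h.comparable (hC.2.1 i j k hij hjk),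
      fun i j k hij hjk => h.comparable (hC.2.2 i j k hij hjk)⟩) (fun {V} hC hne => ?_)
    ⟨hV.equalised, fun _ _ _ => hV.comparable_top, fun _ _ _ => hV.comparable_bot⟩
  obtain ⟨hV, htop, hbot⟩ := hC
  by_cases hdown : ∃ i : Fin (ℓ + 1), V.transition (.top i) (.bot i) ≠ 0
  · exact hV.exists_split_of_down_ne_zero htop hbot hdown
  push Not at hdown
  by_cases htop_zero : (V.restrict (topRow ℓ)).IsZero
  · refine hV.exists_bot_split htop_zero fun hbot_zero => hne ?_
    rintro (i | i)
    exacts [htop_zero ⟨i⟩, hbot_zero ⟨i⟩]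
  · exact hV.exists_top_split hdown htop_zero

end Ladder

/-! ### Thin representations and their parts -/

namespace QuiverRep

section UpSets

variable {Q : Type} [Quiver.{0} Q] {P U S : Set Q}

/-- `U` is a subset of `P` which is closed under paths within `P`. -/
def IsUpSetIn (P U : Set Q) : Prop := U ⊆ P ∧ ∀ x ∈ U, ∀ y ∈ P, Reaches x y → y ∈ U

/-- All paths between members of `P` stay in `P`. -/
def PathConvex (P : Set Q) : Prop :=
  ∀ x ∈ P, ∀ z ∈ P, ∀ y, Reaches x y → Reaches y z → y ∈ P

/-- The members of `P` which can be reached from `S`, that is, the up-set of `P` generated by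
`S ∩ P` when `P` is path convex. -/
def gen (P S : Set Q) : Set Q := {y ∈ P | ∃ x ∈ S, Reaches x y}

/-- The minimal members of `R` for the flow order. -/
def minSet (R : Set Q) : Set Q := {x ∈ R | ∀ y ∈ R, Reaches y x → y = x}

theorem isUpSetIn_gen (P S : Set Q) : IsUpSetIn P (gen P S) :=
  ⟨fun _ h => h.1, fun _ ⟨_, s, hs, ⟨p⟩⟩ _ hy ⟨q⟩ => ⟨hy, s, hs, ⟨p.comp q⟩⟩⟩

theorem gen_empty (P : Set Q) : gen P ∅ = ∅ := by simp [gen]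

theorem mem_gen_of_mem {x : Q} (hP : x ∈ P) (hS : x ∈ S) : x ∈ gen P S :=
  ⟨hP, x, hS, ⟨.nil⟩⟩

theorem IsUpSetIn.gen_subset (h : IsUpSetIn P U) (hS : S ⊆ U) : gen P S ⊆ U :=
  fun y ⟨hy, x, hx, hxy⟩ => h.2 x (hS hx) y hy hxy

end UpSets

section SubThin

variable {K : Type u} [Field K] {Q : Type} [Quiver.{0} Q] {P U : Set Q}

theorem finrank_thin_obj {x : Q} (hx : x ∈ P) : Module.finrank K ((thin K P).obj x) = 1 := by
  classical exact (dimVec_thin P x).trans (if_pos hx)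

theorem thin_mapPath (hP : PathConvex P) {x y : Q} (p : Quiver.Path x y) (hx : x ∈ P)
    (hy : y ∈ P) (v : (thin K P).obj x) : ((thin K P).mapPath p v).1 = v.1 := by
  induction p with
  | nil => rfl
  | @cons y z p e ih =>
    exact (thin_map_of_mem e hy _).trans (ih (hP x hx z hy y ⟨p⟩ ⟨e.toPath⟩))

theorem thin_isEqualised (hP : PathConvex P) : (thin K P).IsEqualised := by
  intro x y p q
  ext v
  refine Subtype.ext ?_
  by_cases hy : y ∈ P
  · by_cases hx : x ∈ P
    · rw [thin_mapPath hP p hx hy, thin_mapPath hP q hx hy]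
    · rw [thin_obj_eq_zero hx v, map_zero, map_zero]
  · rw [thin_obj_eq_zero hy ((thin K P).mapPath p v), thin_obj_eq_zero hy ((thin K P).mapPath q v)]

namespace Sub

theorem mapPath_mem {V : QuiverRep K Q} (A : Sub V) {x y : Q} (p : Quiver.Path x y) {v : V.obj x}
    (hv : v ∈ A.carrier x) : V.mapPath p v ∈ A.carrier y := by
  induction p with
  | nil => exact hv
  | cons p e ih => exact A.stable e ih

/-- The vertices at which a subrepresentation is nonzero. -/
def supp {V : QuiverRep K Q} (A : Sub V) : Set Q := {x | A.carrier x ≠ ⊥}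

theorem supp_subset (A : Sub (thin K P)) : A.supp ⊆ P := by
  intro x hx
  by_contra h
  exact hx ((Submodule.eq_bot_iff _).mpr fun v _ => thin_obj_eq_zero h v)

theorem isUpSetIn_supp (hP : PathConvex P) (A : Sub (thin K P)) : IsUpSetIn P A.supp := by
  refine ⟨A.supp_subset, ?_⟩
  rintro x hx y hy ⟨p⟩ hbot
  obtain ⟨v, hv, hv0⟩ := (Submodule.ne_bot_iff _).mp hx
  have hpv := A.mapPath_mem p hv
  rw [hbot, Submodule.mem_bot] at hpv
  refine hv0 (Subtype.ext ?_)
  rw [← thin_mapPath hP p (A.supp_subset hx) hy v, hpv]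
  rfl

theorem carrier_eq_top {A : Sub (thin K P)} {x : Q} (hx : x ∈ A.supp) : A.carrier x = ⊤ := by
  refine Submodule.eq_top_of_finrank_eq (le_antisymm (Submodule.finrank_le _) ?_)
  rw [finrank_thin_obj (A.supp_subset hx), Nat.one_le_iff_ne_zero]
  exact fun h => hx (Submodule.finrank_eq_zero.mp h)

theorem dim_thin (A : Sub (thin K P)) : A.dim = A.supp.indicator 1 := by
  funext x
  by_cases hx : x ∈ A.supp
  · rw [Set.indicator_of_mem hx]
    unfold dim
    rw [carrier_eq_top hx, finrank_top]
    exact finrank_thin_obj (A.supp_subset hx)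
  · rw [Set.indicator_of_notMem hx]
    unfold dim
    rw [not_not.mp hx, finrank_bot]

theorem le_iff_supp_subset {A B : Sub (thin K P)} : A ≤ B ↔ A.supp ⊆ B.supp := by
  constructor
  · intro h x hx hB
    exact hx (le_bot_iff.mp (hB ▸ h x))
  · intro h x
    by_cases hx : x ∈ A.supp
    · rw [carrier_eq_top (h hx)]; exact le_top
    · rw [not_not.mp hx]; exact bot_le

open Classical in
/-- The subrepresentation of a thin representation supported on an up-set. -/
noncomputable def ofUpSetIn (K : Type u) [Field K] (h : IsUpSetIn P U) : Sub (thin K P) where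
  carrier x := if x ∈ U then ⊤ else ⊥
  stable := fun {x y} e => by
    by_cases hy : y ∈ U
    · rw [if_pos hy]; exact fun _ _ => trivial
    · rw [if_neg hy]
      by_cases hx : x ∈ U
      · exact fun v _ => thin_obj_eq_zero (fun hyP => hy (h.2 x hx y hyP ⟨e.toPath⟩)) _
      · rw [if_neg hx]; exact bot_le

theorem supp_ofUpSetIn (h : IsUpSetIn P U) : (ofUpSetIn K h).supp = U := by
  ext x
  by_cases hx : x ∈ U
  · have hne : (⊤ : Submodule K ((thin K P).obj x)) ≠ ⊥ := by
      intro htop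
      have hone := finrank_thin_obj (K := K) (h.1 hx)
      rw [← finrank_top, htop, finrank_bot] at hone
      exact zero_ne_one hone
    simpa [supp, ofUpSetIn, hx] using hne
  · simp [supp, ofUpSetIn, hx]

end Sub

end SubThin

section Weights

variable {Q : Type} [Fintype Q] {U U' : Set Q} {α : Q → ℝ}

/-- The total weight of a set of vertices. -/
noncomputable def weight (w : Q → ℝ) (U : Set Q) : ℝ := ∑ x, U.indicator w x

theorem sum_indicator_one (U : Set Q) : ∑ x, U.indicator (1 : Q → ℝ) x = U.ncard := by
  classical
  rw [Finset.sum_indicator_eq_sum_filter, Set.ncard_eq_toFinset_card']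
  simp [Set.toFinset]

theorem weight_sub_const (α : Q → ℝ) (θ : ℝ) (U : Set Q) :
    weight (fun x => α x - θ) U = weight α U - θ * U.ncard := by
  have hind (x : Q) : U.indicator (fun x => α x - θ) x =
      U.indicator α x - θ * U.indicator 1 x := by
    by_cases hx : x ∈ U <;> simp [hx]
  simp only [weight, hind, Finset.sum_sub_distrib, ← Finset.mul_sum, sum_indicator_one]

theorem eq_zero_of_sum_mul_eq_zero (hα : LinearIndepOn ℚ α (α.support)) {c : Q → ℚ}
    (h : ∑ x, (c x : ℝ) * α x = 0) {x : Q} (hx : α x ≠ 0) : c x = 0 := by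
  have hα' : LinearIndepOn ℚ α ↑α.support.toFinite.toFinset := by
    rwa [Set.Finite.coe_toFinset]
  refine linearIndepOn_finset_iff.mp hα' c ?_ x (by simpa using hx)
  rw [← h, ← Finset.sum_subset (Finset.subset_univ α.support.toFinite.toFinset) fun y _ hy => ?_]
  · exact Finset.sum_congr rfl fun y _ => Rat.smul_def (c y) (α y)
  · have hαy : α y = 0 := by simpa using hy
    rw [hαy, mul_zero]

/-- If two sets have the same weight, rational independence forces the coefficient
`k (𝟙_U - 𝟙_U') - (|U| - |U'|)` of `α x` in `k` times the difference of the weights to vanish. -/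
theorem mul_indicator_sub_indicator_eq (hα : LinearIndepOn ℚ α (α.support)) {k : ℕ} (hk : 0 < k)
    (h : weight (fun x => α x - (∑ y, α y) / k) U = weight (fun x => α x - (∑ y, α y) / k) U')
    {x : Q} (hx : α x ≠ 0) :
    (k : ℚ) * (U.indicator 1 x - U'.indicator 1 x) = U.ncard - U'.ncard := by
  have hk' : (k : ℝ) ≠ 0 := by positivity
  have hind (X : Set Q) (y : Q) : X.indicator α y = ((X.indicator 1 y : ℚ) : ℝ) * α y := by
    by_cases hy : y ∈ X <;> simp [hy]
  refine sub_eq_zero.mp (eq_zero_of_sum_mul_eq_zero hα (c := fun y =>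
    (k : ℚ) * (U.indicator 1 y - U'.indicator 1 y) - (U.ncard - U'.ncard)) ?_ hx)
  calc ∑ y, (((k : ℚ) * (U.indicator 1 y - U'.indicator 1 y) - (U.ncard - U'.ncard) : ℚ) : ℝ) * α y
      = k * (weight α U - weight α U') - (U.ncard - U'.ncard) * ∑ y, α y := by
        simp only [weight, hind, ← Finset.sum_sub_distrib, Finset.mul_sum]
        refine Finset.sum_congr rfl fun y _ => ?_
        push_cast
        ring
    _ = 0 := by
        rw [weight_sub_const, weight_sub_const] at h
        field_simp at h
        linarith

end Weights

section MaxUpSets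

variable {K : Type u} [Field K] {Q : Type} [Quiver.{0} Q] [Fintype Q] {P U : Set Q}

theorem Sub.wdim_thin (w : Q → ℝ) (A : Sub (thin K P)) : A.wdim w = weight w A.supp := by
  refine Finset.sum_congr rfl fun x _ => ?_
  rw [Sub.dim_thin]
  by_cases hx : x ∈ A.supp <;> simp [hx]

/-- `U` is an up-set of `P` of the largest weight. -/
def IsMaxUpSet (w : Q → ℝ) (P U : Set Q) : Prop :=
  IsUpSetIn P U ∧ ∀ X, IsUpSetIn P X → weight w X ≤ weight w U

theorem Sub.IsMaximizer.isMaxUpSet_supp (hP : PathConvex P) {w : Q → ℝ} {A : Sub (thin K P)}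
    (hA : A.IsMaximizer w) : IsMaxUpSet w P A.supp := by
  refine ⟨A.isUpSetIn_supp hP, fun X hX => ?_⟩
  simpa only [Sub.wdim_thin, Sub.supp_ofUpSetIn] using hA (Sub.ofUpSetIn K hX)

theorem IsMaxUpSet.isMaximizer (hP : PathConvex P) {w : Q → ℝ} (hU : IsMaxUpSet w P U) :
    (Sub.ofUpSetIn K hU.1).IsMaximizer w := by
  intro X
  simpa only [Sub.wdim_thin, Sub.supp_ofUpSetIn] using hU.2 _ (X.isUpSetIn_supp hP)

theorem exists_isMaxUpSet (w : Q → ℝ) (P : Set Q) : ∃ U, IsMaxUpSet w P U := by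
  obtain ⟨U, hU, hmax⟩ := {U | IsUpSetIn P U}.toFinite.exists_maximalFor (weight w) _
    ⟨_, isUpSetIn_gen P ∅⟩
  exact ⟨U, hU, fun X hX => (le_total _ _).elim id (hmax hX)⟩

theorem hasPart_thin (hP : PathConvex P) {w : Q → ℝ} {A B : Set Q} (hA : IsMaxUpSet w P A)
    (hB : IsMaxUpSet w P B) (hAB : ∀ X, IsMaxUpSet w P X → A ⊆ X ∧ X ⊆ B) :
    (thin K P).HasPart w ((B \ A).indicator 1) := by
  refine ⟨_, _, hA.isMaximizer hP, hB.isMaximizer hP, fun X hX => ?_, ?_⟩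
  · simpa only [Sub.le_iff_supp_subset, Sub.supp_ofUpSetIn] using hAB _ (hX.isMaxUpSet_supp hP)
  · rw [Sub.dim_thin, Sub.dim_thin, Sub.supp_ofUpSetIn, Sub.supp_ofUpSetIn]
    exact (congrArg (Set.indicator · 1) (Set.sdiff_union_of_subset (hAB B hB).1).symm).trans
      (Set.indicator_union_of_disjoint Set.disjoint_sdiff_left 1)

end MaxUpSets

section Isolation

variable {K : Type u} [Field K] {Q : Type} [Quiver.{0} Q] [Fintype Q] {P U U' : Set Q}
  {α : Q → ℝ} {θ : ℝ}

open Classical in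
theorem IsMaxUpSet.eq_gen (hθ : 0 < θ) (hU : IsMaxUpSet (fun x => α x - θ) P U) :
    U = gen P (U ∩ α.support) := by
  have hsub : gen P (U ∩ α.support) ⊆ U := hU.1.gen_subset Set.inter_subset_left
  have hweight : weight α (gen P (U ∩ α.support)) = weight α U := by
    refine Finset.sum_congr rfl fun x _ => ?_
    by_cases hxα : α x = 0
    · simp [Set.indicator_apply, hxα]
    · have hiff : x ∈ gen P (U ∩ α.support) ↔ x ∈ U :=
        ⟨fun h => hsub h, fun h => mem_gen_of_mem (hU.1.1 h) ⟨h, hxα⟩⟩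
      simp [Set.indicator_apply, hiff]
  have hle := hU.2 _ (isUpSetIn_gen P (U ∩ α.support))
  rw [weight_sub_const, weight_sub_const, hweight] at hle
  have hcard : (U.ncard : ℝ) ≤ (gen P (U ∩ α.support)).ncard :=
    le_of_mul_le_mul_left (by linarith) hθ
  exact (Set.eq_of_subset_of_ncard_le hsub (by exact_mod_cast hcard) U.toFinite).symm

open Classical in
/-- Two maximal up-sets at the slope `(∑ x, α x) / k` either agree, or are `∅` and the up-set
generated by the support of `α`. -/
theorem IsMaxUpSet.eq_or_eq_gen (hα : LinearIndepOn ℚ α (α.support)) (hpos : 0 < ∑ x, α x) {k : ℕ}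
    (hk : 0 < k) (hU : IsMaxUpSet (fun x => α x - (∑ y, α y) / k) P U)
    (hU' : IsMaxUpSet (fun x => α x - (∑ y, α y) / k) P U') (hle : U.ncard ≤ U'.ncard) :
    U = U' ∨ U = ∅ ∧ α.support ⊆ P ∧ U' = gen P (α.support) ∧ U'.ncard = k := by
  have hθ : 0 < (∑ y, α y) / k := by positivity
  have hcoeff {x : Q} (hx : α x ≠ 0) :=
    mul_indicator_sub_indicator_eq hα hk ((hU.2 _ hU'.1).antisymm (hU'.2 _ hU.1)) hx
  obtain heq | hlt := hle.eq_or_lt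
  · left
    rw [hU.eq_gen hθ, hU'.eq_gen hθ]
    congr 1
    ext x
    refine and_congr_left fun hx => ?_
    have hx := hcoeff hx
    rw [heq, sub_self, mul_eq_zero_iff_left (by positivity)] at hx
    by_cases h : x ∈ U <;> by_cases h' : x ∈ U' <;> simp_all
  · right
    have hsplit (x : Q) (hx : α x ≠ 0) : x ∉ U ∧ x ∈ U' ∧ U'.ncard = k + U.ncard := by
      have hx := hcoeff hx
      simp only [Set.indicator_apply, Pi.one_apply] at hx
      have hlt' : (U.ncard : ℚ) < U'.ncard := by exact_mod_cast hlt
      have hk' : (0 : ℚ) < k := by exact_mod_cast hk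
      have hcard : (U'.ncard : ℚ) = k + U.ncard → U'.ncard = k + U.ncard := by exact_mod_cast id
      split_ifs at hx <;> grind
    have hU0 : U = ∅ := by
      rw [hU.eq_gen hθ, Set.eq_empty_of_forall_notMem fun x (hx : x ∈ U ∩ α.support) =>
        (hsplit x hx.2).1 hx.1, gen_empty]
    have hsub : α.support ⊆ U' := fun x hx => (hsplit x hx).2.1
    obtain ⟨x, -, hx⟩ := Finset.exists_ne_zero_of_sum_ne_zero hpos.ne'
    refine ⟨hU0, hsub.trans hU'.1.1, ?_, by simpa [hU0] using (hsplit x hx).2.2⟩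
    conv_lhs => rw [hU'.eq_gen hθ, Set.inter_eq_right.mpr hsub]

open Classical in
theorem hasPart_thin_of_linearIndepOn (hP : PathConvex P) (hα : LinearIndepOn ℚ α (α.support))
    (hpos : 0 < ∑ x, α x) {k : ℕ} (hk : 0 < k) (hθ : θ = (∑ x, α x) / k) :
    (thin K P).HasPart (fun x => α x - θ)
      (if α.support ⊆ P ∧ (gen P (α.support)).ncard = k ∧
          ∀ U, IsUpSetIn P U → weight α U ≤ θ * U.ncard
        then (gen P (α.support)).indicator 1 else 0) := by
  subst hθ
  have hweight_empty : weight (fun x => α x - (∑ y, α y) / k) ∅ = 0 := by simp [weight]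
  have hmax_empty : IsMaxUpSet (fun x => α x - (∑ y, α y) / k) P ∅ ↔
      ∀ U, IsUpSetIn P U → weight α U ≤ (∑ y, α y) / k * U.ncard := by
    rw [IsMaxUpSet, hweight_empty, ← gen_empty P, and_iff_right (isUpSetIn_gen P ∅)]
    simp only [weight_sub_const, sub_nonpos]
  split_ifs with h
  · obtain ⟨hsub, hcard, hle⟩ := h
    have hbot := hmax_empty.mpr hle
    have htop : IsMaxUpSet (fun x => α x - (∑ y, α y) / k) P (gen P (α.support)) := by
      have hweight : weight α (gen P (α.support)) = ∑ y, α y :=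
        Finset.sum_congr rfl fun x _ => Set.indicator_apply_eq_self.mpr fun hx =>
          not_not.mp fun hx' => hx (mem_gen_of_mem (hsub hx') hx')
      refine ⟨isUpSetIn_gen _ _, fun X hX => (hbot.2 X hX).trans_eq ?_⟩
      rw [hweight_empty, weight_sub_const, hweight, hcard]
      field_simp
      ring
    rw [← Set.sdiff_empty (s := gen P (α.support))]
    refine hasPart_thin hP hbot htop fun X hX => ⟨Set.empty_subset X, ?_⟩
    obtain rfl | ⟨-, -, hXeq, -⟩ := hbot.eq_or_eq_gen hα hpos hk hX (by simp)
    · exact Set.empty_subset _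
    · exact hXeq.le
  · obtain ⟨U, hU⟩ := exists_isMaxUpSet (fun x => α x - (∑ y, α y) / k) P
    have hle_unique {X Y : Set Q} (hX : IsMaxUpSet (fun x => α x - (∑ y, α y) / k) P X)
        (hY : IsMaxUpSet (fun x => α x - (∑ y, α y) / k) P Y) (hXY : X.ncard ≤ Y.ncard) :
        X = Y := by
      obtain heq | ⟨rfl, hsub, rfl, hcard⟩ := hX.eq_or_eq_gen hα hpos hk hY hXY
      · exact heq
      · exact absurd ⟨hsub, hcard, hmax_empty.mp hX⟩ h
    have hunique (X : Set Q) (hX : IsMaxUpSet (fun x => α x - (∑ y, α y) / k) P X) : U = X :=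
      (le_total U.ncard X.ncard).elim (hle_unique hU hX) fun h => (hle_unique hX hU h).symm
    have hpart := hasPart_thin (K := K) hP hU hU fun X hX =>
      ⟨(hunique X hX).le, (hunique X hX).ge⟩
    rwa [Set.sdiff_self, Set.indicator_empty] at hpart

end Isolation

end QuiverRep

/-! ### Blocks and their minimal vertices -/

namespace QuiverRep

theorem minSet_gen {Q : Type} [Quiver.{0} Q]
    (hanti : ∀ x y : Q, Reaches x y → Reaches y x → x = y) {P S : Set Q} (hSP : S ⊆ P)
    (hS : ∀ x ∈ S, ∀ y ∈ S, Reaches x y → x = y) : minSet (gen P S) = S := by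
  ext x
  constructor
  · rintro ⟨⟨-, s, hs, hsx⟩, hmin⟩
    exact hmin s (mem_gen_of_mem (hSP hs) hs) hsx ▸ hs
  · intro hx
    refine ⟨mem_gen_of_mem (hSP hx) hx, ?_⟩
    rintro y ⟨-, s, hs, hsy⟩ hyx
    obtain rfl := hS s hs x hx (hsy.map2 Quiver.Path.comp hyx)
    exact hanti y s hyx hsy

end QuiverRep

section Blocks

variable {ℓ : ℕ}

/-- The position of a vertex in the grid `Bool × Fin (ℓ + 1)`, whose product order is the flow
order of the ladder. -/
def LadderVertex.coord : LadderVertex ℓ → Bool × Fin (ℓ + 1)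
  | .top i => (false, i)
  | .bot i => (true, i)

theorem coord_le_of_edge {x y : LadderVertex ℓ} (e : x ⟶ y) : x.coord ≤ y.coord :=
  match e with
  | .top h => ⟨le_rfl, Fin.le_def.mpr (h ▸ Nat.le_succ _)⟩
  | .bot h => ⟨le_rfl, Fin.le_def.mpr (h ▸ Nat.le_succ _)⟩
  | .down _ => ⟨Bool.false_le _, le_rfl⟩

theorem coord_le_of_reaches {x y : LadderVertex ℓ} (h : Reaches x y) : x.coord ≤ y.coord := by
  obtain ⟨p⟩ := h
  induction p with
  | nil => exact le_rfl
  | cons _ e ih => exact ih.trans (coord_le_of_edge e)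

@[simp] theorem reaches_top_top_iff {i j : Fin (ℓ + 1)} :
    Reaches (.top i : LadderVertex ℓ) (.top j) ↔ i ≤ j :=
  ⟨fun h => (coord_le_of_reaches h).2, reaches_top_top⟩

@[simp] theorem reaches_bot_bot_iff {i j : Fin (ℓ + 1)} :
    Reaches (.bot i : LadderVertex ℓ) (.bot j) ↔ i ≤ j :=
  ⟨fun h => (coord_le_of_reaches h).2, reaches_bot_bot⟩

@[simp] theorem reaches_top_bot_iff {i j : Fin (ℓ + 1)} :
    Reaches (.top i : LadderVertex ℓ) (.bot j) ↔ i ≤ j :=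
  ⟨fun h => (coord_le_of_reaches h).2, reaches_top_bot⟩

@[simp] theorem not_reaches_bot_top {i j : Fin (ℓ + 1)} :
    ¬ Reaches (.bot i : LadderVertex ℓ) (.top j) :=
  fun h => Bool.false_ne_true (Bool.eq_false_of_le_false (coord_le_of_reaches h).1).symm

theorem LadderVertex.reaches_antisymm {x y : LadderVertex ℓ} (hxy : Reaches x y)
    (hyx : Reaches y x) : x = y := by
  rcases x with i | i <;> rcases y with j | j <;>
    simp only [reaches_top_top_iff, reaches_bot_bot_iff, not_reaches_bot_top] at hxy hyx
  · exact congrArg _ (le_antisymm hxy hyx)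
  · exact congrArg _ (le_antisymm hxy hyx)

theorem IsBlock.pathConvex {P : Set (LadderVertex ℓ)} (h : IsBlock P) : PathConvex P := by
  obtain ⟨a, b, c, d, hs, rfl⟩ := h
  unfold BlockShape at hs
  rintro (i | i) hx (k | k) hz (j | j) hxy hyz <;>
    simp only [reaches_top_top_iff, reaches_bot_bot_iff, reaches_top_bot_iff,
      not_reaches_bot_top, top_mem_block, bot_mem_block] at * <;> lia

theorem ncard_block {a b c d : ℕ} (hb : b ≤ ℓ + 1) (hd : d ≤ ℓ + 1) :
    (block ℓ a b c d).ncard = (b - a) + (d - c) := by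
  have hrow (a b : ℕ) (hb : b ≤ ℓ + 1) :
      {i : Fin (ℓ + 1) | a ≤ i.val ∧ i.val < b}.ncard = b - a := by
    rw [← Set.ncard_image_of_injective _ Fin.val_injective, ← Nat.card_Ico, ← Set.ncard_coe_finset]
    congr 1
    ext n
    simp only [Set.mem_image, Set.mem_ofPred_eq, Finset.coe_Ico, Set.mem_Ico]
    exact ⟨fun ⟨_, hi, hin⟩ => hin ▸ hi, fun hn => ⟨⟨n, by lia⟩, hn, rfl⟩⟩
  have hunion : block ℓ a b c d = (LadderVertex.top '' {i | a ≤ i.val ∧ i.val < b}) ∪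
      (LadderVertex.bot '' {i | c ≤ i.val ∧ i.val < d}) := by
    ext (i | i) <;> simp [top_mem_block, bot_mem_block]
  have hdisj : Disjoint (LadderVertex.top '' {i : Fin (ℓ + 1) | a ≤ i.val ∧ i.val < b})
      (LadderVertex.bot '' {i | c ≤ i.val ∧ i.val < d}) := by
    rw [Set.disjoint_left]
    rintro _ ⟨_, -, rfl⟩ ⟨_, -, h⟩
    cases h
  rw [hunion, Set.ncard_union_eq hdisj,
    Set.ncard_image_of_injective _ fun _ _ => LadderVertex.top.inj,
    Set.ncard_image_of_injective _ fun _ _ => LadderVertex.bot.inj, hrow a b hb, hrow c d hd]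

theorem gen_block_top {a b c d : ℕ} {i : Fin (ℓ + 1)} (hi : .top i ∈ block ℓ a b c d)
    (hc : c ≤ i.val) : gen (block ℓ a b c d) {.top i} = block ℓ i b i d := by
  have hi := top_mem_block.mp hi
  ext (j | j) <;> simp only [gen, Set.mem_ofPred_eq, Set.mem_singleton_iff, exists_eq_left,
    reaches_top_top_iff, reaches_top_bot_iff, top_mem_block, bot_mem_block] <;> lia

theorem gen_block_bot {a b c d : ℕ} {j : Fin (ℓ + 1)} (hj : .bot j ∈ block ℓ a b c d) :
    gen (block ℓ a b c d) {.bot j} = block ℓ 0 0 j d := by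
  have hj := bot_mem_block.mp hj
  ext (i | i) <;> simp only [gen, Set.mem_ofPred_eq, Set.mem_singleton_iff, exists_eq_left,
    not_reaches_bot_top, reaches_bot_bot_iff, top_mem_block, bot_mem_block] <;> lia

theorem gen_block_pair {a b c d : ℕ} {i j : Fin (ℓ + 1)} (hi : .top i ∈ block ℓ a b c d)
    (hj : .bot j ∈ block ℓ a b c d) (hji : j ≤ i) :
    gen (block ℓ a b c d) {.top i, .bot j} = block ℓ i b j d := by
  have hi := top_mem_block.mp hi
  have hj := bot_mem_block.mp hj
  ext (k | k) <;> simp only [gen, Set.mem_ofPred_eq, Set.mem_insert_iff, Set.mem_singleton_iff,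
    exists_eq_or_imp, exists_eq_left, reaches_top_top_iff, reaches_top_bot_iff,
    not_reaches_bot_top, reaches_bot_bot_iff, top_mem_block, bot_mem_block] <;> lia

/-- The members of `I_S^k`, represented by their supports. -/
def blockClass (ℓ k : ℕ) (S : Set (LadderVertex ℓ)) : Set (Set (LadderVertex ℓ)) :=
  {R | IsBlock R ∧ R.ncard = k ∧ minSet R = S}

theorem block_top_mem_blockClass {a : Fin (ℓ + 1)} {b d : ℕ} (hab : a.val < b) (hb : b ≤ ℓ + 1)
    (had : a.val ≤ d) (hdb : d ≤ b) :
    block ℓ a b a d ∈ blockClass ℓ ((b - a.val) + (d - a.val)) {.top a} := by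
  have ha : .top a ∈ block ℓ a b a d := top_mem_block.mpr ⟨le_rfl, hab⟩
  refine ⟨⟨a, b, a, d, Or.inl (by lia), rfl⟩, ncard_block hb (by lia), ?_⟩
  conv_lhs => rw [← gen_block_top ha le_rfl]
  exact minSet_gen (fun _ _ => LadderVertex.reaches_antisymm) (by simpa using ha) (by simp)

theorem block_pair_mem_blockClass {a c : Fin (ℓ + 1)} {b d : ℕ} (hca : c < a) (had : a.val < d)
    (hdb : d ≤ b) (hb : b ≤ ℓ + 1) :
    block ℓ a b c d ∈ blockClass ℓ ((b - a.val) + (d - c.val)) {.top a, .bot c} := by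
  have ha : .top a ∈ block ℓ a b c d := top_mem_block.mpr (by lia)
  have hc : .bot c ∈ block ℓ a b c d := bot_mem_block.mpr (by lia)
  refine ⟨⟨a, b, c, d, Or.inl (by lia), rfl⟩, ncard_block hb (by lia), ?_⟩
  conv_lhs => rw [← gen_block_pair ha hc hca.le]
  refine minSet_gen (fun _ _ => LadderVertex.reaches_antisymm) (Set.pair_subset ha hc) ?_
  rintro x (rfl | rfl) y (rfl | rfl) hxy
  · rfl
  · exact absurd hxy (by simpa only [reaches_top_bot_iff, not_le] using hca)
  · exact absurd hxy not_reaches_bot_top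
  · rfl

theorem block_bot_mem_blockClass {c : Fin (ℓ + 1)} {d : ℕ} (hcd : c.val < d) (hd : d ≤ ℓ + 1) :
    block ℓ 0 0 c d ∈ blockClass ℓ (d - c.val) {.bot c} := by
  have hc : .bot c ∈ block ℓ 0 0 c d := bot_mem_block.mpr ⟨le_rfl, hcd⟩
  refine ⟨⟨0, 0, c, d, Or.inr (by lia), rfl⟩, ?_, ?_⟩
  · rw [ncard_block (by lia) hd, Nat.sub_self, Nat.zero_add]
  · conv_lhs => rw [← gen_block_bot hc]
    exact minSet_gen (fun _ _ => LadderVertex.reaches_antisymm) (by simpa using hc) (by simp)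

theorem IsBlock.eq_block {P : Set (LadderVertex ℓ)} (h : IsBlock P) :
    (∃ (a : Fin (ℓ + 1)) (b d : ℕ), a.val < b ∧ b ≤ ℓ + 1 ∧ a.val ≤ d ∧ d ≤ b ∧
      P = block ℓ a b a d) ∨
    (∃ (a c : Fin (ℓ + 1)) (b d : ℕ), c < a ∧ a.val < d ∧ d ≤ b ∧ b ≤ ℓ + 1 ∧
      P = block ℓ a b c d) ∨
    (∃ (c : Fin (ℓ + 1)) (d : ℕ), c.val < d ∧ d ≤ ℓ + 1 ∧ P = block ℓ 0 0 c d) := by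
  obtain ⟨a, b, c, d, ⟨hab, hb, hca, had, hdb, hc⟩ | ⟨rfl, rfl, hcd, hd⟩, rfl⟩ := h
  · obtain rfl | hca := hca.eq_or_lt
    · exact Or.inl ⟨⟨c, by lia⟩, b, d, hab, hb, had, hdb, rfl⟩
    · exact Or.inr (Or.inl ⟨⟨a, by lia⟩, ⟨c, by lia⟩, b, d, hca, by lia, hdb, hb, rfl⟩)
  · exact Or.inr (Or.inr ⟨⟨c, by lia⟩, d, hcd, hd, rfl⟩)

theorem singleton_ne_pair {x : LadderVertex ℓ} {a c : Fin (ℓ + 1)} :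
    ({x} : Set (LadderVertex ℓ)) ≠ {.top a, .bot c} := by
  intro h
  have ha : LadderVertex.top a = x := (Set.ext_iff.mp h _).mpr (Or.inl rfl)
  have hc : LadderVertex.bot c = x := (Set.ext_iff.mp h _).mpr (Or.inr rfl)
  cases ha.trans hc.symm

theorem mem_blockClass_top {k : ℕ} {a : Fin (ℓ + 1)} {R : Set (LadderVertex ℓ)} :
    R ∈ blockClass ℓ k {.top a} ↔ ∃ b d, a.val < b ∧ b ≤ ℓ + 1 ∧ a.val ≤ d ∧ d ≤ b ∧
      (b - a.val) + (d - a.val) = k ∧ R = block ℓ a b a d := by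
  refine ⟨fun ⟨hR, hk, hmin⟩ => ?_, ?_⟩
  · obtain ⟨a', b, d, hab, hb, had, hdb, rfl⟩ | ⟨a', c, b, d, hca, had, hdb, hb, rfl⟩ |
      ⟨c, d, hcd, hd, rfl⟩ := hR.eq_block
    · obtain ⟨-, hk', hmin'⟩ := block_top_mem_blockClass hab hb had hdb
      obtain rfl : a' = a := by simpa [hmin'] using hmin
      exact ⟨b, d, hab, hb, had, hdb, hk'.symm.trans hk, rfl⟩
    · exact absurd (hmin.symm.trans (block_pair_mem_blockClass hca had hdb hb).2.2)
        singleton_ne_pair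
    · simp [(block_bot_mem_blockClass hcd hd).2.2] at hmin
  · rintro ⟨b, d, hab, hb, had, hdb, rfl, rfl⟩
    exact block_top_mem_blockClass hab hb had hdb

theorem mem_blockClass_bot {k : ℕ} {c : Fin (ℓ + 1)} {R : Set (LadderVertex ℓ)} :
    R ∈ blockClass ℓ k {.bot c} ↔ c.val + k ≤ ℓ + 1 ∧ 0 < k ∧ R = block ℓ 0 0 c (c + k) := by
  refine ⟨fun ⟨hR, hk, hmin⟩ => ?_, ?_⟩
  · obtain ⟨a, b, d, hab, hb, had, hdb, rfl⟩ | ⟨a, c', b, d, hca, had, hdb, hb, rfl⟩ |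
      ⟨c', d, hcd, hd, rfl⟩ := hR.eq_block
    · simp [(block_top_mem_blockClass hab hb had hdb).2.2] at hmin
    · exact absurd (hmin.symm.trans (block_pair_mem_blockClass hca had hdb hb).2.2)
        singleton_ne_pair
    · obtain ⟨-, hk', hmin'⟩ := block_bot_mem_blockClass hcd hd
      obtain rfl : c' = c := by simpa [hmin'] using hmin
      obtain rfl : d = c' + k := by lia
      exact ⟨hd, by lia, rfl⟩
  · rintro ⟨hd, hk, rfl⟩
    simpa using block_bot_mem_blockClass (c := c) (d := c + k) (by lia) hd

theorem mem_blockClass_pair {k : ℕ} {a c : Fin (ℓ + 1)} {R : Set (LadderVertex ℓ)} :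
    R ∈ blockClass ℓ k {.top a, .bot c} ↔ ∃ b d, c < a ∧ a.val < d ∧ d ≤ b ∧ b ≤ ℓ + 1 ∧
      (b - a.val) + (d - c.val) = k ∧ R = block ℓ a b c d := by
  refine ⟨fun ⟨hR, hk, hmin⟩ => ?_, ?_⟩
  · obtain ⟨a', b, d, hab, hb, had, hdb, rfl⟩ | ⟨a', c', b, d, hca, had, hdb, hb, rfl⟩ |
      ⟨c', d, hcd, hd, rfl⟩ := hR.eq_block
    · exact absurd ((block_top_mem_blockClass hab hb had hdb).2.2.symm.trans hmin)
        singleton_ne_pair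
    · obtain ⟨-, hk', hmin'⟩ := block_pair_mem_blockClass hca had hdb hb
      obtain ⟨rfl, rfl⟩ : a' = a ∧ c' = c := by
        simpa [Set.pair_eq_pair_iff] using hmin'.symm.trans hmin
      exact ⟨b, d, hca, had, hdb, hb, hk'.symm.trans hk, rfl⟩
    · exact absurd ((block_bot_mem_blockClass hcd hd).2.2.symm.trans hmin) singleton_ne_pair
  · rintro ⟨b, d, hca, had, hdb, hb, rfl, rfl⟩
    exact block_pair_mem_blockClass hca had hdb hb

theorem IsBlock.minSet_eq {R : Set (LadderVertex ℓ)} (h : IsBlock R) :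
    (∃ x, minSet R = {x}) ∨ ∃ a c : Fin (ℓ + 1), c < a ∧ minSet R = {.top a, .bot c} := by
  obtain ⟨a, b, d, hab, hb, had, hdb, rfl⟩ | ⟨a, c, b, d, hca, had, hdb, hb, rfl⟩ |
    ⟨c, d, hcd, hd, rfl⟩ := h.eq_block
  · exact Or.inl ⟨_, (block_top_mem_blockClass hab hb had hdb).2.2⟩
  · exact Or.inr ⟨a, c, hca, (block_pair_mem_blockClass hca had hdb hb).2.2⟩
  · exact Or.inl ⟨_, (block_bot_mem_blockClass hcd hd).2.2⟩

theorem IsBlock.gen_minSet {R : Set (LadderVertex ℓ)} (h : IsBlock R) : gen R (minSet R) = R := by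
  obtain ⟨a, b, d, hab, hb, had, hdb, rfl⟩ | ⟨a, c, b, d, hca, had, hdb, hb, rfl⟩ |
    ⟨c, d, hcd, hd, rfl⟩ := h.eq_block
  · rw [(block_top_mem_blockClass hab hb had hdb).2.2,
      gen_block_top (top_mem_block.mpr ⟨le_rfl, hab⟩) le_rfl]
  · rw [(block_pair_mem_blockClass hca had hdb hb).2.2,
      gen_block_pair (top_mem_block.mpr (by lia)) (bot_mem_block.mpr (by lia)) hca.le]
  · rw [(block_bot_mem_blockClass hcd hd).2.2, gen_block_bot (bot_mem_block.mpr ⟨le_rfl, hcd⟩)]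

theorem IsBlock.isBlock_gen_singleton {P : Set (LadderVertex ℓ)} (h : IsBlock P)
    {x : LadderVertex ℓ} (hx : x ∈ P) : IsBlock (gen P {x}) := by
  obtain ⟨a, b, c, d, hs, rfl⟩ := h
  unfold BlockShape at hs
  rcases x with i | j
  · have hi := top_mem_block.mp hx
    rw [gen_block_top hx (by lia)]
    obtain hid | hdi := le_total i.val d
    · exact ⟨i, b, i, d, Or.inl (by lia), rfl⟩
    · refine ⟨i, b, i, i, Or.inl (by lia), ?_⟩
      ext (j | j) <;> simp only [top_mem_block, bot_mem_block]
      lia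
  · have hj := bot_mem_block.mp hx
    rw [gen_block_bot hx]
    exact ⟨0, 0, j, d, Or.inr (by lia), rfl⟩

end Blocks

/-! ### Central charges isolating blocks -/

namespace QuiverRep

section Weights

variable {Q : Type} [Fintype Q] {α : Q → ℝ}

theorem weight_empty (α : Q → ℝ) : weight α ∅ = 0 := by simp [weight]

theorem weight_singleton (α : Q → ℝ) (x : Q) : weight α {x} = α x := by
  classical simp [weight, Set.indicator_apply]

theorem weight_mono (hα : 0 ≤ α) {U U' : Set Q} (h : U ⊆ U') : weight α U ≤ weight α U' :=
  Finset.sum_le_sum fun x _ => Set.indicator_le_indicator_of_subset h hα x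

theorem forall_weight_le_iff [Quiver.{0} Q] {P : Set Q} {θ : ℝ} (hα : 0 ≤ α) (hθ : 0 ≤ θ)
    (hP : α.support ⊆ P) : (∀ U, IsUpSetIn P U → weight α U ≤ θ * U.ncard) ↔
      ∀ T ⊆ α.support, weight α T ≤ θ * (gen P T).ncard := by
  constructor
  · intro h T hT
    refine (weight_mono hα fun x hx => ?_).trans (h _ (isUpSetIn_gen P T))
    exact mem_gen_of_mem (hP (hT hx)) hx
  · intro h U hU
    have hweight : weight α U = weight α (U ∩ α.support) := by
      simp only [weight, Set.indicator_inter_support]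
    have hgen : gen P (U ∩ α.support) ⊆ U := hU.gen_subset Set.inter_subset_left
    rw [hweight]
    refine (h _ Set.inter_subset_right).trans (mul_le_mul_of_nonneg_left ?_ hθ)
    exact_mod_cast Set.ncard_le_ncard hgen U.toFinite

end Weights

end QuiverRep

section Isolation

variable {K : Type u} [Field K] {ℓ k : ℕ} {P : Set (LadderVertex ℓ)} {t : ℕ → ℕ → ℝ}

open Classical in
/-- There is a slope at which the part along `α` of a block `P` consists of the vertices of `P`
above `S` if these form a member of `I_S^k`, and vanishes otherwise. -/
def Isolates (K : Type u) [Field K] (α : LadderVertex ℓ → ℝ) (k : ℕ) (S : Set (LadderVertex ℓ)) :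
    Prop :=
  ∃ θ : ℝ, ∀ P, IsBlock P → (thin K P).HasPart (fun x => α x - θ)
    (if gen P S ∈ blockClass ℓ k S then (gen P S).indicator 1 else 0)

theorem subset_of_gen_mem_blockClass {S : Set (LadderVertex ℓ)} (h : gen P S ∈ blockClass ℓ k S) :
    S ⊆ P :=
  fun x hx => (h.2.2.symm ▸ hx : x ∈ minSet (gen P S)).1.1

theorem isolates_of_forall_isBlock {α : LadderVertex ℓ → ℝ} (hα : 0 ≤ α)
    (hind : LinearIndepOn ℚ α α.support) (hpos : 0 < ∑ x, α x) (hk : 0 < k)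
    (hsemi : ∀ P, IsBlock P → α.support ⊆ P → (gen P α.support).ncard = k →
      ((∀ T ⊆ α.support, weight α T ≤ (∑ x, α x) / k * (gen P T).ncard) ↔
        gen P α.support ∈ blockClass ℓ k α.support)) :
    Isolates K α k α.support := by
  classical
  refine ⟨(∑ x, α x) / k, fun P hP => ?_⟩
  convert hasPart_thin_of_linearIndepOn hP.pathConvex hind hpos hk rfl using 1
  refine if_congr ⟨fun h => ?_, fun ⟨hsub, hcard, hle⟩ => ?_⟩ rfl rfl
  · have hsub := subset_of_gen_mem_blockClass h
    exact ⟨hsub, h.2.1, (forall_weight_le_iff hα (by positivity) hsub).mpr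
      ((hsemi P hP hsub h.2.1).mpr h)⟩
  · exact (hsemi P hP hsub hcard).mp ((forall_weight_le_iff hα (by positivity) hsub).mp hle)

theorem isolates_skyscraper (K : Type u) [Field K] (hk : 0 < k) (x : LadderVertex ℓ) :
    Isolates K (skyscraper x) k {x} := by
  have hsupp : (skyscraper x).support = {x} := Pi.support_single_of_ne one_ne_zero
  have hsum : ∑ y, skyscraper x y = 1 := Finset.sum_pi_single' x 1 _ |>.trans (by simp)
  have hk' : (k : ℝ) ≠ 0 := by positivity
  rw [← hsupp]
  refine isolates_of_forall_isBlock (Pi.single_nonneg.mpr zero_le_one) ?_ (by simp [hsum]) hk ?_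
  · rw [hsupp, linearIndepOn_singleton_iff]
    simp [skyscraper]
  · rw [hsupp, hsum]
    intro P hP hx hcard
    refine iff_of_true (fun T hT => ?_) ⟨hP.isBlock_gen_singleton (hx rfl), hcard, ?_⟩
    · obtain rfl | rfl := Set.subset_singleton_iff_eq.mp hT
      · simp [weight_empty, gen_empty]
      · rw [hcard, weight_singleton, one_div_mul_cancel hk']
        simp [skyscraper]
    · exact minSet_gen (fun _ _ => LadderVertex.reaches_antisymm) hx (by simp)

theorem IsAdmissibleParam.bounds (ht : IsAdmissibleParam t) {p q : ℕ} (hqp : q < p) :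
    0 < t p q ∧ q ≤ t p q * (p - q) ∧ t p q * (p - (q + 1)) ≤ q + 1 := by
  obtain ⟨-, hlow, hupp⟩ := ht p q hqp
  have hpq : (0 : ℝ) < p - q := sub_pos.mpr (by exact_mod_cast hqp)
  refine ⟨(by positivity : (0 : ℝ) ≤ q / (p - q)).trans_lt hlow, ((div_lt_iff₀ hpq).mp hlow).le, ?_⟩
  obtain hq | rfl := (Nat.succ_le_of_lt hqp).lt_or_eq
  · have hpq' : (0 : ℝ) < p - (q + 1) := sub_pos.mpr (by exact_mod_cast hq)
    exact ((lt_div_iff₀ hpq').mp (hupp hq)).le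
  · push_cast
    simp only [sub_self, mul_zero]
    positivity

/-- The two inequalities are the semistability of the block `block ℓ a b c d`, with `m = b - a`
and `n = d - c`, along `δ_y + t δ_z`. For `d ≤ a` they would force `t = n / m`. -/
theorem IsAdmissibleParam.slope_le_iff (ht : IsAdmissibleParam t) {q m n : ℕ} (hm : 0 < m)
    (hq : q < m + n) :
    (1 ≤ (1 + t (m + n) q) / (m + n) * (m + (n - q : ℕ)) ∧
      t (m + n) q ≤ (1 + t (m + n) q) / (m + n) * n) ↔ q < n := by
  obtain ⟨hpos, hlow, hupp⟩ := ht.bounds hq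
  have hirr := (ht _ _ hq).1
  generalize t (m + n) q = s at *
  have hm' : (0 : ℝ) < m := by exact_mod_cast hm
  have hk : (0 : ℝ) < m + n := by positivity
  rw [div_mul_eq_mul_div, div_mul_eq_mul_div, le_div_iff₀ hk, le_div_iff₀ hk]
  push_cast at hlow hupp
  constructor
  · rintro ⟨htop, hbot⟩
    by_contra! hnq
    rw [Nat.sub_eq_zero_of_le hnq, Nat.cast_zero, add_zero] at htop
    refine hirr ⟨n / m, ?_⟩
    push_cast
    rw [div_eq_iff hm'.ne']
    linarith
  · intro hqn
    have hqn' : (q : ℝ) + 1 ≤ n := by exact_mod_cast hqn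
    rw [Nat.cast_sub hqn.le]
    exact ⟨by linarith, by nlinarith⟩

/-- The form `δ_y + s δ_z`, for `y = x_a^+` and `z = x_c^-`, of the central charge `α_S^k` of a
pair `S = {y, z}`. -/
noncomputable def pairCharge (a c : Fin (ℓ + 1)) (s : ℝ) : LadderVertex ℓ → ℝ :=
  skyscraper (.top a) + s • skyscraper (.bot c)

@[simp] theorem pairCharge_top (a c i : Fin (ℓ + 1)) (s : ℝ) :
    pairCharge a c s (.top i) = if i = a then 1 else 0 := by
  simp [pairCharge, skyscraper, Pi.single_apply]

@[simp] theorem pairCharge_bot (a c i : Fin (ℓ + 1)) (s : ℝ) :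
    pairCharge a c s (.bot i) = if i = c then s else 0 := by
  simp [pairCharge, skyscraper, Pi.single_apply]

theorem pairCharge_nonneg (a c : Fin (ℓ + 1)) {s : ℝ} (hs : 0 ≤ s) : 0 ≤ pairCharge a c s := by
  rintro (i | i) <;> simp only [pairCharge_top, pairCharge_bot] <;> split_ifs <;> simp [hs]

theorem sum_pairCharge (a c : Fin (ℓ + 1)) (s : ℝ) : ∑ x, pairCharge a c s x = 1 + s := by
  simp [pairCharge, skyscraper, Finset.sum_add_distrib, ← Finset.mul_sum]

theorem support_pairCharge (a c : Fin (ℓ + 1)) {s : ℝ} (hs : s ≠ 0) :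
    (pairCharge a c s).support = {.top a, .bot c} := by
  ext (i | i) <;> simp [hs]

theorem forall_subset_pair_weight_le_iff {Q : Type} [Fintype Q] [Quiver.{0} Q] {P : Set Q}
    {α : Q → ℝ} {θ : ℝ} {y z : Q} (hyz : α.support = {y, z})
    (hθ : ∑ x, α x = θ * (gen P {y, z}).ncard) :
    (∀ T ⊆ {y, z}, weight α T ≤ θ * (gen P T).ncard) ↔
      α y ≤ θ * (gen P {y}).ncard ∧ α z ≤ θ * (gen P {z}).ncard := by
  simp only [← weight_singleton α]
  refine ⟨fun h => ⟨h _ (by simp), h _ (by simp)⟩, fun ⟨hy, hz⟩ T hT => ?_⟩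
  obtain rfl | rfl | rfl | rfl := Set.subset_pair_iff_eq.mp hT
  · simp [weight_empty, gen_empty]
  · exact hy
  · exact hz
  · rw [← hθ, ← hyz, weight, Set.indicator_support]

theorem block_pair_mem_blockClass_iff {a c : Fin (ℓ + 1)} {b d : ℕ} (hca : c < a) (hdb : d ≤ b)
    (hb : b ≤ ℓ + 1) :
    block ℓ a b c d ∈ blockClass ℓ (b - a.val + (d - c.val)) {.top a, .bot c} ↔
      a.val - c.val < d - c.val := by
  refine ⟨fun h => ?_, fun h => block_pair_mem_blockClass hca (by lia) hdb hb⟩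
  obtain ⟨b', d', -, had, -, -, -, heq⟩ := mem_blockClass_pair.mp h
  have ha : .bot a ∈ block ℓ a b c d := heq ▸ bot_mem_block.mpr ⟨hca.le, had⟩
  rw [bot_mem_block] at ha
  lia

theorem isolates_pairCharge (K : Type u) [Field K] (ht : IsAdmissibleParam t) {a c : Fin (ℓ + 1)}
    (hca : c < a) (hk : a.val - c.val < k) :
    Isolates K (pairCharge a c (t k (a.val - c.val))) k {.top a, .bot c} := by
  have hpos := (ht.bounds hk).1
  have hk₀ : (k : ℝ) ≠ 0 := by exact_mod_cast (Nat.zero_le _ |>.trans_lt hk).ne'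
  rw [← support_pairCharge a c hpos.ne']
  refine isolates_of_forall_isBlock (pairCharge_nonneg a c hpos.le) ?_ ?_ (by lia) ?_
  · rw [support_pairCharge a c hpos.ne', linearIndepOn_pair_iff _ (by simp) (by simp)]
    intro r hr
    exact (ht k _ hk).1 ⟨r, by simpa [Rat.smul_def] using hr⟩
  · rw [sum_pairCharge]
    positivity
  · rw [support_pairCharge a c hpos.ne', sum_pairCharge]
    rintro _ ⟨a', b, c', d, hs, rfl⟩ hsub hcard
    have ha := hsub (Or.inl rfl)
    have hc := hsub (Or.inr rfl)
    have hab := top_mem_block.mp ha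
    have hcd := bot_mem_block.mp hc
    have hs : b ≤ ℓ + 1 ∧ c' ≤ a' ∧ d ≤ b := by unfold BlockShape at hs; lia
    rw [forall_subset_pair_weight_le_iff (support_pairCharge a c hpos.ne') (by
      rw [sum_pairCharge, hcard, div_mul_cancel₀ _ hk₀])]
    rw [gen_block_pair ha hc hca.le, ncard_block (by lia) (by lia)] at hcard
    subst hcard
    rw [gen_block_pair ha hc hca.le, gen_block_top ha (by lia), gen_block_bot hc,
      ncard_block (by lia) (by lia), ncard_block (by lia) (by lia)]
    have hsub : d - a.val = d - c.val - (a.val - c.val) := by lia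
    rw [block_pair_mem_blockClass_iff hca hs.2.2 hs.1, hsub,
      ← ht.slope_le_iff (Nat.sub_pos_of_lt hab.2) hk]
    simp

theorem IsLadderCharge.isolates (K : Type u) [Field K] (ht : IsAdmissibleParam t)
    {S : Set (LadderVertex ℓ)} {α : LadderVertex ℓ → ℝ} (hα : IsLadderCharge t k S α)
    (hne : (blockClass ℓ k S).Nonempty) : Isolates K α k S := by
  obtain ⟨R, hR⟩ := hne
  obtain ⟨x, rfl, rfl⟩ | ⟨a, c, hca, rfl, rfl⟩ := hα
  · obtain ⟨-, rfl, hmin⟩ := hR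
    have hx : x ∈ minSet R := hmin ▸ rfl
    exact isolates_skyscraper K ((Set.ncard_pos).mpr ⟨x, hx.1⟩) x
  · obtain ⟨b, d, -, had, hdb, -, hk, -⟩ := mem_blockClass_pair.mp hR
    exact isolates_pairCharge K ht hca (by lia)

end Isolation

section Dual

variable {ℓ k : ℕ}

open Classical in
theorem exists_linearMap_indicator_block {b : ℕ} (hb : b ≤ ℓ + 1) :
    ∃ φ : (LadderVertex ℓ → ℝ) →ₗ[ℝ] ℝ, ∀ a b' c d, a < b → b' ≤ ℓ + 1 →
      φ ((block ℓ a b' c d).indicator 1) = if b' = b then 1 else 0 := by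
  refine ⟨(if h : 0 < b then LinearMap.proj (.top ⟨b - 1, by lia⟩) else 0) -
    (if h : b < ℓ + 1 then LinearMap.proj (.top ⟨b, h⟩) else 0), fun a b' c d hab hb' => ?_⟩
  simp only [LinearMap.sub_apply]
  split_ifs <;> simp [Set.indicator_apply, top_mem_block] <;> grind

open Classical in
theorem exists_dual_of_block {a b c d : ℕ} (hab : a < b) (hb : b ≤ ℓ + 1)
    {C : Set (Set (LadderVertex ℓ))} (hC : ∀ R ∈ C, ∃ b' d', b' ≤ ℓ + 1 ∧
      R = block ℓ a b' c d' ∧ (b' = b → d' = d)) :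
    ∃ φ : (LadderVertex ℓ → ℝ) →ₗ[ℝ] ℝ, ∀ R ∈ C,
      φ (R.indicator 1) = if R = block ℓ a b c d then 1 else 0 := by
  obtain ⟨φ, hφ⟩ := exists_linearMap_indicator_block hb
  refine ⟨φ, fun R hR => ?_⟩
  obtain ⟨b', d', hb', rfl, hbd⟩ := hC R hR
  obtain rfl | hne := eq_or_ne b' b
  · rw [hbd rfl, if_pos rfl, hφ a b' c d hab hb', if_pos rfl]
  · have hblock : block ℓ a b' c d' ≠ block ℓ a b c d := by
      intro h
      have hval := hφ a b' c d' hab hb'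
      rw [h, hφ a b c d hab hb, if_pos rfl, if_neg hne] at hval
      exact one_ne_zero hval
    rw [hφ a b' c d' hab hb', if_neg hne, if_neg hblock]

open Classical in
theorem exists_dual_blockClass {S R : Set (LadderVertex ℓ)} (hR : R ∈ blockClass ℓ k S) :
    ∃ φ : (LadderVertex ℓ → ℝ) →ₗ[ℝ] ℝ, ∀ R' ∈ blockClass ℓ k S,
      φ (R'.indicator 1) = if R' = R then 1 else 0 := by
  obtain ⟨x, rfl⟩ | ⟨a, c, -, rfl⟩ := hR.2.2 ▸ hR.1.minSet_eq
  · rcases x with a | c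
    · obtain ⟨b, d, hab, hb, had, -, rfl, rfl⟩ := mem_blockClass_top.mp hR
      refine exists_dual_of_block hab hb fun R' hR' => ?_
      obtain ⟨b', d', -, hb', had', -, hk, rfl⟩ := mem_blockClass_top.mp hR'
      exact ⟨b', d', hb', rfl, by lia⟩
    · refine ⟨LinearMap.proj (.bot c), fun R' hR' => ?_⟩
      obtain ⟨-, hk, rfl⟩ := mem_blockClass_bot.mp hR
      obtain ⟨-, -, rfl⟩ := mem_blockClass_bot.mp hR'
      simp [bot_mem_block, hk]
  · obtain ⟨b, d, hca, had, hdb, hb, rfl, rfl⟩ := mem_blockClass_pair.mp hR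
    refine exists_dual_of_block (by lia) hb fun R' hR' => ?_
    obtain ⟨b', d', -, had', -, hb', hk, rfl⟩ := mem_blockClass_pair.mp hR'
    exact ⟨b', d', hb', rfl, by lia⟩

end Dual

/-! ### Completeness -/

namespace QuiverRep

variable {K : Type u} [Field K] {Q : Type} [Quiver.{0} Q] {P : Set Q} {U V W : QuiverRep K Q}
  {x y z : Q}

theorem isZero_iff_dimVec_eq_zero : V.IsZero ↔ V.dimVec = 0 := by
  simp only [IsZero, funext_iff, dimVec, Pi.zero_apply, Module.finrank_zero_iff]

/-- The vertices `x` and `y` are connected by a zigzag of paths between members of `P`. -/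
def Zigzag (P : Set Q) (x y : Q) : Prop :=
  Relation.EqvGen (fun x y => x ∈ P ∧ y ∈ P ∧ Reaches x y) x y

theorem IsRetract.dimVec_le_of_reaches (h : IsRetract W (thin K P)) (hP : PathConvex P)
    (hx : x ∈ P) (hy : y ∈ P) (hxy : Reaches x y) : W.dimVec x ≤ W.dimVec y := by
  obtain ⟨p⟩ := hxy
  obtain ⟨ι, π, hπ⟩ := h
  refine LinearMap.finrank_le_finrank_of_injective (f := W.mapPath p)
    ((injective_iff_map_eq_zero _).mpr fun w hw => ?_)
  have hι : ι.app x w = 0 := by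
    refine Subtype.ext ((thin_mapPath hP p hx hy (ι.app x w)).symm.trans ?_)
    rw [← ι.app_mapPath, hw, map_zero]
    rfl
  rw [← hπ x w, hι, map_zero]

open Classical in
theorem dimVec_add_dimVec_of_thin (h : (thin K P).Isomorphic (U.prod W)) (x : Q) :
    U.dimVec x + W.dimVec x = if x ∈ P then 1 else 0 := by
  rw [← dimVec_thin (K := K), h.dimVec_eq, dimVec_prod, Pi.add_apply]

theorem dimVec_eq_of_zigzag (hP : PathConvex P) (h : (thin K P).Isomorphic (U.prod W))
    (hxy : Zigzag P x y) : U.dimVec x = U.dimVec y := by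
  induction hxy with
  | refl x => rfl
  | symm x y _ ih => exact ih.symm
  | trans x y z _ _ ih ih' => exact ih.trans ih'
  | rel x y hxy =>
    obtain ⟨hx, hy, hxy⟩ := hxy
    have hU := (isRetract_of_isomorphic_prod
      (h.trans (isomorphic_prod_comm U W))).dimVec_le_of_reaches hP hx hy hxy
    have hW := (isRetract_of_isomorphic_prod h).dimVec_le_of_reaches hP hx hy hxy
    have hsum_x := dimVec_add_dimVec_of_thin h x
    have hsum_y := dimVec_add_dimVec_of_thin h y
    rw [if_pos hx] at hsum_x
    rw [if_pos hy] at hsum_y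
    lia

theorem isZero_of_dimVec_eq_zero (hP : PathConvex P) (hconn : ∀ x ∈ P, Zigzag P x z)
    (h : (thin K P).Isomorphic (U.prod W)) (hz : U.dimVec z = 0) : U.IsZero := by
  rw [isZero_iff_dimVec_eq_zero]
  funext x
  by_cases hx : x ∈ P
  · exact (dimVec_eq_of_zigzag hP h (hconn x hx)).trans hz
  · have hsum := dimVec_add_dimVec_of_thin h x
    rw [if_neg hx] at hsum
    exact (Nat.add_eq_zero_iff.mp hsum).1

theorem isIndecomposable_thin (hP : PathConvex P) (hz : z ∈ P)
    (hconn : ∀ x ∈ P, Zigzag P x z) : (thin K P).IsIndecomposable := by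
  classical
  refine ⟨fun h => ?_, fun U W hUW => ?_⟩
  · have hdim := congrFun (isZero_iff_dimVec_eq_zero.mp h) z
    rw [dimVec_thin, if_pos hz] at hdim
    exact one_ne_zero hdim
  · have hsum := dimVec_add_dimVec_of_thin hUW z
    rw [if_pos hz] at hsum
    obtain hU | hW : U.dimVec z = 0 ∨ W.dimVec z = 0 := by lia
    · exact Or.inl (isZero_of_dimVec_eq_zero hP hconn hUW hU)
    · exact Or.inr
        (isZero_of_dimVec_eq_zero hP hconn (hUW.trans (isomorphic_prod_comm U W)) hW)

theorem minSupport_thin (P : Set Q) : (thin K P).minSupport = minSet P := by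
  unfold minSupport minSet
  rw [support_thin]

theorem Isomorphic.minSupport_eq (h : V.Isomorphic W) : V.minSupport = W.minSupport := by
  unfold minSupport
  rw [h.support_eq]

end QuiverRep

section LadderClass

variable {K : Type u} [Field K] {ℓ k : ℕ} {P R S : Set (LadderVertex ℓ)} {t : ℕ → ℕ → ℝ}

theorem IsBlock.exists_forall_zigzag (h : IsBlock P) : ∃ z ∈ P, ∀ x ∈ P, Zigzag P x z := by
  have of_reaches {x y : LadderVertex ℓ} (hx : x ∈ P) (hy : y ∈ P) (hxy : Reaches x y) :
      Zigzag P x y := .rel _ _ ⟨hx, hy, hxy⟩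
  obtain ⟨a, b, d, hab, -, -, -, rfl⟩ | ⟨a, c, b, d, hca, had, hdb, -, rfl⟩ |
    ⟨c, d, hcd, -, rfl⟩ := h.eq_block
  · have ha : .top a ∈ block ℓ a b a d := top_mem_block.mpr ⟨le_rfl, hab⟩
    refine ⟨_, ha, ?_⟩
    rintro (i | j) hx
    · exact (of_reaches ha hx (reaches_top_top (top_mem_block.mp hx).1)).symm
    · exact (of_reaches ha hx (reaches_top_bot (bot_mem_block.mp hx).1)).symm
  · have ha : .top a ∈ block ℓ a b c d := top_mem_block.mpr ⟨le_rfl, by lia⟩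
    have hc : .bot c ∈ block ℓ a b c d := bot_mem_block.mpr ⟨le_rfl, by lia⟩
    have hz : .bot a ∈ block ℓ a b c d := bot_mem_block.mpr ⟨by lia, had⟩
    refine ⟨_, hz, ?_⟩
    rintro (i | j) hx
    · exact (of_reaches ha hx (reaches_top_top (top_mem_block.mp hx).1)).symm.trans
        _ _ _ (of_reaches ha hz (reaches_top_bot le_rfl))
    · exact (of_reaches hc hx (reaches_bot_bot (bot_mem_block.mp hx).1)).symm.trans
        _ _ _ (of_reaches hc hz (reaches_bot_bot hca.le))
  · have hc : .bot c ∈ block ℓ 0 0 c d := bot_mem_block.mpr ⟨le_rfl, hcd⟩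
    refine ⟨_, hc, ?_⟩
    rintro (i | j) hx
    · exact absurd (top_mem_block.mp hx).2 (Nat.not_lt_zero _)
    · exact (of_reaches hc hx (reaches_bot_bot (bot_mem_block.mp hx).1)).symm

theorem IsBlock.isIndecomposable_thin (K : Type u) [Field K] (h : IsBlock P) :
    (thin K P).IsIndecomposable := by
  obtain ⟨z, hz, hconn⟩ := h.exists_forall_zigzag
  exact QuiverRep.isIndecomposable_thin h.pathConvex hz hconn

theorem IsBlock.isNestfree_thin (K : Type u) [Field K] (h : IsBlock P) :
    IsNestfree (thin K P) := by
  classical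
  have dimVec_le_one (x : LadderVertex ℓ) : (thin K P).dimVec x ≤ 1 := by
    rw [dimVec_thin]
    split_ifs <;> simp
  exact ⟨thin_isEqualised h.pathConvex,
    hasNoNestedIntervals_of_dimVec_le_one fun _ => dimVec_le_one _,
    hasNoNestedIntervals_of_dimVec_le_one fun _ => dimVec_le_one _⟩

theorem thin_mem_ladderClass (K : Type u) [Field K] (hR : R ∈ blockClass ℓ k S) :
    thin K R ∈ ladderClass K ℓ k S :=
  ⟨hR.1.isIndecomposable_thin K, hR.1.isNestfree_thin K, (totalDim_thin R).trans hR.2.1,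
    (minSupport_thin R).trans hR.2.2⟩

theorem exists_isomorphic_thin_of_mem_ladderClass {V : QuiverRep K (LadderVertex ℓ)}
    (hV : V ∈ ladderClass K ℓ k S) : ∃ R ∈ blockClass ℓ k S, V.Isomorphic (thin K R) := by
  obtain ⟨⟨hne, hind⟩, hnf, hk, hS⟩ := hV
  obtain ⟨l, hl, hiso⟩ := hnf.exists_isomorphic_thinSum
  cases l with
  | nil =>
    refine absurd ?_ hne
    rw [isZero_iff_dimVec_eq_zero, hiso.dimVec_eq]
    exact isZero_iff_dimVec_eq_zero.mp isZero_zero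
  | cons R l =>
    have hR := hl R List.mem_cons_self
    have hl_zero := (hind _ _ hiso).resolve_left (hR.isIndecomposable_thin K).1
    have hiso' : V.Isomorphic (thin K R) := hiso.trans (isomorphic_prod_of_isZero _ hl_zero)
    refine ⟨R, ⟨hR, ?_, ?_⟩, hiso'⟩
    · rw [← hk, hiso'.totalDim_eq, totalDim_thin]
    · rw [← hS, hiso'.minSupport_eq, minSupport_thin]

theorem ladderClass_nonempty_iff : (ladderClass K ℓ k S).Nonempty ↔ (blockClass ℓ k S).Nonempty :=
  ⟨fun ⟨_, hV⟩ => let ⟨R, hR, _⟩ := exists_isomorphic_thin_of_mem_ladderClass hV; ⟨R, hR⟩,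
    fun ⟨_, hR⟩ => ⟨_, thin_mem_ladderClass K hR⟩⟩

theorem IsBlock.existsUnique_isLadderCharge (h : IsBlock R) (k : ℕ) :
    ∃! α, IsLadderCharge t k (minSet R) α := by
  obtain ⟨x, hx⟩ | ⟨a, c, hca, hac⟩ := h.minSet_eq
  · rw [hx]
    refine ⟨skyscraper x, Or.inl ⟨x, rfl, rfl⟩, ?_⟩
    rintro α (⟨y, hy, rfl⟩ | ⟨a, c, -, hac, -⟩)
    · rw [Set.singleton_eq_singleton_iff.mp hy]
    · exact absurd hac singleton_ne_pair
  · rw [hac]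
    refine ⟨_, Or.inr ⟨a, c, hca, rfl, rfl⟩, ?_⟩
    rintro α (⟨x, hx, -⟩ | ⟨a', c', -, hac', rfl⟩)
    · exact absurd hx.symm singleton_ne_pair
    · obtain ⟨rfl, rfl⟩ : a = a' ∧ c = c' := by simpa [Set.pair_eq_pair_iff] using hac'
      rfl

theorem existsUnique_isLadderCharge (h : (ladderClass K ℓ k S).Nonempty) :
    ∃! α, IsLadderCharge t k S α := by
  obtain ⟨R, hR⟩ := ladderClass_nonempty_iff.mp h
  rw [← hR.2.2]
  exact hR.1.existsUnique_isLadderCharge k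

end LadderClass

section Completeness

/-- The counts determine the multiplicities by downward induction on the partial order. -/
theorem perm_of_countP_eq {ι : Type*} [Finite ι] [PartialOrder ι]
    {rel : ι → ι → Prop} [DecidableRel rel] {p : ι → Prop} (hrefl : ∀ x, p x → rel x x)
    (hle : ∀ x y, rel x y → x ≤ y) {l l' : List ι} (hl : ∀ x ∈ l, p x) (hl' : ∀ x ∈ l', p x)
    (h : ∀ x, p x → l.countP (rel x ·) = l'.countP (rel x ·)) : l.Perm l' := by
  classical
  have countP_eq (m : List ι) {x : ι} (hx : p x) :
      m.countP (rel x ·) = m.count x + (m.filter (x < ·)).countP (rel x ·) := by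
    induction m with
    | nil => rfl
    | cons y m ih =>
      have hle_xy := hle x y
      have hrel_self := hrefl x hx
      grind [lt_iff_le_and_ne]
  rw [List.perm_iff_count]
  intro x
  induction x using WellFoundedGT.induction with
  | ind x ih =>
    by_cases hx : p x
    · have hperm : (l.filter (x < ·)).Perm (l'.filter (x < ·)) := by
        rw [List.perm_iff_count]
        intro y
        by_cases hxy : x < y
        · rw [List.count_filter (by simpa), List.count_filter (by simpa), ih y hxy]
        · rw [List.count_eq_zero_of_not_mem (by simp [hxy]),
            List.count_eq_zero_of_not_mem (by simp [hxy])]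
      have hcount := h x hx
      rw [countP_eq l hx, countP_eq l' hx, hperm.countP_eq] at hcount
      exact Nat.add_right_cancel hcount
    · rw [List.count_eq_zero_of_not_mem (mt (hl x) hx),
        List.count_eq_zero_of_not_mem (mt (hl' x) hx)]

theorem apply_cast_sum_eq_countP {ι Q : Type*} (φ : (Q → ℝ) →ₗ[ℝ] ℝ) {D : ι → Q → ℕ}
    {q : ι → Prop} [DecidablePred q] {l : List ι}
    (h : ∀ i ∈ l, φ (fun x => (D i x : ℝ)) = if q i then 1 else 0) :
    φ (fun x => ((l.map D).sum x : ℝ)) = l.countP (q ·) := by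
  induction l with
  | nil => exact (congrArg φ (by ext; simp)).trans ((map_zero φ).trans (by simp))
  | cons i l ih =>
    have hsplit : (fun x => (((i :: l).map D).sum x : ℝ)) =
        (fun x => (D i x : ℝ)) + fun x => ((l.map D).sum x : ℝ) := by
      funext x
      simp
    rw [hsplit, map_add, ih fun j hj => h j (List.mem_cons_of_mem i hj), h i List.mem_cons_self,
      List.countP_cons]
    split_ifs <;> simp_all [add_comm]

variable {K : Type u} [Field K] {ℓ : ℕ} {R : Set (LadderVertex ℓ)} {t : ℕ → ℕ → ℝ}

open Classical in
theorem IsBlock.exists_countP_eq (K : Type u) [Field K] (ht : IsAdmissibleParam t)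
    (hR : IsBlock R) :
    ∃ α ∈ ladderCharges K ℓ t, ∃ F : List (LadderVertex ℓ → ℕ) → ℝ,
      ∀ (V : QuiverRep K (LadderVertex ℓ)) (l : List (Set (LadderVertex ℓ))),
        (∀ P ∈ l, IsBlock P) → V.Isomorphic (thinSum K l) →
          F (V.hnType α) = l.countP (gen · (minSet R) = R) := by
  have hmem : R ∈ blockClass ℓ R.ncard (minSet R) := ⟨hR, rfl, rfl⟩
  obtain ⟨α, hα, -⟩ := hR.existsUnique_isLadderCharge (t := t) R.ncard
  obtain ⟨θ, hθ⟩ := hα.isolates K ht ⟨R, hmem⟩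
  obtain ⟨φ, hφ⟩ := exists_dual_blockClass hmem
  refine ⟨α, ⟨_, _, ⟨_, thin_mem_ladderClass K hmem⟩, hα⟩,
    fun L => φ fun x => (partOfSlope α θ L x : ℝ), fun V l hl hV => ?_⟩
  have hpart := (hV.symm.hasPart (hasPart_thinSum fun P hP => hθ P (hl P hP))).unique
    (hasPart_hnType α θ V)
  beta_reduce
  rw [← hpart]
  refine apply_cast_sum_eq_countP φ fun P _ => ?_
  by_cases hP : gen P (minSet R) ∈ blockClass ℓ R.ncard (minSet R)
  · rw [← hφ _ hP, if_pos hP]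
    congr 1
    funext x
    simp [Set.indicator_apply]
  · rw [if_neg hP, if_neg fun h : gen P (minSet R) = R => hP (h.symm ▸ hmem)]
    exact (congrArg φ (by ext; simp)).trans (map_zero φ)

theorem isCompleteOn_ladderCharges (ht : IsAdmissibleParam t) :
    QuiverRep.IsCompleteOn (ladderCharges K ℓ t)
      (fun V : QuiverRep K (LadderVertex ℓ) => IsNestfree V) := by
  classical
  intro V W hV hW hVW
  obtain ⟨l, hl, hVl⟩ := hV.exists_isomorphic_thinSum
  obtain ⟨l', hl', hWl⟩ := hW.exists_isomorphic_thinSum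
  refine hVl.trans ((thinSum_perm ?_).trans hWl.symm)
  refine perm_of_countP_eq (rel := fun R P => gen P (minSet R) = R) (fun R hR => hR.gen_minSet)
    (fun R P h => h ▸ fun x hx => hx.1) hl hl' fun R hR => ?_
  obtain ⟨α, hα, F, hF⟩ := hR.exists_countP_eq K ht
  rw [← Nat.cast_inj (R := ℝ), ← hF V l hl hVl, ← hF W l' hl' hWl, hVW α hα]

end Completeness

section LinearIndependence

variable {K : Type u} [Field K] {ℓ : ℕ} {P : Set (LadderVertex ℓ)}

theorem dimVec_eq_indicator {V : QuiverRep K (LadderVertex ℓ)} (h : V.Isomorphic (thin K P)) :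
    (fun x => (V.dimVec x : ℝ)) = P.indicator 1 := by
  classical
  funext x
  rw [h.dimVec_eq, dimVec_thin]
  simp [Set.indicator_apply]

theorem linearIndepOn_dimVec_ladderClass (K : Type u) [Field K] (k : ℕ)
    (S : Set (LadderVertex ℓ)) :
    LinearIndepOn ℝ id ((fun (V : QuiverRep K (LadderVertex ℓ)) x => (V.dimVec x : ℝ)) ''
      ladderClass K ℓ k S) := by
  have exists_block : ∀ v : (fun (V : QuiverRep K (LadderVertex ℓ)) x => (V.dimVec x : ℝ)) ''
      ladderClass K ℓ k S, ∃ R ∈ blockClass ℓ k S, v.1 = R.indicator 1 := by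
    rintro ⟨_, V, hV, rfl⟩
    obtain ⟨R, hR, hiso⟩ := exists_isomorphic_thin_of_mem_ladderClass hV
    exact ⟨R, hR, dimVec_eq_indicator hiso⟩
  choose R hR hv using exists_block
  choose φ hφ using fun v => exists_dual_blockClass (hR v)
  refine LinearIndependent.of_pairwise_dual_eq_zero_one _ φ (fun v w hvw => ?_) fun v => ?_
  · refine (congrArg (φ v) (hv w)).trans ((hφ v _ (hR w)).trans (if_neg fun h => hvw ?_))
    rw [Subtype.ext_iff, hv v, hv w, h]
  · exact (congrArg (φ v) (hv v)).trans ((hφ v _ (hR v)).trans (if_pos rfl))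

end LinearIndependence

/-! ### The number of central charges -/

section Count

variable {ℓ : ℕ}

theorem skyscraper_injective : Function.Injective (skyscraper : LadderVertex ℓ → _) :=
  fun x y h => by simpa [skyscraper, Pi.single_apply] using congrFun h x

theorem pairCharge_inj {a c a' c' : Fin (ℓ + 1)} {s s' : ℝ} (hs : s ≠ 0) :
    pairCharge a c s = pairCharge a' c' s' ↔ a = a' ∧ c = c' ∧ s = s' := by
  refine ⟨fun h => ?_, fun ⟨ha, hc, hs⟩ => ha ▸ hc ▸ hs ▸ rfl⟩
  have htop := congrFun h (.top a)
  have hbot := congrFun h (.bot c)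
  simp only [pairCharge_top, pairCharge_bot, if_true] at htop hbot
  split_ifs at htop hbot <;> simp_all

theorem skyscraper_ne_pairCharge {a c : Fin (ℓ + 1)} {s : ℝ} (hs : s ≠ 0) (x : LadderVertex ℓ) :
    skyscraper x ≠ pairCharge a c s := by
  intro h
  have htop := congrFun h (.top a)
  have hbot := congrFun h (.bot c)
  rcases x with i | i <;> simp_all [skyscraper, Pi.single_apply]

theorem exists_blockClass_singleton_nonempty (x : LadderVertex ℓ) :
    ∃ k, (blockClass ℓ k {x}).Nonempty := by
  rcases x with a | c
  · exact ⟨_, _, block_top_mem_blockClass a.val.lt_succ_self (by lia) le_rfl (by lia)⟩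
  · exact ⟨_, _, block_bot_mem_blockClass c.val.lt_succ_self (by lia)⟩

theorem blockClass_pair_nonempty_iff {a c : Fin (ℓ + 1)} {k : ℕ} (hca : c < a) :
    (blockClass ℓ k {.top a, .bot c}).Nonempty ↔
      ∃ n < 2 * (ℓ - a.val) + 1, a.val - c.val + 2 + n = k := by
  constructor
  · rintro ⟨R, hR⟩
    obtain ⟨b, d, -, had, hdb, hb, rfl, -⟩ := mem_blockClass_pair.mp hR
    exact ⟨(b - a.val - 1) + (d - a.val - 1), by lia, by lia⟩
  · rintro ⟨n, hn, rfl⟩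
    exact ⟨_, mem_blockClass_pair.mpr ⟨a.val + 1 + (n - n / 2), a.val + 1 + n / 2, hca, by lia,
      by lia, by lia, by lia, rfl⟩⟩

/-- The triples `(a, c, n)` such that `x_a^+` and `x_c^-` are the minimal vertices of a block of
size `a - c + 2 + n`. The least such block has `n = 0`. -/
def pairIndex (ℓ : ℕ) : Finset ((_ : Fin (ℓ + 1)) × Fin (ℓ + 1) × ℕ) :=
  Finset.univ.sigma fun a => Finset.Iio a ×ˢ Finset.range (2 * (ℓ - a.val) + 1)

/-- The central charge `α_S^k` for the pair `S` and the size `k` indexed by `p`. -/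
noncomputable def indexedCharge (t : ℕ → ℕ → ℝ) (p : (_ : Fin (ℓ + 1)) × Fin (ℓ + 1) × ℕ) :
    LadderVertex ℓ → ℝ :=
  pairCharge p.1 p.2.1 (t (p.1.val - p.2.1.val + 2 + p.2.2) (p.1.val - p.2.1.val))

theorem mem_pairIndex {a c : Fin (ℓ + 1)} {n : ℕ} :
    ⟨a, c, n⟩ ∈ pairIndex ℓ ↔ c < a ∧ n < 2 * (ℓ - a.val) + 1 := by
  simp [pairIndex]

theorem six_mul_card_pairIndex (ℓ : ℕ) : 6 * (pairIndex ℓ).card = 2 * ℓ ^ 3 + 3 * ℓ ^ 2 + ℓ := by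
  have hsum : 6 * ∑ a ∈ Finset.range (ℓ + 1), a * (2 * (ℓ - a) + 1) =
      2 * ℓ ^ 3 + 3 * ℓ ^ 2 + ℓ := by
    induction ℓ with
    | zero => rfl
    | succ ℓ ih =>
      have hstep : ∀ a ∈ Finset.range (ℓ + 1),
          a * (2 * (ℓ + 1 - a) + 1) = a * (2 * (ℓ - a) + 1) + a * 2 := by
        intro a ha
        rw [Nat.sub_add_comm (Finset.mem_range_succ_iff.mp ha)]
        ring
      rw [Finset.sum_range_succ, Finset.sum_congr rfl hstep, Finset.sum_add_distrib,
        ← Finset.sum_mul, Finset.sum_range_id_mul_two, Nat.sub_self, mul_add, mul_add, ih,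
        Nat.add_sub_cancel]
      ring
  rw [pairIndex, Finset.card_sigma]
  simp only [Finset.card_product, Fin.card_Iio, Finset.card_range]
  rw [Fin.sum_univ_eq_sum_range fun a => a * (2 * (ℓ - a) + 1), hsum]

theorem card_ladderVertex (ℓ : ℕ) : Fintype.card (LadderVertex ℓ) = 2 * (ℓ + 1) := by
  have bijective_coord : Function.Bijective (LadderVertex.coord (ℓ := ℓ)) := by
    refine ⟨?_, ?_⟩
    · rintro (i | i) (j | j) h <;> simp_all [LadderVertex.coord]
    · rintro ⟨_ | _, i⟩
      exacts [⟨.top i, rfl⟩, ⟨.bot i, rfl⟩]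
  rw [Fintype.card_of_bijective bijective_coord, Fintype.card_prod, Fintype.card_bool,
    Fintype.card_fin]

theorem ladderCharges_eq (K : Type u) [Field K] (t : ℕ → ℕ → ℝ) :
    ladderCharges K ℓ t = Set.range skyscraper ∪ indexedCharge t '' pairIndex ℓ := by
  ext α
  constructor
  · rintro ⟨k, S, hne, ⟨x, -, rfl⟩ | ⟨a, c, hca, rfl, rfl⟩⟩
    · exact Or.inl ⟨x, rfl⟩
    · obtain ⟨n, hn, rfl⟩ := (blockClass_pair_nonempty_iff hca).mp (ladderClass_nonempty_iff.mp hne)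
      exact Or.inr ⟨⟨a, c, n⟩, mem_pairIndex.mpr ⟨hca, hn⟩, rfl⟩
  · rintro (⟨x, rfl⟩ | ⟨⟨a, c, n⟩, hp, rfl⟩)
    · obtain ⟨k, hk⟩ := exists_blockClass_singleton_nonempty x
      exact ⟨k, {x}, ladderClass_nonempty_iff.mpr hk, Or.inl ⟨x, rfl, rfl⟩⟩
    · obtain ⟨hca, hn⟩ := mem_pairIndex.mp hp
      exact ⟨_, _, ladderClass_nonempty_iff.mpr
        ((blockClass_pair_nonempty_iff hca).mpr ⟨n, hn, rfl⟩), Or.inr ⟨a, c, hca, rfl, rfl⟩⟩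

theorem finite_ladderCharges (K : Type u) [Field K] (t : ℕ → ℕ → ℝ) :
    (ladderCharges K ℓ t).Finite := by
  rw [ladderCharges_eq]
  exact (Set.finite_range _).union ((pairIndex ℓ).finite_toSet.image _)

theorem ncard_range_skyscraper (ℓ : ℕ) :
    (Set.range (skyscraper (ℓ := ℓ))).ncard = 2 * (ℓ + 1) := by
  rw [← Set.image_univ, Set.ncard_image_of_injective _ skyscraper_injective, Set.ncard_univ,
    Nat.card_eq_fintype_card, card_ladderVertex]

theorem ncard_ladderCharges_le (K : Type u) [Field K] (ℓ : ℕ) (t : ℕ → ℕ → ℝ) :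
    6 * (ladderCharges K ℓ t).ncard ≤ 2 * ℓ ^ 3 + 3 * ℓ ^ 2 + 13 * ℓ + 12 := by
  have hunion := Set.ncard_union_le (Set.range (skyscraper (ℓ := ℓ)))
    (indexedCharge t '' pairIndex ℓ)
  have himage := Set.ncard_image_le (f := indexedCharge t) (pairIndex ℓ).finite_toSet
  rw [Set.ncard_coe_finset] at himage
  rw [ncard_range_skyscraper] at hunion
  rw [ladderCharges_eq]
  linarith [six_mul_card_pairIndex ℓ]

variable {t : ℕ → ℕ → ℝ}

theorem IsAdmissibleParam.ne_zero (ht : IsAdmissibleParam t) {p q : ℕ} (hqp : q < p) :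
    t p q ≠ 0 :=
  (ht.bounds hqp).1.ne'

theorem IsAdmissibleParam.injOn_indexedCharge (ht : IsAdmissibleParam t)
    (hd : IsDistinctParam t) : Set.InjOn (indexedCharge (ℓ := ℓ) t) (pairIndex ℓ) := by
  rintro ⟨a, c, n⟩ - ⟨a', c', n'⟩ - h
  obtain ⟨rfl, rfl, hs⟩ := (pairCharge_inj (ht.ne_zero (by lia))).mp h
  have hn := hd (a.val - c.val) (Set.mem_ofPred_eq.mpr (by lia)) (Set.mem_ofPred_eq.mpr (by lia)) hs
  obtain rfl : n = n' := Nat.add_left_cancel hn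
  rfl

theorem ncard_ladderCharges_eq (K : Type u) [Field K] (ℓ : ℕ) (ht : IsAdmissibleParam t)
    (hd : IsDistinctParam t) :
    6 * (ladderCharges K ℓ t).ncard = 2 * ℓ ^ 3 + 3 * ℓ ^ 2 + 13 * ℓ + 12 := by
  have hdisj : Disjoint (Set.range (skyscraper (ℓ := ℓ))) (indexedCharge t '' pairIndex ℓ) := by
    rw [Set.disjoint_left]
    rintro _ ⟨x, rfl⟩ ⟨p, -, hp⟩
    exact skyscraper_ne_pairCharge (ht.ne_zero (by lia)) x hp.symm
  rw [ladderCharges_eq, Set.ncard_union_eq hdisj (Set.finite_range _)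
    ((pairIndex ℓ).finite_toSet.image _), ncard_range_skyscraper,
    (ht.injOn_indexedCharge hd).ncard_image, Set.ncard_coe_finset, mul_add,
    six_mul_card_pairIndex]
  ring

/-- For fixed `q`, the interval around `t_{p,q}` moves downwards as `p` grows, and those of `p` and
`p + 2` no longer meet as long as `p ≤ 2 * q`. -/
theorem IsAdmissibleParam.lt_of_add_two_le (ht : IsAdmissibleParam t) {q m m' : ℕ} (hm : 0 < m)
    (hmq : m ≤ q) (hmm' : m + 2 ≤ m') : t (q + m') q < t (q + m) q := by
  have hupper := (ht (q + m') q (by lia)).2.2 (by lia)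
  have hlower := (ht (q + m) q (by lia)).2.1
  have hm_one : (1 : ℝ) ≤ m := by exact_mod_cast hm
  have hmq_real : (m : ℝ) ≤ q := by exact_mod_cast hmq
  have hmm'_real : (m : ℝ) + 2 ≤ m' := by exact_mod_cast hmm'
  refine (hupper.trans_le ?_).trans hlower
  push_cast
  rw [div_le_div_iff₀ (by linarith) (by linarith)]
  nlinarith

theorem IsAdmissibleParam.injOn_even (ht : IsAdmissibleParam t) (q : ℕ) :
    Set.InjOn (fun n => t (q + (2 + 2 * n)) q) {n | 2 + 2 * n ≤ q} := by
  have hanti : StrictAntiOn (fun n => t (q + (2 + 2 * n)) q) {n | 2 + 2 * n ≤ q} :=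
    fun n hn n' _ hlt => ht.lt_of_add_two_le (by lia) hn (by lia)
  exact hanti.injOn

theorem pow_le_ncard_ladderCharges (K : Type u) [Field K] (ht : IsAdmissibleParam t) {r : ℕ}
    (hr : 6 * r ≤ ℓ) : r ^ 3 ≤ (ladderCharges K ℓ t).ncard := by
  let index (p : Fin r × Fin r × Fin r) : (_ : Fin (ℓ + 1)) × Fin (ℓ + 1) × ℕ :=
    ⟨⟨ℓ - r - p.1, by lia⟩, ⟨p.2.1, by lia⟩, 2 * p.2.2⟩
  have index_mem (p : Fin r × Fin r × Fin r) : index p ∈ pairIndex ℓ :=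
    mem_pairIndex.mpr ⟨Fin.lt_def.mpr (by lia), by simp only; lia⟩
  have injective_charge : Function.Injective (indexedCharge t ∘ index) := by
    rintro ⟨u, v, n⟩ ⟨u', v', n'⟩ h
    obtain ⟨hu, hv, hs⟩ := (pairCharge_inj (ht.ne_zero (by lia))).mp h
    have hsub : ℓ - r - u = ℓ - r - u' := Fin.mk.inj hu
    obtain rfl : u = u' := by lia
    obtain rfl : v = v' := Fin.ext (Fin.mk.inj hv)
    have mem_even (m : Fin r) : (m : ℕ) ∈ {n | 2 + 2 * n ≤ ℓ - r - u - v} :=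
      Set.mem_ofPred_eq.mpr (by lia)
    have hn := ht.injOn_even _ (mem_even n) (mem_even n') (by simpa only [add_assoc] using hs)
    rw [Fin.ext hn]
  have hcard : Nat.card (Fin r × Fin r × Fin r) = r ^ 3 := by
    simp only [Nat.card_prod, Nat.card_fin]
    ring
  rw [← hcard, ← Set.ncard_univ, ← Set.ncard_image_of_injective _ injective_charge]
  refine Set.ncard_le_ncard ?_ (finite_ladderCharges K t)
  rintro _ ⟨p, -, rfl⟩
  rw [ladderCharges_eq]
  exact Or.inr ⟨index p, index_mem p, rfl⟩

theorem ncard_ladderCharges_isTheta (K : Type u) [Field K] (ht : IsAdmissibleParam t) :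
    (fun ℓ : ℕ => ((ladderCharges K ℓ t).ncard : ℝ)) =Θ[atTop] (fun ℓ : ℕ => (ℓ : ℝ) ^ 3) := by
  constructor
  · refine IsBigO.of_bound 5 ?_
    filter_upwards [eventually_ge_atTop 1] with ℓ hℓ
    have hle : (ladderCharges K ℓ t).ncard ≤ 5 * ℓ ^ 3 := by
      have hsq : ℓ ^ 2 ≤ ℓ ^ 3 := Nat.pow_le_pow_right hℓ (by norm_num)
      have hself : ℓ ≤ ℓ ^ 3 := Nat.le_self_pow three_ne_zero ℓ
      linarith [ncard_ladderCharges_le K ℓ t]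
    rw [Real.norm_of_nonneg (by positivity), Real.norm_of_nonneg (by positivity)]
    exact_mod_cast hle
  · refine IsBigO.of_bound (12 ^ 3) ?_
    filter_upwards [eventually_ge_atTop 6] with ℓ hℓ
    have hle : ℓ ^ 3 ≤ 12 ^ 3 * (ladderCharges K ℓ t).ncard :=
      calc
        ℓ ^ 3 ≤ (12 * (ℓ / 6)) ^ 3 := Nat.pow_le_pow_left (by lia) 3
        _ = 12 ^ 3 * (ℓ / 6) ^ 3 := mul_pow _ _ _
        _ ≤ 12 ^ 3 * (ladderCharges K ℓ t).ncard :=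
          Nat.mul_le_mul_left _ (pow_le_ncard_ladderCharges K ht (Nat.mul_div_le ℓ 6))
    rw [Real.norm_of_nonneg (by positivity), Real.norm_of_nonneg (by positivity)]
    exact_mod_cast hle

end Count

section Parameters

theorem irrational_div_sub {x : ℝ} (hx : Irrational x) {p : ℕ} (hp : p ≠ 0) :
    Irrational (x / (p - x)) := by
  have hpx : (p : ℝ) - x ≠ 0 := (hx.natCast_sub p).ne_zero
  have heq : x / (p - x) = p / (p - x) - (1 : ℕ) := by
    rw [Nat.cast_one]
    field_simp
    ring
  rw [heq]
  exact ((hx.natCast_sub p).natCast_div hp).sub_natCast 1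

theorem div_sub_lt_div_sub {x y p : ℝ} (hx : 0 ≤ x) (hxy : x < y) (hyp : y < p) :
    x / (p - x) < y / (p - y) := by
  rw [div_lt_div_iff₀ (by linarith) (by linarith)]
  nlinarith

variable {s : ℝ}

theorem isAdmissibleParam_of_irrational (hs : Irrational s) (hs₀ : 0 < s) (hs₁ : s < 1) :
    IsAdmissibleParam fun p q => (q + s) / (p - (q + s)) := by
  intro p q hqp
  have hqp_real : (q : ℝ) + 1 ≤ p := by exact_mod_cast hqp
  refine ⟨irrational_div_sub (hs.natCast_add q) (by lia),
    div_sub_lt_div_sub q.cast_nonneg (by linarith) (by linarith), fun hqp' => ?_⟩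
  exact div_sub_lt_div_sub (by positivity) (by linarith) (by exact_mod_cast hqp')

theorem isDistinctParam_of_pos (hs₀ : 0 < s) :
    IsDistinctParam fun p q => (q + s) / (p - (q + s)) := by
  intro q p _ p' _ h
  have hq : (q : ℝ) + s ≠ 0 := by positivity
  simpa only [div_eq_mul_inv, mul_right_inj' hq, inv_inj, sub_left_inj, Nat.cast_inj] using h

theorem exists_isAdmissibleParam_isDistinctParam :
    ∃ t : ℕ → ℕ → ℝ, IsAdmissibleParam t ∧ IsDistinctParam t := by
  obtain ⟨s, hs, hs₀, hs₁⟩ := exists_irrational_btwn zero_lt_one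
  exact ⟨_, isAdmissibleParam_of_irrational hs hs₀ hs₁, isDistinctParam_of_pos hs₀⟩

end Parameters

theorem theorem6p4 {K : Type u} [Field K] :
    (∃ t : ℕ → ℕ → ℝ, IsAdmissibleParam t ∧ IsDistinctParam t) ∧
    ∀ t : ℕ → ℕ → ℝ, IsAdmissibleParam t →
      (∀ ℓ : ℕ, 1 ≤ ℓ →
        (∀ (k : ℕ) (S : Set (LadderVertex ℓ)), (ladderClass K ℓ k S).Nonempty →
          ∃! α, IsLadderCharge t k S α) ∧
        (ladderCharges K ℓ t).Finite ∧
        QuiverRep.IsCompleteOn (ladderCharges K ℓ t)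
          (fun V : QuiverRep K (LadderVertex ℓ) => IsNestfree V) ∧
        (∀ (k : ℕ) (S : Set (LadderVertex ℓ)),
          LinearIndepOn ℝ id
            ((fun (V : QuiverRep K (LadderVertex ℓ)) x => (V.dimVec x : ℝ)) ''
              ladderClass K ℓ k S)) ∧
        6 * (ladderCharges K ℓ t).ncard ≤ 2 * ℓ ^ 3 + 3 * ℓ ^ 2 + 13 * ℓ + 12 ∧
        (IsDistinctParam t →
          6 * (ladderCharges K ℓ t).ncard = 2 * ℓ ^ 3 + 3 * ℓ ^ 2 + 13 * ℓ + 12)) ∧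
      (fun ℓ : ℕ => ((ladderCharges K ℓ t).ncard : ℝ)) =Θ[atTop] (fun ℓ : ℕ => (ℓ : ℝ) ^ 3) := by
  refine ⟨exists_isAdmissibleParam_isDistinctParam, fun t ht => ⟨fun ℓ _ => ⟨fun k S h =>
    existsUnique_isLadderCharge h, finite_ladderCharges K t, isCompleteOn_ladderCharges ht,
    linearIndepOn_dimVec_ladderClass K, ncard_ladderCharges_le K ℓ t,
    ncard_ladderCharges_eq K ℓ ht⟩, ncard_ladderCharges_isTheta K ht⟩⟩
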